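/- Let $\lambda_0,\lambda_1>0$ and let $\varepsilon(t)\in\{0,1\}$, $t\ge 0$, be the two-state continuous-time Markov chain with transition intensities $\lambda_0$ (from $0$ to $1$) and $\lambda_1$ (from $1$ to $0$). Let $a_i,\gamma_i\in\mathbb R$ with $\gamma_i\neq0$ ($i=0,1$), let $X$ be the Kac--Ornstein--Uhlenbeck process $$X(t)=X(0)+\int_0^t\big(a_{\varepsilon(s)}-\gamma_{\varepsilon(s)}X(s)\big)\,ds ,$$ and put $\rho_i=a_i/\gamma_i$, $\alpha_i=\lambda_i/\gamma_i$; assume $\rho_0<\rho_1$. A probability measure $\mu$ on $\mathbb R\times\{0,1\}$ is called invariant if for every $t\ge0$ it satisfies $\mu(B)=\int \mathbb P\{(X(t),\varepsilon(t))\in B\mid (X(0),\varepsilon(0))=z\}\,\mu(dz)$ for all Borel sets $B$. A pair $\vec\pi=(\pi_0,\pi_1)$ of nonnegative functions on an open half-line $K$ is called a stationary density on $K$ if $\int_K(\pi_0+\pi_1)\,dx=1$, $$(\gamma_0x-a_0)\pi_0'=(\lambda_0-\gamma_0)\pi_0-\lambda_1\pi_1,\qquad (\gamma_1x-a_1)\pi_1'=-\lambda_0\pi_0+(\lambda_1-\gamma_1)\pi_1\qquad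 (x\in K),$$ and $(a_i-\gamma_ix)\pi_i(x)\to0$, $i=0,1$, as $x\in K$ tends to the endpoint of $K$. Let $B(\cdot,\cdot)$ be Euler's beta function. 1. Let $\gamma_0>0>\gamma_1$. There is an invariant probability measure if and only if $\alpha_0+\alpha_1<0$, and there is a stationary density on $K=(-\infty,\rho_0)$ if and only if $\alpha_0+\alpha_1<0$. If $\alpha_0+\alpha_1<0$, then the invariant probability measure is unique and has the density (i.e. $\mu(A\times\{i\})=\int_A\pi_i(x)\,dx$) $$\pi_0(x)=C_0(\rho_0-x)^{-1+\alpha_0}(\rho_1-x)^{\alpha_1}\mathbf 1_{\{x<\rho_0\}},\qquad \pi_1(x)=C_1(\rho_0-x)^{\alpha_0}(\rho_1-x)^{-1+\alpha_1}\mathbf 1_{\{x<\rho_0\}},$$ where $C_0=c_0\gamma_0^{-1}>0$, $C_1=-c_0\gamma_1^{-1}>0$ and $$c_0^{-1}=(\rho_1-\rho_0)^{\alpha_0+\alpha_1}\big(\gamma_0^{-1}B(-\alpha_0-\alpha_1,\alpha_0)-\gamma_1^{-1}B(-\alpha_0-\alpha_1,1+\alpha_0)\big);$$ moreover $(\pi_0,\pi_1)$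 is the only stationary density on $K$. 2. Let $\gamma_0<0<\gamma_1$. There is an invariant probability measure if and only if $\alpha_0+\alpha_1<0$, and there is a stationary density on $K=(\rho_1,\infty)$ if and only if $\alpha_0+\alpha_1<0$. If $\alpha_0+\alpha_1<0$, then the invariant probability measure is unique and has the density $$\pi_0(x)=C_0(x-\rho_0)^{-1+\alpha_0}(x-\rho_1)^{\alpha_1}\mathbf 1_{\{x>\rho_1\}},\qquad \pi_1(x)=C_1(x-\rho_0)^{\alpha_0}(x-\rho_1)^{-1+\alpha_1}\mathbf 1_{\{x>\rho_1\}},$$ where $C_0=-c_1\gamma_0^{-1}>0$, $C_1=c_1\gamma_1^{-1}>0$ and $$c_1^{-1}=(\rho_1-\rho_0)^{\alpha_0+\alpha_1}\big(-\gamma_0^{-1}B(-\alpha_0-\alpha_1,1+\alpha_1)+\gamma_1^{-1}B(-\alpha_0-\alpha_1,\alpha_1)\big);$$ moreover $(\pi_0,\pi_1)$ is the only stationary density on $K$. 3. Let $\gamma_0,\gamma_1<0$. Then there is no invariant probability measure. -/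

import Mathlib

open MeasureTheory ProbabilityTheory Set Filter Topology

noncomputable section

namespace KacOU

instance expOneIsProbability : IsProbabilityMeasure (expMeasure 1) :=
  isProbabilityMeasure_expMeasure one_pos

/-- The law of a sequence `e 0, e 1, …` of independent standard exponential variables. -/
def expSeqMeasure : Measure (ℕ → ℝ) :=
  Measure.infinitePi (fun _ : ℕ => expMeasure 1)

/-- The state, after `n` switches, of a chain on `{0, 1}` which starts at `i`. -/
def stateAfter (i : Fin 2) (n : ℕ) : Fin 2 := if Even n then i else 1 - i

/-- The time of the `(n+1)`-st switch of the two-state chain started at `i`: the holding time before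
the `(k+1)`-st switch is `e k / lam j`, that is `Exp (lam j)`, where `j` is the current state. -/
def switchTime (lam : Fin 2 → ℝ) (i : Fin 2) (e : ℕ → ℝ) (n : ℕ) : ℝ :=
  ∑ k ∈ Finset.range (n + 1), e k / lam (stateAfter i k)

/-- The number of switches up to time `t` (almost surely finite). -/
def switchCount (lam : Fin 2 → ℝ) (i : Fin 2) (e : ℕ → ℝ) (t : ℝ) : ℕ :=
  Set.ncard {n : ℕ | switchTime lam i e n ≤ t}

/-- The two-state continuous-time Markov chain `ε(t)`, `ε(0) = i`, with transition intensities
`lam 0` (from `0` to `1`) and `lam 1` (from `1` to `0`). -/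
def chain (lam : Fin 2 → ℝ) (i : Fin 2) (e : ℕ → ℝ) (t : ℝ) : Fin 2 :=
  stateAfter i (switchCount lam i e t)

/-- `Γ(t) = ∫₀ᵗ γ_{ε(s)} ds`. -/
def bigGamma (lam γ : Fin 2 → ℝ) (i : Fin 2) (e : ℕ → ℝ) (t : ℝ) : ℝ :=
  ∫ s in (0 : ℝ)..t, γ (chain lam i e s)

/-- The Kac-Ornstein-Uhlenbeck process
`X(t) = x e^{-Γ(t)} + ∫₀ᵗ a_{ε(s)} e^{-(Γ(t) - Γ(s))} ds`, that is, the solution of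
`X(t) = x + ∫₀ᵗ (a_{ε(s)} - γ_{ε(s)} X(s)) ds`. -/
def process (lam a γ : Fin 2 → ℝ) (x : ℝ) (i : Fin 2) (e : ℕ → ℝ) (t : ℝ) : ℝ :=
  x * Real.exp (-bigGamma lam γ i e t) +
    ∫ s in (0 : ℝ)..t, a (chain lam i e s) *
      Real.exp (-(bigGamma lam γ i e t - bigGamma lam γ i e s))

/-- The transition function of the Markov process `(X(t), ε(t))` on `ℝ × {0, 1}`: the law at time
`t` when the process starts at `z = (x, i)`. -/
def transition (lam a γ : Fin 2 → ℝ) (t : ℝ) (z : ℝ × Fin 2) : Measure (ℝ × Fin 2) :=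
  expSeqMeasure.map (fun e => (process lam a γ z.1 z.2 e t, chain lam z.2 e t))

/-- `μ` is an invariant probability distribution of `(X(t), ε(t))`. -/
structure IsInvariantProbability (lam a γ : Fin 2 → ℝ) (μ : Measure (ℝ × Fin 2)) : Prop where
  prob : IsProbabilityMeasure μ
  invariant : ∀ t : ℝ, 0 ≤ t → ∀ B : Set (ℝ × Fin 2), MeasurableSet B →
    ∫⁻ z, transition lam a γ t z B ∂μ = μ B

/-- The measure on `ℝ × {0, 1}` with `μ(B × {i}) = ∫_B p i x dx`. -/
def densityMeasure (p : Fin 2 → ℝ → ℝ) : Measure (ℝ × Fin 2) :=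
  ((volume : Measure ℝ).prod (Measure.count : Measure (Fin 2))).withDensity
    (fun z => ENNReal.ofReal (p z.2 z.1))

/-- `p = (p 0, p 1)` is a probability density on `K` which solves the stationary equation
`𝓛* p = 0`, i.e. `(γ_i x - a_i) p_i' = (lam_i - γ_i) p_i - lam_{1-i} p_{1-i}` on `K`, with the
boundary conditions `(a_i - γ_i x) p_i = 0` at the boundary points of `K`. -/
structure IsStationaryDensityOn (lam a γ : Fin 2 → ℝ) (K : Set ℝ) (p : Fin 2 → ℝ → ℝ) :
    Prop where
  differentiable : ∀ i, ∀ x ∈ K, DifferentiableAt ℝ (p i) x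
  equation : ∀ i, ∀ x ∈ K, (γ i * x - a i) * deriv (p i) x =
    (lam i - γ i) * p i x - lam (1 - i) * p (1 - i) x
  boundary : ∀ i, ∀ b ∈ frontier K, Tendsto (fun x => (a i - γ i * x) * p i x) (𝓝[K] b) (𝓝 0)
  nonneg : ∀ i, ∀ x ∈ K, 0 ≤ p i x
  integrable : IntegrableOn (fun x => p 0 x + p 1 x) K
  integral_eq_one : ∫ x in K, (p 0 x + p 1 x) = 1

/-- `ρ_i = a_i / γ_i`. -/
def rho (a γ : Fin 2 → ℝ) (i : Fin 2) : ℝ := a i / γ i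

/-- `α_i = lam_i / γ_i`. -/
def alpha (lam γ : Fin 2 → ℝ) (i : Fin 2) : ℝ := lam i / γ i

/-- The normalising constant `c₀` for `γ 0 > 0 > γ 1`. -/
def c₀ (lam a γ : Fin 2 → ℝ) : ℝ :=
  ((rho a γ 1 - rho a γ 0) ^ (alpha lam γ 0 + alpha lam γ 1) *
    ((γ 0)⁻¹ * beta (-alpha lam γ 0 - alpha lam γ 1) (alpha lam γ 0)
      - (γ 1)⁻¹ * beta (-alpha lam γ 0 - alpha lam γ 1) (1 + alpha lam γ 0)))⁻¹

/-- The normalising constant `c₁` for `γ 0 < 0 < γ 1`. -/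
def c₁ (lam a γ : Fin 2 → ℝ) : ℝ :=
  ((rho a γ 1 - rho a γ 0) ^ (alpha lam γ 0 + alpha lam γ 1) *
    (-(γ 0)⁻¹ * beta (-alpha lam γ 0 - alpha lam γ 1) (1 + alpha lam γ 1)
      + (γ 1)⁻¹ * beta (-alpha lam γ 0 - alpha lam γ 1) (alpha lam γ 1)))⁻¹

/-- The densities `(π₀, π₁)` for `γ 0 > 0 > γ 1`, supported on `x < ρ₀`. -/
def piLower (lam a γ : Fin 2 → ℝ) : Fin 2 → ℝ → ℝ :=
  ![(Iio (rho a γ 0)).indicator fun x => c₀ lam a γ * (γ 0)⁻¹ *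
      (rho a γ 0 - x) ^ (-1 + alpha lam γ 0) * (rho a γ 1 - x) ^ alpha lam γ 1,
    (Iio (rho a γ 0)).indicator fun x => -c₀ lam a γ * (γ 1)⁻¹ *
      (rho a γ 0 - x) ^ alpha lam γ 0 * (rho a γ 1 - x) ^ (-1 + alpha lam γ 1)]

/-- The densities `(π₀, π₁)` for `γ 0 < 0 < γ 1`, supported on `x > ρ₁`. -/
def piUpper (lam a γ : Fin 2 → ℝ) : Fin 2 → ℝ → ℝ :=
  ![(Ioi (rho a γ 1)).indicator fun x => -c₁ lam a γ * (γ 0)⁻¹ *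
      (x - rho a γ 0) ^ (-1 + alpha lam γ 0) * (x - rho a γ 1) ^ alpha lam γ 1,
    (Ioi (rho a γ 1)).indicator fun x => c₁ lam a γ * (γ 1)⁻¹ *
      (x - rho a γ 0) ^ alpha lam γ 0 * (x - rho a γ 1) ^ (-1 + alpha lam γ 1)]

end KacOU

end

/-! ### Measurability of the path and the semigroup in all variables -/

noncomputable section

open scoped ENNReal

namespace KacOU

/-! Write `P_t` for the transition semigroup, `S_t` for its restriction to paths without a switch
(`noSwitch`) and `Λ` for the switch operator (`switch`). Conditioning on the first switch gives the
renewal equation `P_t = S_t + ∫₀ᵗ S_s Λ P_{t-s} ds`. Its bounded solutions are unique, so the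
last-switch form `P_t = S_t + ∫₀ᵗ P_{t-s} Λ S_s ds` holds as well. Integrated against an invariant
`μ`, the latter loses `P`, and `t → ∞` leaves the fixed-point equation `μ = ∫₀^∞ μ Λ S_s ds`;
conversely this equation implies invariance. In terms of the sections `m₀, m₁` of `μ` on the two
states it says that `λ_i m_i` is the image of `λ_{1-i} m_{1-i}` under the flow of state `i` run for
an independent exponential time of rate `λ_i` (`IsBalanced`, `isInvariantProbability_iff`). No
regularity of `μ` is presupposed.

Half-lines that the flows preserve then locate the mass. If both flows repel, mass escapes to
infinity and cannot be replaced, so `m₀ = m₁ = 0` (`IsBalanced.eq_zero_of_neg`). If state `0`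
attracts and state `1` repels, all mass lies below `ρ₀` (`IsBalanced.null_Ici`).

Below `ρ₀` the balance equation makes the distribution functions differentiable, with `γ_i (ρ_i - x)
F_i' = λ_{1-i} F_{1-i} - λ_i F_i` (`IsBalanced.hasDerivAt`). The right-hand sides for `i = 0, 1` are
opposite, so the total flux is zero, and `G = γ₀ (ρ₀ - x) F₀'` solves the scalar equation `G' = -G
(α₀/(ρ₀ - x) + α₁/(ρ₁ - x))`. Hence `G = C (ρ₀ - x)^α₀ (ρ₁ - x)^α₁`. The resulting density is
integrable at `-∞` exactly when `α₀ + α₁ < 0`, and its mass is a sum of two beta integrals, which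
fixes `C = c₀`. A stationary density obeys the same scalar equation, because the boundary condition
makes the total flux vanish. Conversely, differentiating the distribution functions of `piLower`
along the flow shows that they are balanced (`isBalanced_piLower`). The case `γ₀ < 0 < γ₁` is the
mirror image under `(x, i) ↦ (-x, 1 - i)`. -/

instance : IsProbabilityMeasure expSeqMeasure := by
  unfold expSeqMeasure; infer_instance

lemma measurable_ncard_nat : Measurable (fun s : Set ℕ => s.ncard) := by
  have hpos : ∀ k : ℕ, k ≠ 0 → MeasurableSet {s : Set ℕ | s.ncard = k} := by
    intro k hk
    have : {s : Set ℕ | s.ncard = k} =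
        ⋃ F ∈ {F : Finset ℕ | F.card = k}, {s : Set ℕ | s = (F : Set ℕ)} := by
      ext s
      simp only [mem_ofPred_eq, mem_iUnion, exists_prop]
      constructor
      · intro h
        have hf : s.Finite := Set.finite_of_ncard_ne_zero (h ▸ hk)
        refine ⟨hf.toFinset, ?_, by simp⟩
        rw [← Set.ncard_eq_toFinset_card s hf, h]
      · rintro ⟨F, hF, rfl⟩
        simpa using hF
    rw [this]
    exact MeasurableSet.biUnion (Set.to_countable _) fun F _ => measurableSet_singleton _
  refine measurable_to_countable' fun k => ?_
  -- `ncard` is `0` on infinite sets as well, so the fibre over `0` is uncountable and is measured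
  -- as the complement of the other fibres.
  by_cases hk : k = 0
  · have : (fun s : Set ℕ => s.ncard) ⁻¹' {k} =
        (⋃ j ∈ {j : ℕ | j ≠ 0}, {s : Set ℕ | s.ncard = j})ᶜ := by
      ext s
      subst hk
      simp only [mem_preimage, mem_singleton_iff, mem_compl_iff, mem_iUnion, exists_prop]
      refine ⟨fun h => by simp [h], fun h => ?_⟩
      by_contra hs
      exact h ⟨_, hs, rfl⟩
    rw [this]
    exact (MeasurableSet.biUnion (Set.to_countable _) fun j hj => hpos j hj).compl
  · exact hpos k hk

variable (lam a γ : Fin 2 → ℝ)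

lemma measurable_switchTime (i : Fin 2) (n : ℕ) : Measurable fun e => switchTime lam i e n := by
  unfold switchTime; fun_prop

lemma measurable_switchCount (i : Fin 2) :
    Measurable fun q : ℝ × (ℕ → ℝ) => switchCount lam i q.2 q.1 := by
  refine measurable_ncard_nat.comp ?_
  refine measurable_set_iff.2 fun n => ?_
  exact measurableSet_setOfPred.1 (measurableSet_le ((measurable_switchTime lam i n).comp measurable_snd) measurable_fst)


lemma measurable_chain_right (i : Fin 2) :
    Measurable fun q : ℝ × (ℕ → ℝ) => chain lam i q.2 q.1 := by
  unfold chain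
  have h := measurable_switchCount lam i
  have h2 : Measurable (stateAfter i) := measurable_of_countable _
  exact h2.comp h

attribute [local irreducible] chain

lemma measurable_chain_of_pair : Measurable fun q : Fin 2 × (ℝ × (ℕ → ℝ)) => chain lam q.1 q.2.2 q.2.1 := by
    refine measurable_from_prod_countable_right fun i => ?_
    exact measurable_chain_right lam i

lemma measurable_chain : Measurable fun q : ℝ × Fin 2 × (ℕ → ℝ) => chain lam q.2.1 q.2.2 q.1 := by
  have h : Measurable fun q : ℝ × Fin 2 × (ℕ → ℝ) => (q.2.1, (q.1, q.2.2)) := by fun_prop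
  exact (measurable_chain_of_pair lam).comp h

/-- The moving endpoints are absorbed into the indicator of a measurable subset of `α × ℝ`, which
leaves a parameter integral over all of `ℝ`. -/
lemma measurable_parametric_intervalIntegral {α : Type*} [MeasurableSpace α] {f : α → ℝ → ℝ}
    (hf : Measurable (Function.uncurry f)) {t : α → ℝ} (ht : Measurable t) :
    Measurable fun x => ∫ s in (0 : ℝ)..t x, f x s := by
  have key : ∀ g h : α → ℝ, Measurable g → Measurable h →
      Measurable fun x => ∫ s in Ioc (g x) (h x), f x s := by
    intro g h hg hh
    have : (fun x => ∫ s in Ioc (g x) (h x), f x s) =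
        fun x => ∫ s, {p : α × ℝ | g p.1 < p.2 ∧ p.2 ≤ h p.1}.indicator (Function.uncurry f) (x, s) := by
      funext x
      rw [← integral_indicator measurableSet_Ioc]
      rfl
    rw [this]
    refine (StronglyMeasurable.integral_prod_right' (ν := volume) ?_).measurable
    refine (hf.indicator ?_).stronglyMeasurable
    exact (measurableSet_lt (hg.comp measurable_fst) measurable_snd).inter
      (measurableSet_le measurable_snd (hh.comp measurable_fst))
  simp only [intervalIntegral]
  exact (key _ _ measurable_const ht).sub (key _ _ ht measurable_const)

lemma measurable_bigGamma :
    Measurable fun q : ℝ × Fin 2 × (ℕ → ℝ) => bigGamma lam γ q.2.1 q.2.2 q.1 := by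
  refine measurable_parametric_intervalIntegral (f := fun (q : ℝ × Fin 2 × (ℕ → ℝ)) s => γ (chain lam q.2.1 q.2.2 s)) ?_
    measurable_fst
  exact (measurable_of_countable γ).comp ((measurable_chain lam).comp
    (by fun_prop : Measurable fun p : (ℝ × Fin 2 × (ℕ → ℝ)) × ℝ => (p.2, p.1.2)))

attribute [local irreducible] bigGamma

lemma measurable_process :
    Measurable fun q : ℝ × (ℝ × Fin 2) × (ℕ → ℝ) => process lam a γ q.2.1.1 q.2.1.2 q.2.2 q.1 := by
  unfold process
  have hG := measurable_bigGamma lam γ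
  have hc := measurable_chain lam
  have hG1 : Measurable fun q : ℝ × (ℝ × Fin 2) × (ℕ → ℝ) => bigGamma lam γ q.2.1.2 q.2.2 q.1 :=
    hG.comp (by fun_prop : Measurable fun q : ℝ × (ℝ × Fin 2) × (ℕ → ℝ) => (q.1, q.2.1.2, q.2.2))
  refine (Measurable.mul (by fun_prop) hG1.neg.exp).add ?_
  refine measurable_parametric_intervalIntegral 
      (f := fun (q : ℝ × (ℝ × Fin 2) × (ℕ → ℝ)) s => a (chain lam q.2.1.2 q.2.2 s) *
      Real.exp (-(bigGamma lam γ q.2.1.2 q.2.2 q.1 - bigGamma lam γ q.2.1.2 q.2.2 s))) ?_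
    measurable_fst
  have hm : Measurable fun p : (ℝ × (ℝ × Fin 2) × (ℕ → ℝ)) × ℝ => (p.2, p.1.2.1.2, p.1.2.2) := by
    fun_prop
  refine Measurable.mul ((measurable_of_countable a).comp (hc.comp hm)) ?_
  exact ((hG1.comp measurable_fst).sub (hG.comp hm)).neg.exp

attribute [local irreducible] process

/-- The state `(X(t), ε(t))` started at `z`. -/
def path (t : ℝ) (z : ℝ × Fin 2) (e : ℕ → ℝ) : ℝ × Fin 2 :=
  (process lam a γ z.1 z.2 e t, chain lam z.2 e t)

lemma measurable_path :
    Measurable fun q : ℝ × (ℝ × Fin 2) × (ℕ → ℝ) => path lam a γ q.1 q.2.1 q.2.2 :=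
  (measurable_process lam a γ).prodMk ((measurable_chain lam).comp
    (by fun_prop : Measurable fun q : ℝ × (ℝ × Fin 2) × (ℕ → ℝ) => (q.1, q.2.1.2, q.2.2)))

/-- The transition semigroup acting on nonnegative functions. -/
def semigroup (t : ℝ) (f : ℝ × Fin 2 → ℝ≥0∞) (z : ℝ × Fin 2) : ℝ≥0∞ :=
  ∫⁻ e, f (path lam a γ t z e) ∂expSeqMeasure

lemma transition_apply (t : ℝ) (z : ℝ × Fin 2) {B : Set (ℝ × Fin 2)} (hB : MeasurableSet B) :
    transition lam a γ t z B = semigroup lam a γ t (B.indicator 1) z := by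
  have hm : Measurable fun e => path lam a γ t z e :=
    (measurable_path lam a γ).comp (by fun_prop : Measurable fun e : ℕ → ℝ => (t, z, e))
  change (expSeqMeasure.map fun e => path lam a γ t z e) B = _
  rw [← lintegral_indicator_one hB, lintegral_map (measurable_one.indicator hB) hm]
  rfl

lemma measurable_semigroup {α : Type*} [MeasurableSpace α] {g : α → ℝ × Fin 2 → ℝ≥0∞}
    (hg : Measurable (Function.uncurry g)) {t : α → ℝ} (ht : Measurable t)
    {z : α → ℝ × Fin 2} (hz : Measurable z) :
    Measurable fun x => semigroup lam a γ (t x) (g x) (z x) := by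
  unfold semigroup
  refine Measurable.lintegral_prod_right' (f := fun p : α × (ℕ → ℝ) =>
    g p.1 (path lam a γ (t p.1) (z p.1) p.2)) ?_
  refine hg.comp (measurable_fst.prodMk ?_)
  exact (measurable_path lam a γ).comp
    (by fun_prop : Measurable fun p : α × (ℕ → ℝ) => (t p.1, z p.1, p.2))

lemma semigroup_le {f : ℝ × Fin 2 → ℝ≥0∞} {c : ℝ≥0∞} (hf : ∀ z, f z ≤ c) (t : ℝ)
    (z : ℝ × Fin 2) : semigroup lam a γ t f z ≤ c := by
  refine (lintegral_mono fun e => hf _).trans ?_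
  simp

end KacOU
end

/-! ### Pathwise restart at the first switch -/

noncomputable section

open scoped ENNReal

namespace KacOU

variable (lam a γ : Fin 2 → ℝ)

/-- The flow of `x' = a i - γ i x`, for `γ i ≠ 0`. -/
def flow (i : Fin 2) (s x : ℝ) : ℝ := rho a γ i + (x - rho a γ i) * Real.exp (-(γ i * s))

/-- The motion of `(X, ε)` without a switch. -/
def drift (s : ℝ) (z : ℝ × Fin 2) : ℝ × Fin 2 := (flow a γ z.2 s z.1, z.2)

/-- A switch of `ε`. -/
def flip (z : ℝ × Fin 2) : ℝ × Fin 2 := (z.1, 1 - z.2)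

/-- The sequences of holding times for which the chain is well behaved. -/
structure IsRegular (e : ℕ → ℝ) : Prop where
  nonneg : ∀ k, 0 ≤ e k
  finite : ∀ i t, {n : ℕ | switchTime lam i e n ≤ t}.Finite

/-- The sequence without its first term. -/
def tail (e : ℕ → ℝ) : ℕ → ℝ := fun n => e (n + 1)

lemma stateAfter_succ (i : Fin 2) (k : ℕ) : stateAfter i (k + 1) = stateAfter (1 - i) k := by
  have h : 1 - (1 - i) = i := by revert i; decide
  unfold stateAfter
  by_cases hk : Even k
  · simp [hk, Nat.even_add_one]
  · simp [hk, Nat.even_add_one, h]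

lemma switchTime_zero (i : Fin 2) (e : ℕ → ℝ) : switchTime lam i e 0 = e 0 / lam i := by
  simp [switchTime, stateAfter]

lemma switchTime_succ (i : Fin 2) (e : ℕ → ℝ) (n : ℕ) :
    switchTime lam i e (n + 1) = e 0 / lam i + switchTime lam (1 - i) (tail e) n := by
  unfold switchTime
  rw [Finset.sum_range_succ', add_comm]
  simp [stateAfter_succ, tail]
  simp [stateAfter]

variable {lam a γ}

lemma switchTime_mono (hlam : ∀ i, 0 < lam i) {e : ℕ → ℝ} (he : ∀ k, 0 ≤ e k) (i : Fin 2) :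
    Monotone (switchTime lam i e) := by
  refine monotone_nat_of_le_succ fun n => ?_
  unfold switchTime
  rw [Finset.sum_range_succ _ (n + 1)]
  exact le_add_of_nonneg_right (div_nonneg (he _) (hlam _).le)

lemma chain_of_lt (hlam : ∀ i, 0 < lam i) {e : ℕ → ℝ} (he : ∀ k, 0 ≤ e k) {i : Fin 2} {s : ℝ}
    (hs : s < e 0 / lam i) : chain lam i e s = i := by
  have : {n : ℕ | switchTime lam i e n ≤ s} = ∅ := by
    ext n
    simp only [mem_ofPred_eq, mem_empty_iff_false, iff_false, not_le]
    refine hs.trans_le ?_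
    rw [← switchTime_zero lam i e]
    exact switchTime_mono hlam he i n.zero_le
  simp [chain, switchCount, this, stateAfter]

/-- Removing the first switch lowers the count by one. This needs finitely many switches up to `s`:
on an infinite set `ncard` is `0` and the shift would be lost. -/
lemma chain_of_le {e : ℕ → ℝ} (he : IsRegular lam (tail e)) {i : Fin 2} {s : ℝ}
    (hs : e 0 / lam i ≤ s) :
    chain lam i e s = chain lam (1 - i) (tail e) (s - e 0 / lam i) := by
  have h : {n : ℕ | switchTime lam i e n ≤ s} = insert 0 (Nat.succ ''
      {n : ℕ | switchTime lam (1 - i) (tail e) n ≤ s - e 0 / lam i}) := by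
    ext n
    rcases n with _ | n
    · simp [switchTime_zero, hs]
    · simp [switchTime_succ, le_sub_iff_add_le']
  have hf := he.finite (1 - i) (s - e 0 / lam i)
  unfold chain switchCount
  rw [h, Set.ncard_insert_of_notMem (by simp) (hf.image _),
    Set.ncard_image_of_injective _ Nat.succ_injective, stateAfter_succ]

lemma ae_expMeasure_nonneg : ∀ᵐ x ∂expMeasure 1, 0 ≤ x := by
  rw [ae_iff]
  simp only [not_le]
  change expMeasure 1 (Iio 0) = 0
  rw [expMeasure, gammaMeasure, withDensity_apply _ measurableSet_Iio]
  exact lintegral_gammaPDF_of_nonpos le_rfl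

lemma ae_nonneg : ∀ᵐ e ∂expSeqMeasure, ∀ k, 0 ≤ e k :=
  ae_all_iff.2 fun k => (measurePreserving_eval_infinitePi (fun _ : ℕ => expMeasure 1)
    k).quasiMeasurePreserving.ae ae_expMeasure_nonneg

lemma measure_forall_le (c : ℝ) : expSeqMeasure {e | ∀ k, e k ≤ c} = 0 := by
  set p := expMeasure 1 (Iic c) with hp
  have hp1 : p < 1 := by
    have h1 : (cdf (expMeasure 1)) c < 1 := by
      rw [cdf_expMeasure_eq one_pos]
      split_ifs
      · linarith [Real.exp_pos (-(1 * c))]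
      · exact one_pos
    have := ofReal_cdf (expMeasure 1) c
    rw [hp, ← this]
    exact ENNReal.ofReal_lt_one.2 h1
  have hle : ∀ n : ℕ, expSeqMeasure {e | ∀ k, e k ≤ c} ≤ p ^ n := by
    intro n
    have := Measure.infinitePi_pi (fun _ : ℕ => expMeasure 1) (s := Finset.range n)
      (t := fun _ => Iic c) (fun _ _ => measurableSet_Iic)
    simp only [Finset.prod_const, Finset.card_range] at this
    rw [hp, ← this]
    exact measure_mono fun e he k _ => he k
  exact le_antisymm (ge_of_tendsto' (ENNReal.tendsto_pow_atTop_nhds_zero_of_lt_one hp1) hle)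
    zero_le

/-- Explosion is excluded by one long holding time: almost surely the sequence is unbounded, and a
term above `t * (lam 0 + lam 1)` gives a holding time longer than `t` in either state. -/
lemma ae_isRegular (hlam : ∀ i, 0 < lam i) : ∀ᵐ e ∂expSeqMeasure, IsRegular lam e := by
  have h2 : ∀ᵐ e ∂expSeqMeasure, ∀ N : ℕ, ∃ k, (N : ℝ) < e k := by
    rw [ae_all_iff]
    intro N
    rw [ae_iff]
    simpa using measure_forall_le N
  filter_upwards [ae_nonneg, h2] with e he h
  refine ⟨he, fun i t => ?_⟩
  obtain ⟨N, hN⟩ := exists_nat_ge (t * (lam 0 + lam 1))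
  obtain ⟨k, hk⟩ := h N
  refine (Set.finite_Iio k).subset fun n hn => ?_
  by_contra hkn
  have hkn : k ≤ n := not_lt.1 hkn
  have h1 : switchTime lam i e k ≤ t := (switchTime_mono hlam he i hkn).trans hn
  have h3 : e k / lam (stateAfter i k) ≤ t := by
    refine le_trans ?_ h1
    unfold switchTime
    exact Finset.single_le_sum (f := fun k => e k / lam (stateAfter i k))
      (fun j _ => div_nonneg (he j) (hlam _).le) (Finset.self_mem_range_succ k)
  have hl : ∀ j, lam j ≤ lam 0 + lam 1 := fun j => by
    have h0 := hlam 0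
    have h1 := hlam 1
    fin_cases j <;> simp <;> linarith
  have ht : 0 ≤ t := (div_nonneg (he k) (hlam _).le).trans h3
  rw [div_le_iff₀ (hlam _)] at h3
  have := mul_le_mul_of_nonneg_left (hl (stateAfter i k)) ht
  linarith

/-- Prepend a term to a sequence. -/
def cons (p : ℝ × (ℕ → ℝ)) : ℕ → ℝ := fun n => Nat.casesOn n p.1 p.2

lemma measurable_cons : Measurable cons := by
  refine measurable_pi_iff.2 fun n => ?_
  rcases n with _ | n
  · exact measurable_fst
  · exact (measurable_pi_apply n).comp measurable_snd

/-- Independence of the first holding time from the rest. A product measure is determined by finite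
cylinders; padding a cylinder with `univ` makes its index set an initial segment, from which
coordinate `0` splits off. -/
lemma map_cons : ((expMeasure 1).prod expSeqMeasure).map cons = expSeqMeasure := by
  refine Measure.eq_infinitePi _ fun s t ht => ?_
  obtain ⟨N, hN⟩ : ∃ N, s ⊆ Finset.range (N + 1) := by
    obtain ⟨N, hN⟩ := s.exists_nat_subset_range
    exact ⟨N, hN.trans (Finset.range_mono N.le_succ)⟩
  classical
  set u : ℕ → Set ℝ := fun n => if n ∈ s then t n else univ with hu
  have hum : ∀ n, MeasurableSet (u n) := fun n => by
    simp only [hu]; split_ifs; exacts [ht n, .univ]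
  have h1 : Set.pi (s : Set ℕ) t = Set.pi (Finset.range (N + 1) : Set ℕ) u := by
    ext e
    simp only [Set.mem_pi, hu]
    refine ⟨fun h n _ => ?_, fun h n hn => ?_⟩
    · split_ifs with hn
      · exact h n hn
      · trivial
    · have := h n (hN hn)
      rw [if_pos (by exact_mod_cast hn)] at this
      exact this
  have h2 : ∏ n ∈ s, expMeasure 1 (t n) = ∏ n ∈ Finset.range (N + 1), expMeasure 1 (u n) := by
    rw [← Finset.prod_subset hN]
    · refine Finset.prod_congr rfl fun n hn => ?_
      simp [hu, hn]
    · intro n _ hn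
      simp [hu, hn]
  have h3 : cons ⁻¹' (Set.pi (Finset.range (N + 1) : Set ℕ) u) =
      u 0 ×ˢ Set.pi (Finset.range N : Set ℕ) (fun n => u (n + 1)) := by
    ext p
    simp only [mem_preimage, Set.mem_pi, mem_prod]
    constructor
    · intro h
      exact ⟨h 0 (by simp), fun n hn => h (n + 1) (by simpa using hn)⟩
    · rintro ⟨h0, h⟩ n hn
      rcases n with _ | n
      · exact h0
      · exact h n (by simpa using hn)
  rw [h1, h2, Measure.map_apply measurable_cons
    (.pi (Finset.countable_toSet _) fun n _ => hum n), h3, Measure.prod_prod, expSeqMeasure,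
    Measure.infinitePi_pi _ (fun n _ => hum (n + 1)), Finset.prod_range_succ', mul_comm]

attribute [local irreducible] chain

lemma intervalIntegrable_chain (b : Fin 2 → ℝ) (i : Fin 2) (e : ℕ → ℝ) (s t : ℝ) :
    IntervalIntegrable (fun u => b (chain lam i e u)) volume s t := by
  have hm : Measurable fun u => chain lam i e u :=
    (measurable_chain lam).comp (by fun_prop : Measurable fun u : ℝ => (u, i, e))
  have hb : Measurable b := measurable_of_countable b
  refine IntervalIntegrable.mono_fun' (g := fun _ => |b 0| + |b 1|) (by simp)
    (hb.comp hm).aestronglyMeasurable ?_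
  have hj : ∀ j, ‖b j‖ ≤ |b 0| + |b 1| := fun j => by
    fin_cases j <;> simp
  exact ae_of_all _ fun u => hj _

lemma intervalIntegrable_process_integrand (i : Fin 2) (e : ℕ → ℝ) (t u v : ℝ) :
    IntervalIntegrable (fun s => a (chain lam i e s) *
      Real.exp (-(bigGamma lam γ i e t - bigGamma lam γ i e s))) volume u v := by
  refine (intervalIntegrable_chain a i e u v).mul_continuousOn ?_
  have : Continuous (bigGamma lam γ i e) :=
    intervalIntegral.continuous_primitive (fun s t => intervalIntegrable_chain γ i e s t) 0
  fun_prop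

lemma integral_exp_drift {c : ℝ} (hc : c ≠ 0) (t : ℝ) :
    ∫ s in (0 : ℝ)..t, Real.exp (-(c * t - c * s)) = (1 - Real.exp (-(c * t))) / c := by
  have : ∀ s ∈ uIcc 0 t, HasDerivAt (fun s => Real.exp (-(c * t - c * s)) / c)
      (Real.exp (-(c * t - c * s))) s := fun s _ => by
    have h1 : HasDerivAt (fun s => -(c * t - c * s)) c s := by
      have := ((hasDerivAt_id s).const_mul c).sub_const (c * t)
      simp only [id, mul_one] at this
      exact this.congr_of_eventuallyEq (Eventually.of_forall fun s => by simp)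
    have h2 := h1.exp.div_const c
    rwa [mul_div_cancel_right₀ _ hc] at h2
  rw [intervalIntegral.integral_eq_sub_of_hasDerivAt this
    ((by fun_prop : Continuous fun s => Real.exp (-(c * t - c * s))).intervalIntegrable _ _)]
  simp [sub_div]

section
variable {i : Fin 2} {e e' : ℕ → ℝ} {T t : ℝ}

lemma bigGamma_of_le (h1 : ∀ s < T, chain lam i e s = i) (ht : 0 ≤ t) (htT : t ≤ T) :
    bigGamma lam γ i e t = γ i * t := by
  unfold bigGamma
  rw [intervalIntegral.integral_congr_Ioo_of_le (g := fun _ => γ i) ht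
    (fun s hs => by simp [h1 s (hs.2.trans_le htT)])]
  simp [mul_comm]

lemma bigGamma_of_ge (h1 : ∀ s < T, chain lam i e s = i)
    (h2 : ∀ s, T ≤ s → chain lam i e s = chain lam (1 - i) e' (s - T)) (hT : 0 ≤ T) (htT : T ≤ t) :
    bigGamma lam γ i e t = γ i * T + bigGamma lam γ (1 - i) e' (t - T) := by
  have h := bigGamma_of_le (γ := γ) h1 hT le_rfl
  unfold bigGamma at h ⊢
  rw [← intervalIntegral.integral_add_adjacent_intervals (intervalIntegrable_chain γ i e 0 T)
    (intervalIntegrable_chain γ i e T t), h]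
  congr 1
  rw [intervalIntegral.integral_congr_Ioo_of_le (g := fun s => γ (chain lam (1 - i) e' (s - T)))
    htT (fun s hs => by simp [h2 s hs.1.le]), intervalIntegral.integral_comp_sub_right
    (fun s => γ (chain lam (1 - i) e' s)), sub_self]

lemma process_of_le (hγ : ∀ i, γ i ≠ 0) (h1 : ∀ s < T, chain lam i e s = i) (ht : 0 ≤ t)
    (htT : t ≤ T) (x : ℝ) : process lam a γ x i e t = flow a γ i t x := by
  unfold process
  have h : ∫ s in (0 : ℝ)..t, a (chain lam i e s) *
      Real.exp (-(bigGamma lam γ i e t - bigGamma lam γ i e s)) =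
      ∫ s in (0 : ℝ)..t, a i * Real.exp (-(γ i * t - γ i * s)) := by
    refine intervalIntegral.integral_congr_Ioo_of_le ht fun s hs => ?_
    rw [h1 s (hs.2.trans_le htT), bigGamma_of_le h1 ht htT,
      bigGamma_of_le h1 hs.1.le (hs.2.le.trans htT)]
  rw [h, bigGamma_of_le h1 ht htT, intervalIntegral.integral_const_mul,
    integral_exp_drift (hγ i), flow, rho]
  field_simp [hγ i]
  ring

/-- The Markov property at the switch time `T`, path by path: since `Γ` is additive, the part of the
integral over `[0, T]` is damped by the factor of the restarted process, and the part over `[T, t]`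
is the integral of the restarted process. -/
lemma process_of_ge (hγ : ∀ i, γ i ≠ 0) (h1 : ∀ s < T, chain lam i e s = i)
    (h2 : ∀ s, T ≤ s → chain lam i e s = chain lam (1 - i) e' (s - T)) (hT : 0 ≤ T) (htT : T ≤ t)
    (x : ℝ) : process lam a γ x i e t = process lam a γ (flow a γ i T x) (1 - i) e' (t - T) := by
  have h := process_of_le (a := a) hγ h1 hT le_rfl x
  have hG := bigGamma_of_ge (γ := γ) h1 h2 hT htT
  have hGT := bigGamma_of_le (γ := γ) h1 hT le_rfl
  rw [← h]
  unfold process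
  rw [← intervalIntegral.integral_add_adjacent_intervals
    (intervalIntegrable_process_integrand i e t 0 T)
    (intervalIntegrable_process_integrand i e t T t)]
  have e1 : ∫ s in (0 : ℝ)..T, a (chain lam i e s) *
      Real.exp (-(bigGamma lam γ i e t - bigGamma lam γ i e s)) =
      (∫ s in (0 : ℝ)..T, a (chain lam i e s) *
        Real.exp (-(bigGamma lam γ i e T - bigGamma lam γ i e s))) *
        Real.exp (-bigGamma lam γ (1 - i) e' (t - T)) := by
    rw [← intervalIntegral.integral_mul_const]
    refine intervalIntegral.integral_congr fun s _ => ?_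
    rw [mul_assoc, ← Real.exp_add, hG, hGT]
    ring_nf
  have e2 : ∫ s in T..t, a (chain lam i e s) *
      Real.exp (-(bigGamma lam γ i e t - bigGamma lam γ i e s)) =
      ∫ s in (0 : ℝ)..(t - T), a (chain lam (1 - i) e' s) *
        Real.exp (-(bigGamma lam γ (1 - i) e' (t - T) - bigGamma lam γ (1 - i) e' s)) := by
    rw [intervalIntegral.integral_congr_Ioo_of_le (g := fun s => a (chain lam (1 - i) e' (s - T)) *
        Real.exp (-(bigGamma lam γ (1 - i) e' (t - T) - bigGamma lam γ (1 - i) e' (s - T)))) htT,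
      intervalIntegral.integral_comp_sub_right (fun s => a (chain lam (1 - i) e' s) *
        Real.exp (-(bigGamma lam γ (1 - i) e' (t - T) - bigGamma lam γ (1 - i) e' s))), sub_self]
    intro s hs
    beta_reduce
    rw [h2 s hs.1.le, hG, bigGamma_of_ge h1 h2 hT hs.1.le]
    ring_nf
  rw [e1, e2, hG, hGT]
  rw [neg_add, Real.exp_add]
  ring

end

lemma path_of_lt (hlam : ∀ i, 0 < lam i) (hγ : ∀ i, γ i ≠ 0) {e : ℕ → ℝ} (he : ∀ k, 0 ≤ e k)
    {t : ℝ} (ht : 0 ≤ t) (z : ℝ × Fin 2) (htT : t < e 0 / lam z.2) :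
    path lam a γ t z e = drift a γ t z := by
  unfold path drift
  rw [process_of_le hγ (fun s hs => chain_of_lt hlam he hs) ht htT.le, chain_of_lt hlam he htT]

lemma path_of_ge (hlam : ∀ i, 0 < lam i) (hγ : ∀ i, γ i ≠ 0) {e : ℕ → ℝ} (he : ∀ k, 0 ≤ e k)
    (he' : IsRegular lam (tail e)) {t : ℝ} (z : ℝ × Fin 2) (htT : e 0 / lam z.2 ≤ t) :
    path lam a γ t z e =
      path lam a γ (t - e 0 / lam z.2) (flip (drift a γ (e 0 / lam z.2) z)) (tail e) := by
  unfold path drift flip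
  rw [process_of_ge hγ (fun s hs => chain_of_lt hlam he hs) (fun s hs => chain_of_le he' hs)
    (div_nonneg (he 0) (hlam _).le) htT, chain_of_le he' htT]

end KacOU
end

/-! ### Renewal equation at the first switch -/

noncomputable section

open scoped ENNReal

namespace KacOU

variable {lam a γ : Fin 2 → ℝ}

lemma measurable_flow (i : Fin 2) : Measurable fun p : ℝ × ℝ => flow a γ i p.1 p.2 := by
  unfold flow; fun_prop

lemma measurable_drift : Measurable fun p : ℝ × (ℝ × Fin 2) => drift a γ p.1 p.2 := by
  unfold drift flow
  have hγ : Measurable γ := measurable_of_countable _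
  have hρ : Measurable (rho a γ) := measurable_of_countable _
  fun_prop

lemma measurable_flip : Measurable flip := by
  have h : Measurable fun i : Fin 2 => 1 - i := measurable_of_countable _
  unfold flip
  fun_prop

lemma lintegral_expMeasure_one (F : ℝ → ℝ≥0∞) (hF : Measurable F) :
    ∫⁻ x, F x ∂expMeasure 1 = ∫⁻ x in Ioi 0, ENNReal.ofReal (Real.exp (-x)) * F x := by
  have hm : Measurable (gammaPDF 1 1) := (measurable_exponentialPDFReal 1).ennreal_ofReal
  rw [expMeasure, gammaMeasure, lintegral_withDensity_eq_lintegral_mul _ hm hF,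
    ← setLIntegral_congr (Ioi_ae_eq_Ici (a := (0 : ℝ))).symm, ← lintegral_indicator measurableSet_Ici]
  refine lintegral_congr fun x => ?_
  by_cases hx : 0 ≤ x
  · simp [hx, gammaPDF, gammaPDFReal]
  · simp [hx, gammaPDF, gammaPDFReal]

lemma lintegral_expMeasure_one_scaled {c : ℝ} (hc : 0 < c) (F : ℝ → ℝ≥0∞) (hF : Measurable F) :
    ∫⁻ x, F (x / c) ∂expMeasure 1 =
      ∫⁻ s in Ioi 0, ENNReal.ofReal (c * Real.exp (-(c * s))) * F s := by
  rw [lintegral_expMeasure_one _ (by fun_prop), ← lintegral_indicator measurableSet_Ioi,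
    ← lintegral_indicator measurableSet_Ioi]
  have hm : MeasurableEmbedding fun s : ℝ => c * s :=
    (Homeomorph.mulLeft₀ c hc.ne').isClosedEmbedding.measurableEmbedding
  have h := hm.lintegral_map (μ := volume) ((Ioi (0 : ℝ)).indicator fun x => ENNReal.ofReal (Real.exp (-x)) * F (x / c))
  rw [Real.map_volume_mul_left hc.ne', lintegral_smul_measure] at h
  have h2 : ENNReal.ofReal c * ENNReal.ofReal |c⁻¹| = 1 := by
    rw [← ENNReal.ofReal_mul hc.le, abs_of_pos (inv_pos.2 hc), mul_inv_cancel₀ hc.ne',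
      ENNReal.ofReal_one]
  rw [← one_mul (lintegral _ _), ← h2, mul_assoc, ← smul_eq_mul (ENNReal.ofReal |c⁻¹|), h,
    ← lintegral_const_mul']
  · refine lintegral_congr fun s => ?_
    by_cases hs : 0 < s
    · simp [hs, hc, ENNReal.ofReal_mul hc.le, hc.ne', mul_assoc, mul_div_cancel_left₀]
    · simp [hs, hc]
  · simp

lemma lintegral_expSeqMeasure (F : (ℕ → ℝ) → ℝ≥0∞) (hF : Measurable F) :
    ∫⁻ e, F e ∂expSeqMeasure = ∫⁻ x, ∫⁻ e, F (cons (x, e)) ∂expSeqMeasure ∂expMeasure 1 := by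
  conv_lhs => rw [← map_cons]
  rw [lintegral_map hF measurable_cons, lintegral_prod (fun p => F (cons p)) (hF.comp measurable_cons).aemeasurable]

lemma lintegral_Ioi_exp {c : ℝ} (hc : 0 < c) (t : ℝ) :
    ∫⁻ s in Ioi t, ENNReal.ofReal (c * Real.exp (-(c * s))) =
      ENNReal.ofReal (Real.exp (-(c * t))) := by
  have h := integral_exp_mul_Ioi (a := -c) (by linarith) t
  have hi := integrableOn_exp_mul_Ioi (a := -c) (by linarith) t
  rw [← ofReal_integral_eq_lintegral_ofReal]
  · rw [integral_const_mul]
    simp only [neg_mul] at h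
    rw [h]
    congr 1
    field_simp
  · simp only [neg_mul] at hi
    exact hi.const_mul c
  · exact ae_of_all _ fun s => by positivity

/-- Conditioning on the time of the first switch. -/
theorem semigroup_eq (hlam : ∀ i, 0 < lam i) (hγ : ∀ i, γ i ≠ 0) {t : ℝ} (ht : 0 ≤ t)
    {f : ℝ × Fin 2 → ℝ≥0∞} (hf : Measurable f) (z : ℝ × Fin 2) :
    semigroup lam a γ t f z = ENNReal.ofReal (Real.exp (-(lam z.2 * t))) * f (drift a γ t z) +
      ∫⁻ s in Ioo 0 t, ENNReal.ofReal (lam z.2 * Real.exp (-(lam z.2 * s))) *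
        semigroup lam a γ (t - s) f (flip (drift a γ s z)) := by
  -- `G s` is the conditional expectation of `f` at time `t`, given that the first switch happens at
  -- time `s`.
  set G : ℝ → ℝ≥0∞ := fun s => if s < t then semigroup lam a γ (t - s) f (flip (drift a γ s z))
    else f (drift a γ t z) with hG
  have hGm : Measurable G := by
    refine Measurable.ite measurableSet_Iio ?_ measurable_const
    refine measurable_semigroup lam a γ (g := fun _ => f) (hf.comp measurable_snd) (by fun_prop) ?_
    exact measurable_flip.comp (measurable_drift.comp
      (by fun_prop : Measurable fun s : ℝ => (s, z)))
  have hpm : Measurable fun e => f (path lam a γ t z e) :=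
    hf.comp ((measurable_path lam a γ).comp (by fun_prop : Measurable fun e : ℕ → ℝ => (t, z, e)))
  have key : semigroup lam a γ t f z = ∫⁻ x, G (x / lam z.2) ∂expMeasure 1 := by
    unfold semigroup
    rw [lintegral_expSeqMeasure _ hpm]
    -- A first switch exactly at `t` must be discarded as a null event: the path has then already
    -- changed state, whereas `G` takes the value without a switch.
    have hne : ∀ᵐ x ∂expMeasure 1, 0 ≤ x ∧ x / lam z.2 ≠ t := by
      have hac : expMeasure 1 ≪ volume := withDensity_absolutelyContinuous _ _
      have h1 : ∀ᵐ x ∂expMeasure 1, x ≠ t * lam z.2 := hac.ae_le (Measure.ae_ne volume _)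
      filter_upwards [h1, ae_expMeasure_nonneg] with x hx hx3
      refine ⟨hx3, fun h => hx ?_⟩
      rw [← h, div_mul_cancel₀ _ (hlam _).ne']
    refine lintegral_congr_ae ?_
    filter_upwards [hne] with x hx
    have hc : ∀ e, (∀ k, 0 ≤ e k) → ∀ k, 0 ≤ cons (x, e) k := by
      intro e he k
      rcases k with _ | k
      · exact hx.1
      · exact he k
    simp only [hG]
    split_ifs with hxt
    · unfold semigroup
      refine lintegral_congr_ae ?_
      filter_upwards [ae_isRegular hlam] with e he
      rw [path_of_ge hlam hγ (hc e he.nonneg) he z hxt.le]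
      rfl
    · have hxt' : t < x / lam z.2 := lt_of_le_of_ne (not_lt.1 hxt) hx.2.symm
      rw [lintegral_congr_ae (g := fun _ => f (drift a γ t z))]
      · simp
      · filter_upwards [ae_isRegular hlam] with e he
        rw [path_of_lt hlam hγ (hc e he.nonneg) ht z hxt']
  rw [key, lintegral_expMeasure_one_scaled (hlam _) _ hGm]
  have hU : Ioi (0 : ℝ) = Ioc 0 t ∪ Ioi t := (Ioc_union_Ioi_eq_Ioi ht).symm
  rw [hU, lintegral_union measurableSet_Ioi (Ioc_disjoint_Ioi le_rfl), add_comm]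
  congr 1
  · rw [setLIntegral_congr_fun (g := fun s => ENNReal.ofReal (lam z.2 * Real.exp (-(lam z.2 * s))) *
      f (drift a γ t z)) measurableSet_Ioi, lintegral_mul_const _ (by fun_prop),
      lintegral_Ioi_exp (hlam _)]
    intro s hs
    simp [hG, (not_lt.2 (mem_Ioi.1 hs).le)]
  · rw [← setLIntegral_congr Ioo_ae_eq_Ioc]
    refine setLIntegral_congr_fun measurableSet_Ioo fun s hs => ?_
    simp [hG, hs.2]

end KacOU
end

/-! ### First-switch and last-switch decompositions -/

noncomputable section

open scoped ENNReal

namespace KacOU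

lemma setLIntegral_Ioo_reflect (t : ℝ) (F : ℝ → ℝ≥0∞) :
    ∫⁻ s in Ioo 0 t, F (t - s) = ∫⁻ s in Ioo 0 t, F s := by
  rw [← lintegral_indicator measurableSet_Ioo, ← lintegral_indicator measurableSet_Ioo,
    ← lintegral_sub_left_eq_self ((Ioo 0 t).indicator F) t]
  refine lintegral_congr fun s => ?_
  by_cases hs : s ∈ Ioo 0 t
  · have : t - s ∈ Ioo 0 t := ⟨by linarith [hs.2], by linarith [hs.1]⟩
    simp [hs, this]
  · have : t - s ∉ Ioo 0 t := fun h => hs ⟨by linarith [h.2], by linarith [h.1]⟩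
    simp [hs, this]

/-- The integral of `F` over the triangle `0 < s`, `0 < r`, `s + r < t`. -/
lemma lintegral_triangle (t : ℝ) (F : ℝ → ℝ → ℝ≥0∞) :
    ∫⁻ s in Ioo 0 t, ∫⁻ r in Ioo 0 (t - s), F s r =
      ∫⁻ s, ∫⁻ r, {p : ℝ × ℝ | 0 < p.1 ∧ 0 < p.2 ∧ p.1 + p.2 < t}.indicator
        (Function.uncurry F) (s, r) := by
  rw [← lintegral_indicator measurableSet_Ioo]
  refine lintegral_congr fun s => ?_
  by_cases hs : s ∈ Ioo 0 t
  · rw [indicator_of_mem hs, ← lintegral_indicator measurableSet_Ioo]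
    refine lintegral_congr fun r => ?_
    simp only [indicator, mem_Ioo, mem_ofPred_eq]
    congr 1
    simp only [eq_iff_iff]
    exact ⟨fun h => ⟨hs.1, h.1, by linarith [h.2]⟩, fun h => ⟨h.2.1, by linarith [h.2.2]⟩⟩
  · rw [indicator_of_notMem hs, eq_comm, ← lintegral_zero (μ := (volume : Measure ℝ))]
    refine lintegral_congr fun r => indicator_of_notMem ?_ _
    exact fun h => hs ⟨h.1, by linarith [h.2.1, h.2.2]⟩

lemma measurableSet_triangle (t : ℝ) :
    MeasurableSet {p : ℝ × ℝ | 0 < p.1 ∧ 0 < p.2 ∧ p.1 + p.2 < t} :=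
  (measurableSet_lt measurable_const measurable_fst).inter
    ((measurableSet_lt measurable_const measurable_snd).inter
      (measurableSet_lt (measurable_fst.add measurable_snd) measurable_const))

lemma lintegral_triangle_swap (t : ℝ) {F : ℝ → ℝ → ℝ≥0∞} (hF : Measurable (Function.uncurry F)) :
    ∫⁻ s in Ioo 0 t, ∫⁻ r in Ioo 0 (t - s), F s r =
      ∫⁻ r in Ioo 0 t, ∫⁻ s in Ioo 0 (t - r), F s r := by
  rw [lintegral_triangle, lintegral_triangle t fun r s => F s r,
    lintegral_lintegral_swap (f := fun s r => {p : ℝ × ℝ | 0 < p.1 ∧ 0 < p.2 ∧ p.1 + p.2 < t}.indicator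
        (Function.uncurry F) (s, r)) (hF.indicator (measurableSet_triangle t)).aemeasurable]
  refine lintegral_congr fun r => lintegral_congr fun s => ?_
  simp only [indicator, mem_ofPred_eq, Function.uncurry_apply_pair]
  congr 1
  simp only [eq_iff_iff]
  exact ⟨fun h => ⟨h.2.1, h.1, by linarith [h.2.2]⟩, fun h => ⟨h.2.1, h.1, by linarith [h.2.2]⟩⟩

/-- The substitution `u = v - r` carries `0 < r < v < t` onto the triangle `0 < r`, `0 < u`, `r + u
< t`. -/
lemma lintegral_triangle_shift (t : ℝ) {F : ℝ → ℝ → ℝ≥0∞} (hF : Measurable (Function.uncurry F)) :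
    ∫⁻ v in Ioo 0 t, ∫⁻ r in Ioo 0 v, F r (v - r) =
      ∫⁻ r in Ioo 0 t, ∫⁻ u in Ioo 0 (t - r), F r u := by
  set H := {p : ℝ × ℝ | 0 < p.1 ∧ 0 < p.2 ∧ p.1 + p.2 < t}.indicator (Function.uncurry F) with hH
  have hHm : Measurable H := hF.indicator (measurableSet_triangle t)
  have h1 : ∫⁻ v in Ioo 0 t, ∫⁻ r in Ioo 0 v, F r (v - r) = ∫⁻ v, ∫⁻ r, H (r, v - r) := by
    rw [← lintegral_indicator measurableSet_Ioo]
    refine lintegral_congr fun v => ?_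
    by_cases hv : v ∈ Ioo 0 t
    · rw [indicator_of_mem hv, ← lintegral_indicator measurableSet_Ioo]
      refine lintegral_congr fun r => ?_
      simp only [hH, indicator, mem_Ioo, mem_ofPred_eq, Function.uncurry_apply_pair]
      congr 1
      simp only [eq_iff_iff]
      exact ⟨fun h => ⟨h.1, by linarith [h.2], by linarith [hv.2]⟩,
        fun h => ⟨h.1, by linarith [h.2.1]⟩⟩
    · rw [indicator_of_notMem hv, eq_comm, ← lintegral_zero (μ := (volume : Measure ℝ))]
      refine lintegral_congr fun r => indicator_of_notMem ?_ _
      exact fun h => hv ⟨by linarith [h.1, h.2.1], by simpa using h.2.2⟩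
  rw [h1, lintegral_triangle, lintegral_lintegral_swap (f := fun v r => H (r, v - r))
    (hHm.comp (by fun_prop : Measurable fun p : ℝ × ℝ => (p.2, p.1 - p.2))).aemeasurable]
  exact lintegral_congr fun r => lintegral_sub_right_eq_self (fun u => H (r, u)) r

variable (lam a γ : Fin 2 → ℝ)

/-- The expectation of `f` at time `t` on the event that there is no switch before `t`. -/
def noSwitch (t : ℝ) (f : ℝ × Fin 2 → ℝ≥0∞) (z : ℝ × Fin 2) : ℝ≥0∞ :=
  ENNReal.ofReal (Real.exp (-(lam z.2 * t))) * f (drift a γ t z)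

/-- The switching rate times the value of `f` after a switch. -/
def switch (f : ℝ × Fin 2 → ℝ≥0∞) (z : ℝ × Fin 2) : ℝ≥0∞ := ENNReal.ofReal (lam z.2) * f (flip z)

section
variable {α : Type*} [MeasurableSpace α] {g : α → ℝ × Fin 2 → ℝ≥0∞}

lemma measurable_noSwitch (hg : Measurable (Function.uncurry g)) {t : α → ℝ} (ht : Measurable t)
    {z : α → ℝ × Fin 2} (hz : Measurable z) :
    Measurable fun x => noSwitch lam a γ (t x) (g x) (z x) := by
  have hl : Measurable lam := measurable_of_countable _
  refine Measurable.mul (by fun_prop) ?_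
  exact hg.comp (measurable_id.prodMk (measurable_drift.comp (ht.prodMk hz)))

lemma measurable_switch (hg : Measurable (Function.uncurry g)) {z : α → ℝ × Fin 2}
    (hz : Measurable z) : Measurable fun x => switch lam (g x) (z x) := by
  have hl : Measurable lam := measurable_of_countable _
  refine Measurable.mul (by fun_prop) ?_
  exact hg.comp (measurable_id.prodMk (measurable_flip.comp hz))

lemma measurable_uncurry_noSwitch (hg : Measurable (Function.uncurry g)) {t : α → ℝ}
    (ht : Measurable t) : Measurable (Function.uncurry fun x => noSwitch lam a γ (t x) (g x)) :=
  measurable_noSwitch lam a γ (g := fun p : α × (ℝ × Fin 2) => g p.1) (t := fun p => t p.1)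
    (hg.comp (by fun_prop : Measurable fun q : (α × (ℝ × Fin 2)) × (ℝ × Fin 2) => (q.1.1, q.2)))
    (by fun_prop) measurable_snd

lemma measurable_uncurry_switch (hg : Measurable (Function.uncurry g)) :
    Measurable (Function.uncurry fun x => switch lam (g x)) :=
  measurable_switch lam (g := fun p : α × (ℝ × Fin 2) => g p.1)
    (hg.comp (by fun_prop : Measurable fun q : (α × (ℝ × Fin 2)) × (ℝ × Fin 2) => (q.1.1, q.2)))
    measurable_snd

lemma measurable_uncurry_semigroup (hg : Measurable (Function.uncurry g)) {t : α → ℝ}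
    (ht : Measurable t) : Measurable (Function.uncurry fun x => semigroup lam a γ (t x) (g x)) :=
  measurable_semigroup lam a γ (g := fun p : α × (ℝ × Fin 2) => g p.1) (t := fun p => t p.1)
    (hg.comp (by fun_prop : Measurable fun q : (α × (ℝ × Fin 2)) × (ℝ × Fin 2) => (q.1.1, q.2)))
    (by fun_prop) measurable_snd

end

variable {lam a γ}

lemma le_sum_rates (hlam : ∀ i, 0 < lam i) (i : Fin 2) : lam i ≤ lam 0 + lam 1 := by
  have h0 := hlam 0
  have h1 := hlam 1
  fin_cases i <;> simp <;> linarith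

lemma noSwitch_le (hlam : ∀ i, 0 < lam i) {t : ℝ} (ht : 0 ≤ t) {f : ℝ × Fin 2 → ℝ≥0∞} {c : ℝ≥0∞}
    (hf : ∀ z, f z ≤ c) (z : ℝ × Fin 2) : noSwitch lam a γ t f z ≤ c := by
  unfold noSwitch
  calc _ ≤ 1 * c := by
        gcongr
        · rw [ENNReal.ofReal_le_one]
          exact Real.exp_le_one_iff.2 (neg_nonpos.2 (mul_nonneg (hlam _).le ht))
        · exact hf _
    _ = c := one_mul c

lemma switch_le (hlam : ∀ i, 0 < lam i) {f : ℝ × Fin 2 → ℝ≥0∞} {c : ℝ≥0∞}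
    (hf : ∀ z, f z ≤ c) (z : ℝ × Fin 2) :
    switch lam f z ≤ ENNReal.ofReal (lam 0 + lam 1) * c := by
  unfold switch
  gcongr
  · exact le_sum_rates hlam _
  · exact hf _

lemma flow_add (i : Fin 2) (s t x : ℝ) : flow a γ i t (flow a γ i s x) = flow a γ i (s + t) x := by
  unfold flow
  rw [mul_add, neg_add, Real.exp_add]
  ring

/-- Without switches the motion is a killed deterministic flow, hence a semigroup by itself; this
turns a no-switch term at time `t` into the tail of an integral over switch times. -/
lemma noSwitch_noSwitch (s t : ℝ) (f : ℝ × Fin 2 → ℝ≥0∞) :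
    noSwitch lam a γ s (noSwitch lam a γ t f) = noSwitch lam a γ (s + t) f := by
  funext z
  simp only [noSwitch, drift]
  rw [← mul_assoc, ← ENNReal.ofReal_mul (Real.exp_pos _).le, ← Real.exp_add, flow_add]
  ring_nf

/-- The first-switch decomposition of the semigroup. -/
theorem semigroup_eq_first (hlam : ∀ i, 0 < lam i) (hγ : ∀ i, γ i ≠ 0) {t : ℝ} (ht : 0 ≤ t)
    {f : ℝ × Fin 2 → ℝ≥0∞} (hf : Measurable f) (z : ℝ × Fin 2) :
    semigroup lam a γ t f z = noSwitch lam a γ t f z +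
      ∫⁻ s in Ioo 0 t, noSwitch lam a γ s (switch lam (semigroup lam a γ (t - s) f)) z := by
  rw [semigroup_eq hlam hγ ht hf z]
  congr 1
  refine lintegral_congr fun s => ?_
  simp only [noSwitch, switch, drift]
  rw [← mul_assoc, mul_comm (lam z.2), ENNReal.ofReal_mul (Real.exp_pos _).le]

lemma noSwitch_switch_add (s : ℝ) (f g : ℝ × Fin 2 → ℝ≥0∞) (z : ℝ × Fin 2) :
    noSwitch lam a γ s (switch lam fun w => f w + g w) z =
      noSwitch lam a γ s (switch lam f) z + noSwitch lam a γ s (switch lam g) z := by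
  simp only [noSwitch, switch, mul_add]

lemma noSwitch_switch_const (s : ℝ) (M : ℝ≥0∞) (z : ℝ × Fin 2) :
    noSwitch lam a γ s (switch lam fun _ => M) z =
      ENNReal.ofReal (lam z.2 * Real.exp (-(lam z.2 * s))) * M := by
  simp only [noSwitch, switch, drift]
  rw [← mul_assoc, ← ENNReal.ofReal_mul (Real.exp_pos _).le, mul_comm (Real.exp _)]

lemma lintegral_noSwitch_switch {β : Type*} [MeasurableSpace β] (ν : Measure β) (r : ℝ)
    (z : ℝ × Fin 2) {h : β → ℝ × Fin 2 → ℝ≥0∞}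
    (hm : Measurable fun s => h s (flip (drift a γ r z))) :
    ∫⁻ s, noSwitch lam a γ r (switch lam (h s)) z ∂ν =
      noSwitch lam a γ r (switch lam fun w => ∫⁻ s, h s w ∂ν) z := by
  simp only [noSwitch, switch]
  rw [lintegral_const_mul _ (hm.const_mul _), lintegral_const_mul _ hm]

attribute [local irreducible] semigroup drift flip

lemma lintegral_Ioo_exp_le {c d t τ : ℝ} (hc : 0 < c) (hcd : c ≤ d) (ht : 0 ≤ t) (htτ : t ≤ τ) :
    ∫⁻ s in Ioo 0 t, ENNReal.ofReal (c * Real.exp (-(c * s))) ≤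
      1 - ENNReal.ofReal (Real.exp (-(d * τ))) := by
  have h := lintegral_Ioi_exp hc 0
  have hU : Ioi (0 : ℝ) = Ioc 0 t ∪ Ioi t := (Ioc_union_Ioi_eq_Ioi ht).symm
  rw [hU, lintegral_union measurableSet_Ioi (Ioc_disjoint_Ioi le_rfl), lintegral_Ioi_exp hc] at h
  simp only [mul_zero, neg_zero, Real.exp_zero, ENNReal.ofReal_one] at h
  rw [setLIntegral_congr Ioo_ae_eq_Ioc]
  refine ENNReal.le_sub_of_add_le_right ENNReal.ofReal_ne_top ?_
  rw [← h]
  gcongr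
  nlinarith

/-- Bounded solutions of the first-switch equation are comparable. -/
lemma le_of_first_switch_equation (hlam : ∀ i, 0 < lam i) {τ : ℝ} {S A B : ℝ → ℝ × Fin 2 → ℝ≥0∞}
    {C : ℝ≥0∞} (hC : C ≠ ∞) (hAC : ∀ t z, 0 ≤ t → t ≤ τ → A t z ≤ C)
    (hA : ∀ t z, 0 ≤ t → t ≤ τ → A t z = S t z +
      ∫⁻ s in Ioo 0 t, noSwitch lam a γ s (switch lam (A (t - s))) z)
    (hB : ∀ t z, 0 ≤ t → t ≤ τ → B t z = S t z +
      ∫⁻ s in Ioo 0 t, noSwitch lam a γ s (switch lam (B (t - s))) z)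
    {t : ℝ} (ht : 0 ≤ t) (htτ : t ≤ τ) (z : ℝ × Fin 2) : A t z ≤ B t z := by
  -- `c` bounds the probability of a switch before `τ` from either state. Each use of the equation
  -- multiplies the error by `c < 1`, so `A ≤ B + c ^ n * C` for all `n`.
  set c : ℝ≥0∞ := 1 - ENNReal.ofReal (Real.exp (-((lam 0 + lam 1) * τ))) with hc
  have hc1 : c < 1 := ENNReal.sub_lt_self ENNReal.one_ne_top one_ne_zero
    (by simp [Real.exp_pos])
  have key : ∀ n : ℕ, ∀ t z, 0 ≤ t → t ≤ τ → A t z ≤ B t z + c ^ n * C := by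
    intro n
    induction n with
    | zero => intro t z ht htτ; simpa using le_add_left (hAC t z ht htτ)
    | succ n ih =>
      intro t z ht htτ
      rw [hA t z ht htτ, hB t z ht htτ, add_assoc]
      gcongr
      calc ∫⁻ s in Ioo 0 t, noSwitch lam a γ s (switch lam (A (t - s))) z
          ≤ ∫⁻ s in Ioo 0 t, (noSwitch lam a γ s (switch lam (B (t - s))) z +
              ENNReal.ofReal (lam z.2 * Real.exp (-(lam z.2 * s))) * (c ^ n * C)) := by
            refine setLIntegral_mono' measurableSet_Ioo fun s hs => ?_
            rw [← noSwitch_switch_const (a := a) (γ := γ), ← noSwitch_switch_add]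
            unfold noSwitch switch
            gcongr
            exact ih _ _ (by linarith [hs.2]) (by linarith [hs.1])
        _ = (∫⁻ s in Ioo 0 t, noSwitch lam a γ s (switch lam (B (t - s))) z) +
              (∫⁻ s in Ioo 0 t, ENNReal.ofReal (lam z.2 * Real.exp (-(lam z.2 * s)))) *
                (c ^ n * C) := by
            rw [lintegral_add_right _ (by fun_prop), lintegral_mul_const _ (by fun_prop)]
        _ ≤ _ := by
            rw [pow_succ', mul_assoc]
            gcongr
            exact lintegral_Ioo_exp_le (hlam _) (le_sum_rates hlam _) ht htτ
  have hlim : Tendsto (fun n : ℕ => B t z + c ^ n * C) atTop (𝓝 (B t z + 0 * C)) := by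
    refine tendsto_const_nhds.add ?_
    exact ENNReal.Tendsto.mul_const (ENNReal.tendsto_pow_atTop_nhds_zero_of_lt_one hc1) (.inr hC)
  simpa using ge_of_tendsto' hlim fun n => key n t z ht htτ

/-- The last-switch decomposition of the semigroup. -/
theorem semigroup_eq_last (hlam : ∀ i, 0 < lam i) (hγ : ∀ i, γ i ≠ 0) {t : ℝ} (ht : 0 ≤ t)
    {f : ℝ × Fin 2 → ℝ≥0∞} (hf : Measurable f) (hf1 : ∀ z, f z ≤ 1) (z : ℝ × Fin 2) :
    semigroup lam a γ t f z = noSwitch lam a γ t f z +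
      ∫⁻ s in Ioo 0 t, semigroup lam a γ (t - s) (switch lam (noSwitch lam a γ s f)) z := by
  set S : ℝ → ℝ × Fin 2 → ℝ≥0∞ := fun t => noSwitch lam a γ t f with hS
  -- The candidate right-hand side is shown to satisfy the first-switch equation; uniqueness of
  -- bounded solutions then identifies it with the semigroup.
  set B : ℝ → ℝ × Fin 2 → ℝ≥0∞ := fun t z => noSwitch lam a γ t f z +
      ∫⁻ s in Ioo 0 t, semigroup lam a γ (t - s) (switch lam (noSwitch lam a γ s f)) z with hB
  have hfu : Measurable (Function.uncurry fun _ : ℝ => f) := hf.comp measurable_snd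
  have hΛS : Measurable (Function.uncurry fun s => switch lam (noSwitch lam a γ s f)) :=
    measurable_uncurry_switch lam (measurable_uncurry_noSwitch lam a γ hfu measurable_id)
  have hBeq : ∀ t z, 0 ≤ t → B t z = S t z +
      ∫⁻ s in Ioo 0 t, noSwitch lam a γ s (switch lam (B (t - s))) z := by
    intro t z ht
    have hP2 : Measurable fun p : ℝ × ℝ =>
        semigroup lam a γ (t - p.1 - p.2) (switch lam (noSwitch lam a γ p.1 f))
          (flip (drift a γ p.2 z)) := by
      refine measurable_semigroup lam a γ
        (g := fun p : ℝ × ℝ => switch lam (noSwitch lam a γ p.1 f))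
        (hΛS.comp (by fun_prop : Measurable fun q : (ℝ × ℝ) × (ℝ × Fin 2) => (q.1.1, q.2)))
        (by fun_prop) ?_
      exact measurable_flip.comp (measurable_drift.comp
        (by fun_prop : Measurable fun p : ℝ × ℝ => (p.2, z)))
    have hF : Measurable (Function.uncurry fun s r => noSwitch lam a γ r
        (switch lam (semigroup lam a γ (t - s - r) (switch lam (noSwitch lam a γ s f)))) z) := by
      refine measurable_noSwitch lam a γ (g := fun p : ℝ × ℝ => switch lam
        (semigroup lam a γ (t - p.1 - p.2) (switch lam (noSwitch lam a γ p.1 f))))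
        (measurable_uncurry_switch lam (measurable_uncurry_semigroup lam a γ ?_ (by fun_prop)))
        measurable_snd measurable_const
      exact hΛS.comp (by fun_prop : Measurable fun q : (ℝ × ℝ) × (ℝ × Fin 2) => (q.1.1, q.2))
    have hS1 : Measurable fun s =>
        noSwitch lam a γ (t - s) (switch lam (noSwitch lam a γ s f)) z :=
      measurable_noSwitch lam a γ hΛS (by fun_prop) measurable_const
    have hS2 : Measurable fun r =>
        noSwitch lam a γ r (switch lam (noSwitch lam a γ (t - r) f)) z :=
      measurable_noSwitch lam a γ (measurable_uncurry_switch lam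
        (measurable_uncurry_noSwitch lam a γ hfu (by fun_prop))) measurable_id measurable_const
    simp only [hB, hS]
    congr 1
    -- Here `s` is the time elapsed since the last switch and `r` the time of the first one.
    -- Expanding at the first switch separates the paths with exactly one switch, where `r = t - s`,
    -- from those with at least two, for which `r` and `s` are interchanged.
    calc ∫⁻ s in Ioo 0 t, semigroup lam a γ (t - s) (switch lam (noSwitch lam a γ s f)) z
        = ∫⁻ s in Ioo 0 t, (noSwitch lam a γ (t - s) (switch lam (noSwitch lam a γ s f)) z +
            ∫⁻ r in Ioo 0 (t - s), noSwitch lam a γ r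
              (switch lam (semigroup lam a γ (t - s - r) (switch lam (noSwitch lam a γ s f)))) z) :=
          setLIntegral_congr_fun measurableSet_Ioo fun s hs =>
            semigroup_eq_first hlam hγ (by linarith [hs.2])
              (hΛS.comp (by fun_prop : Measurable fun w : ℝ × Fin 2 => (s, w))) z
      _ = (∫⁻ r in Ioo 0 t, noSwitch lam a γ r (switch lam (noSwitch lam a γ (t - r) f)) z) +
            ∫⁻ r in Ioo 0 t, ∫⁻ s in Ioo 0 (t - r), noSwitch lam a γ r
              (switch lam (semigroup lam a γ (t - s - r)
                (switch lam (noSwitch lam a γ s f)))) z := by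
          rw [lintegral_add_left hS1, lintegral_triangle_swap t hF, ← setLIntegral_Ioo_reflect t
            fun r => noSwitch lam a γ r (switch lam (noSwitch lam a γ (t - r) f)) z]
          simp only [sub_sub_cancel]
      _ = _ := by
          rw [← lintegral_add_left hS2]
          refine lintegral_congr fun r => ?_
          have hm : Measurable fun s => semigroup lam a γ (t - s - r)
              (switch lam (noSwitch lam a γ s f)) (flip (drift a γ r z)) :=
            hP2.comp (by fun_prop : Measurable fun s : ℝ => (s, r))
          rw [lintegral_noSwitch_switch _ r z hm, ← noSwitch_switch_add]
          simp only [sub_right_comm t _ r]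
  have hPeq : ∀ t z, 0 ≤ t → semigroup lam a γ t f z = S t z +
      ∫⁻ s in Ioo 0 t, noSwitch lam a γ s (switch lam (semigroup lam a γ (t - s) f)) z :=
    fun t z ht => semigroup_eq_first hlam hγ ht hf z
  -- The comparison lemma requires a bound only on its smaller function, so it is applied once in
  -- each direction, with this bound for `B` and the bound `1` for the semigroup.
  have hBle : ∀ u z, 0 ≤ u → u ≤ t →
      B u z ≤ 1 + ENNReal.ofReal (lam 0 + lam 1) * 1 * ENNReal.ofReal t := by
    intro u z hu hut
    refine add_le_add (noSwitch_le hlam hu hf1 z) ?_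
    calc _ ≤ ∫⁻ s in Ioo 0 u, ENNReal.ofReal (lam 0 + lam 1) * 1 :=
          setLIntegral_mono' measurableSet_Ioo fun s hs => semigroup_le lam a γ
            (switch_le hlam (noSwitch_le hlam hs.1.le hf1)) _ _
      _ ≤ _ := by
          rw [setLIntegral_const, Real.volume_Ioo, sub_zero]
          gcongr
  exact le_antisymm
    (le_of_first_switch_equation hlam ENNReal.one_ne_top
      (fun u z _ _ => semigroup_le lam a γ hf1 u z) (fun u z hu _ => hPeq u z hu)
      (fun u z hu _ => hBeq u z hu) ht le_rfl z)
    (le_of_first_switch_equation hlam (by finiteness) hBle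
      (fun u z hu _ => hBeq u z hu) (fun u z hu _ => hPeq u z hu) ht le_rfl z)

end KacOU
end

/-! ### Invariance as a fixed-point equation for the flow through switches -/

noncomputable section

open scoped ENNReal

namespace KacOU

attribute [local irreducible] semigroup drift flip path

variable (lam a γ : Fin 2 → ℝ)

/-- The measure which charges a set `B` with the expected flow out of `μ`, through a switch, into
the set of starting points of the trajectories without switches that end in `B`. -/
def switchFlow (μ : Measure (ℝ × Fin 2)) : Measure (ℝ × Fin 2) :=
  (((volume.restrict (Ioi (0 : ℝ))).prod μ).withDensity fun q =>
    ENNReal.ofReal (lam q.2.2) * ENNReal.ofReal (Real.exp (-(lam (flip q.2).2 * q.1)))).map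
      fun q => drift a γ q.1 (flip q.2)

lemma lintegral_switchFlow (μ : Measure (ℝ × Fin 2)) [SFinite μ] {f : ℝ × Fin 2 → ℝ≥0∞}
    (hf : Measurable f) : ∫⁻ z, f z ∂switchFlow lam a γ μ =
      ∫⁻ s in Ioi 0, ∫⁻ z, switch lam (noSwitch lam a γ s f) z ∂μ := by
  have hl : Measurable lam := measurable_of_countable _
  have hflip : Measurable fun q : ℝ × (ℝ × Fin 2) => flip q.2 := measurable_flip.comp measurable_snd
  have hd : Measurable fun q : ℝ × (ℝ × Fin 2) => drift a γ q.1 (flip q.2) :=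
    measurable_drift.comp (measurable_fst.prodMk hflip)
  have hw : Measurable fun q : ℝ × (ℝ × Fin 2) => ENNReal.ofReal (lam q.2.2) *
      ENNReal.ofReal (Real.exp (-(lam (flip q.2).2 * q.1))) := by
    fun_prop
  unfold switchFlow
  have hfd : Measurable fun q : ℝ × (ℝ × Fin 2) => f (drift a γ q.1 (flip q.2)) := hf.comp hd
  rw [lintegral_map hf hd, lintegral_withDensity_eq_lintegral_mul _ hw hfd,
    lintegral_prod _ (hw.mul hfd).aemeasurable]
  refine lintegral_congr fun s => lintegral_congr fun z => ?_
  simp only [Pi.mul_apply, switch, noSwitch, mul_assoc]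

variable {lam a γ}

lemma IsInvariantProbability.lintegral_semigroup {μ : Measure (ℝ × Fin 2)}
    (h : IsInvariantProbability lam a γ μ) {t : ℝ} (ht : 0 ≤ t) {f : ℝ × Fin 2 → ℝ≥0∞}
    (hf : Measurable f) : ∫⁻ z, semigroup lam a γ t f z ∂μ = ∫⁻ z, f z ∂μ := by
  have := h.prob
  have hp : Measurable fun q : (ℝ × Fin 2) × (ℕ → ℝ) => path lam a γ t q.1 q.2 :=
    (measurable_path lam a γ).comp
      (by fun_prop : Measurable fun q : (ℝ × Fin 2) × (ℕ → ℝ) => (t, q.1, q.2))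
  have hν : ∀ g : ℝ × Fin 2 → ℝ≥0∞, Measurable g →
      ∫⁻ z, g z ∂(μ.prod expSeqMeasure).map (fun q => path lam a γ t q.1 q.2) =
        ∫⁻ z, semigroup lam a γ t g z ∂μ := fun g hg => by
    rw [lintegral_map hg hp, lintegral_prod (fun q => g (path lam a γ t q.1 q.2))
      (hg.comp hp).aemeasurable]
    simp only [semigroup]
  have heq : (μ.prod expSeqMeasure).map (fun q => path lam a γ t q.1 q.2) = μ := by
    ext B hB
    rw [← lintegral_indicator_one hB, hν _ (measurable_one.indicator hB), ← h.invariant t ht B hB]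
    exact lintegral_congr fun z => (transition_apply lam a γ t z hB).symm
  rw [← hν f hf, heq]

lemma lintegral_switch_le (hlam : ∀ i, 0 < lam i) (μ : Measure (ℝ × Fin 2))
    [IsProbabilityMeasure μ] {f : ℝ × Fin 2 → ℝ≥0∞} (hf1 : ∀ z, f z ≤ 1) :
    ∫⁻ z, switch lam f z ∂μ ≤ ENNReal.ofReal (lam 0 + lam 1) := by
  refine (lintegral_mono fun z => switch_le hlam hf1 z).trans ?_
  simp

/-- This is the reason for the last-switch form: there the semigroup stands outermost, so
integrating against an invariant measure removes it and only explicit operators remain. -/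
lemma IsInvariantProbability.lintegral_eq (hlam : ∀ i, 0 < lam i) (hγ : ∀ i, γ i ≠ 0)
    {μ : Measure (ℝ × Fin 2)} (h : IsInvariantProbability lam a γ μ) {t : ℝ} (ht : 0 ≤ t)
    {f : ℝ × Fin 2 → ℝ≥0∞} (hf : Measurable f) (hf1 : ∀ z, f z ≤ 1) :
    ∫⁻ z, f z ∂μ = ∫⁻ z, noSwitch lam a γ t f z ∂μ +
      ∫⁻ s in Ioo 0 t, ∫⁻ z, switch lam (noSwitch lam a γ s f) z ∂μ := by
  have := h.prob
  have hΛS : Measurable (Function.uncurry fun s => switch lam (noSwitch lam a γ s f)) :=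
    measurable_uncurry_switch lam (measurable_uncurry_noSwitch lam a γ (g := fun _ => f)
      (hf.comp measurable_snd) measurable_id)
  have hS : Measurable fun z => noSwitch lam a γ t f z :=
    measurable_noSwitch lam a γ (g := fun _ => f) (hf.comp measurable_snd) measurable_const measurable_id
  have hP : Measurable fun p : (ℝ × Fin 2) × ℝ =>
      semigroup lam a γ (t - p.2) (switch lam (noSwitch lam a γ p.2 f)) p.1 :=
    measurable_semigroup lam a γ
      (g := fun p : (ℝ × Fin 2) × ℝ => switch lam (noSwitch lam a γ p.2 f))
      (hΛS.comp (by fun_prop : Measurable fun q : ((ℝ × Fin 2) × ℝ) × (ℝ × Fin 2) => (q.1.2, q.2)))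
      (by fun_prop) measurable_fst
  rw [← h.lintegral_semigroup ht hf,
    lintegral_congr fun z => semigroup_eq_last hlam hγ ht hf hf1 z, lintegral_add_left hS,
    lintegral_lintegral_swap (f := fun z s =>
      semigroup lam a γ (t - s) (switch lam (noSwitch lam a γ s f)) z) hP.aemeasurable]
  congr 1
  refine setLIntegral_congr_fun measurableSet_Ioo fun s hs => ?_
  exact h.lintegral_semigroup (by linarith [hs.2])
    (hΛS.comp (by fun_prop : Measurable fun w : ℝ × Fin 2 => (s, w)))

lemma tendsto_setLIntegral_Ioo_nat (F : ℝ → ℝ≥0∞) :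
    Tendsto (fun n : ℕ => ∫⁻ s in Ioo 0 (n : ℝ), F s) atTop (𝓝 (∫⁻ s in Ioi 0, F s)) := by
  have hU : Ioi (0 : ℝ) = ⋃ n : ℕ, Ioo 0 (n : ℝ) := by
    ext s
    simp only [mem_Ioi, mem_iUnion, mem_Ioo]
    refine ⟨fun hs => ?_, fun ⟨n, hn⟩ => hn.1⟩
    obtain ⟨n, hn⟩ := exists_nat_gt s
    exact ⟨n, hs, hn⟩
  have hmono : Monotone fun n : ℕ => Ioo 0 (n : ℝ) := fun m n hmn =>
    Ioo_subset_Ioo_right (by exact_mod_cast hmn)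
  have h := tendsto_measure_iUnion_atTop (μ := volume.withDensity F) hmono
  rw [← hU, withDensity_apply _ measurableSet_Ioi] at h
  refine h.congr fun n => ?_
  rw [Function.comp, withDensity_apply _ measurableSet_Ioo]

/-- Let `t → ∞` along the integers in the integrated last-switch decomposition: the no-switch term
is at most `exp (-κ t)`, where `κ` is the smaller of the two rates. -/
theorem IsInvariantProbability.switchFlow_eq (hlam : ∀ i, 0 < lam i) (hγ : ∀ i, γ i ≠ 0)
    {μ : Measure (ℝ × Fin 2)} (h : IsInvariantProbability lam a γ μ) :
    switchFlow lam a γ μ = μ := by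
  have := h.prob
  ext B hB
  set f : ℝ × Fin 2 → ℝ≥0∞ := B.indicator 1 with hfdef
  have hf : Measurable f := measurable_one.indicator hB
  have hf1 : ∀ z, f z ≤ 1 := fun z => indicator_le_self' (fun _ _ => zero_le) z
  rw [← lintegral_indicator_one hB, ← lintegral_indicator_one hB, lintegral_switchFlow _ _ _ _ hf]
  set κ := min (lam 0) (lam 1) with hκ
  have hκ0 : 0 < κ := lt_min (hlam 0) (hlam 1)
  have hκi : ∀ i, κ ≤ lam i := fun i => by fin_cases i <;> simp [hκ]
  have h0 : Tendsto (fun n : ℕ => ∫⁻ z, noSwitch lam a γ n f z ∂μ) atTop (𝓝 0) := by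
    have hexp : Tendsto (fun n : ℕ => ENNReal.ofReal (Real.exp (-(κ * n)))) atTop (𝓝 0) := by
      rw [← ENNReal.ofReal_zero]
      refine ENNReal.tendsto_ofReal (Real.tendsto_exp_neg_atTop_nhds_zero.comp ?_)
      exact tendsto_natCast_atTop_atTop.const_mul_atTop hκ0
    refine tendsto_of_tendsto_of_tendsto_of_le_of_le tendsto_const_nhds hexp
      (fun _ => zero_le) fun n => ?_
    calc ∫⁻ z, noSwitch lam a γ n f z ∂μ
        ≤ ∫⁻ z, ENNReal.ofReal (Real.exp (-(κ * n))) * 1 ∂μ := by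
          refine lintegral_mono fun z => ?_
          unfold noSwitch
          gcongr
          · exact hκi _
          · exact hf1 _
      _ = _ := by simp
  have h1 := h0.add (tendsto_setLIntegral_Ioo_nat
    fun s => ∫⁻ z, switch lam (noSwitch lam a γ s f) z ∂μ)
  rw [zero_add] at h1
  refine tendsto_nhds_unique h1 (tendsto_const_nhds.congr fun n => ?_)
  exact h.lintegral_eq hlam hγ n.cast_nonneg hf hf1

/-- Split the fixed-point integral at `t`: by the semigroup property of `noSwitch`, its tail over
`(t, ∞)` is the fixed-point equation applied to `noSwitch t f`. -/
lemma lintegral_eq_of_switchFlow_eq {μ : Measure (ℝ × Fin 2)} [IsProbabilityMeasure μ]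
    (h : switchFlow lam a γ μ = μ) {t : ℝ} (ht : 0 ≤ t)
    {f : ℝ × Fin 2 → ℝ≥0∞} (hf : Measurable f) :
    ∫⁻ z, f z ∂μ = ∫⁻ z, noSwitch lam a γ t f z ∂μ +
      ∫⁻ s in Ioo 0 t, ∫⁻ z, switch lam (noSwitch lam a γ s f) z ∂μ := by
  have hS : Measurable fun z => noSwitch lam a γ t f z :=
    measurable_noSwitch lam a γ (g := fun _ => f) (hf.comp measurable_snd) measurable_const measurable_id
  have h1 : ∫⁻ z, noSwitch lam a γ t f z ∂μ =
      ∫⁻ s in Ioi t, ∫⁻ z, switch lam (noSwitch lam a γ s f) z ∂μ := by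
    conv_lhs => rw [← h, lintegral_switchFlow _ _ _ _ hS]
    simp only [noSwitch_noSwitch]
    rw [← lintegral_indicator measurableSet_Ioi, ← lintegral_indicator measurableSet_Ioi,
      ← lintegral_add_right_eq_self ((Ioi t).indicator _) t]
    refine lintegral_congr fun s => ?_
    simp [indicator]
  have hU : Ioi (0 : ℝ) = Ioc 0 t ∪ Ioi t := (Ioc_union_Ioi_eq_Ioi ht).symm
  conv_lhs => rw [← h, lintegral_switchFlow _ _ _ _ hf]
  rw [h1, hU, lintegral_union measurableSet_Ioi (Ioc_disjoint_Ioi le_rfl), add_comm,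
    setLIntegral_congr Ioo_ae_eq_Ioc]

/-- With `S` for `noSwitch`, `Λ` for `switch` and `P` for the semigroup applied to `f`, expand `∫₀ᵗ
μ(Λ P_s) ds` by the fixed-point equation and by the first-switch equation. Both expansions contain
the same double integral; cancelling it gives `∫₀ᵗ μ(S_s Λ P_{t-s}) ds = ∫₀ᵗ μ(Λ S_s f) ds`, so the
decompositions of `μ(P_t)` and `μ(f)` agree. -/
theorem isInvariantProbability_of_switchFlow_eq (hlam : ∀ i, 0 < lam i) (hγ : ∀ i, γ i ≠ 0)
    {μ : Measure (ℝ × Fin 2)} [IsProbabilityMeasure μ] (h : switchFlow lam a γ μ = μ) :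
    IsInvariantProbability lam a γ μ := by
  refine ⟨inferInstance, fun t ht B hB => ?_⟩
  set f : ℝ × Fin 2 → ℝ≥0∞ := B.indicator 1 with hfdef
  have hf : Measurable f := measurable_one.indicator hB
  have hf1 : ∀ z, f z ≤ 1 := fun z => indicator_le_self' (fun _ _ => zero_le) z
  rw [lintegral_congr fun z => transition_apply lam a γ t z hB, ← lintegral_indicator_one hB,
    ← hfdef]
  set P : ℝ → ℝ × Fin 2 → ℝ≥0∞ := fun t => semigroup lam a γ t f with hP
  have hfu : Measurable (Function.uncurry fun _ : ℝ => f) := hf.comp measurable_snd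
  have hΛP : Measurable (Function.uncurry fun u => switch lam (P u)) :=
    measurable_uncurry_switch lam (measurable_uncurry_semigroup lam a γ hfu measurable_id)
  have hΛPu : ∀ u, Measurable (switch lam (P u)) := fun u =>
    hΛP.comp (by fun_prop : Measurable fun w : ℝ × Fin 2 => (u, w))
  have hS : Measurable fun z => noSwitch lam a γ t f z :=
    measurable_noSwitch lam a γ (g := fun _ => f) (hf.comp measurable_snd) measurable_const measurable_id
  have hSΛP : Measurable fun p : (ℝ × Fin 2) × ℝ =>
      noSwitch lam a γ p.2 (switch lam (P (t - p.2))) p.1 :=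
    measurable_noSwitch lam a γ (g := fun p : (ℝ × Fin 2) × ℝ => switch lam (P (t - p.2)))
      (hΛP.comp (by fun_prop :
        Measurable fun q : ((ℝ × Fin 2) × ℝ) × (ℝ × Fin 2) => (t - q.1.2, q.2)))
      measurable_snd measurable_fst
  set Φ : ℝ → ℝ → ℝ≥0∞ := fun r u =>
    ∫⁻ z, switch lam (noSwitch lam a γ r (switch lam (P u))) z ∂μ with hΦ
  have hΦ0 : Measurable fun q : (ℝ × ℝ) × (ℝ × Fin 2) =>
      switch lam (noSwitch lam a γ q.1.1 (switch lam (P q.1.2))) q.2 := by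
    refine measurable_switch lam (g := fun q : (ℝ × ℝ) × (ℝ × Fin 2) =>
      noSwitch lam a γ q.1.1 (switch lam (P q.1.2))) ?_ measurable_snd
    refine measurable_uncurry_noSwitch lam a γ (g := fun q : (ℝ × ℝ) × (ℝ × Fin 2) =>
      switch lam (P q.1.2)) ?_ (by fun_prop)
    exact hΛP.comp (by fun_prop :
      Measurable fun q : ((ℝ × ℝ) × (ℝ × Fin 2)) × (ℝ × Fin 2) => (q.1.1.2, q.2))
  have hΦm : Measurable (Function.uncurry Φ) := hΦ0.lintegral_prod_right'
  -- the total flow of `P` through switches, computed in two ways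
  have hI : ∫⁻ s in Ioo 0 t, ∫⁻ z, switch lam (P s) z ∂μ =
      (∫⁻ s in Ioo 0 t, ∫⁻ z, noSwitch lam a γ s (switch lam (P (t - s))) z ∂μ) +
        ∫⁻ r in Ioo 0 t, ∫⁻ u in Ioo 0 (t - r), Φ r u := by
    rw [← setLIntegral_Ioo_reflect]
    rw [setLIntegral_congr_fun measurableSet_Ioo fun s hs =>
      lintegral_eq_of_switchFlow_eq h hs.1.le (hΛPu (t - s)), lintegral_add_left]
    · congr 1
      rw [← lintegral_triangle_swap t (F := fun u r => Φ r u) (hΦm.comp measurable_swap),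
        ← setLIntegral_Ioo_reflect]
      simp only [sub_sub_cancel]
      rfl
    · exact (hSΛP.comp measurable_swap).lintegral_prod_right'
  have hΛS : Measurable (Function.uncurry fun s => switch lam (noSwitch lam a γ s f)) :=
    measurable_uncurry_switch lam (measurable_uncurry_noSwitch lam a γ hfu measurable_id)
  have hJ : ∫⁻ s in Ioo 0 t, ∫⁻ z, switch lam (P s) z ∂μ =
      (∫⁻ s in Ioo 0 t, ∫⁻ z, switch lam (noSwitch lam a γ s f) z ∂μ) +
        ∫⁻ r in Ioo 0 t, ∫⁻ u in Ioo 0 (t - r), Φ r u := by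
    have hΛS' : Measurable fun s => ∫⁻ z, switch lam (noSwitch lam a γ s f) z ∂μ :=
      hΛS.lintegral_prod_right'
    rw [← lintegral_triangle_shift t hΦm, ← lintegral_add_left hΛS']
    refine setLIntegral_congr_fun measurableSet_Ioo fun v hv => ?_
    have hm : Measurable fun q : (ℝ × Fin 2) × ℝ =>
        switch lam (noSwitch lam a γ q.2 (switch lam (P (v - q.2)))) q.1 :=
      hΦ0.comp (by fun_prop : Measurable fun q : (ℝ × Fin 2) × ℝ => ((q.2, v - q.2), q.1))
    have hΛSv : Measurable (switch lam (noSwitch lam a γ v f)) :=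
      hΛS.comp (by fun_prop : Measurable fun w : ℝ × Fin 2 => (v, w))
    simp only [hΦ]
    rw [← lintegral_lintegral_swap (f := fun z r =>
      switch lam (noSwitch lam a γ r (switch lam (P (v - r)))) z) hm.aemeasurable,
      ← lintegral_add_left hΛSv]
    refine lintegral_congr fun z => ?_
    have hm2 : Measurable fun r => noSwitch lam a γ r (switch lam (P (v - r))) (flip z) :=
      measurable_noSwitch lam a γ (g := fun r => switch lam (P (v - r)))
        (hΛP.comp (by fun_prop : Measurable fun q : ℝ × (ℝ × Fin 2) => (v - q.1, q.2)))
        measurable_id measurable_const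
    simp only [switch] at hm2 ⊢
    rw [lintegral_const_mul _ hm2, ← mul_add]
    congr 1
    exact semigroup_eq_first hlam hγ hv.1.le hf (flip z)
  -- Cancellation in `ℝ≥0∞` needs a finite common term. It is dominated by the total flow on a
  -- bounded time interval, with bounded rates and `P ≤ 1`.
  have hfin : ∫⁻ r in Ioo 0 t, ∫⁻ u in Ioo 0 (t - r), Φ r u ≠ ∞ := by
    have hle : ∫⁻ s in Ioo 0 t, ∫⁻ z, switch lam (P s) z ∂μ ≠ ∞ := by
      refine ne_top_of_le_ne_top ?_ (lintegral_mono fun s =>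
        lintegral_switch_le hlam μ fun z => semigroup_le lam a γ hf1 s z)
      rw [setLIntegral_const, Real.volume_Ioo]
      finiteness
    rw [hJ] at hle
    exact (ENNReal.add_ne_top.1 hle).2
  have hIJ := (ENNReal.add_left_inj hfin).1 (hI.symm.trans hJ)
  rw [lintegral_congr fun z => semigroup_eq_first hlam hγ ht hf z, lintegral_add_left hS,
    lintegral_lintegral_swap (f := fun z s =>
      noSwitch lam a γ s (switch lam (P (t - s))) z) hSΛP.aemeasurable, hIJ,
    ← lintegral_eq_of_switchFlow_eq h ht hf]

end KacOU
end

/-! ### Balance equation for the two sections, and criteria for null sets -/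

noncomputable section

open scoped ENNReal

namespace KacOU

/-- The part of `μ` on `ℝ × {i}`, as a measure on `ℝ`. -/
def sect (μ : Measure (ℝ × Fin 2)) (i : Fin 2) : Measure ℝ := μ.comap fun x => (x, i)

lemma measurableEmbedding_pair (i : Fin 2) : MeasurableEmbedding fun x : ℝ => (x, i) :=
  measurableEmbedding_prod_mk_right i

lemma sect_apply (μ : Measure (ℝ × Fin 2)) (i : Fin 2) (A : Set ℝ) :
    sect μ i A = μ ((fun x => (x, i)) '' A) :=
  (measurableEmbedding_pair i).comap_apply μ A

instance (μ : Measure (ℝ × Fin 2)) [IsFiniteMeasure μ] (i : Fin 2) : IsFiniteMeasure (sect μ i) :=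
  ⟨by rw [sect_apply]; exact measure_lt_top μ _⟩

lemma lintegral_eq_sum_sect (μ : Measure (ℝ × Fin 2)) {f : ℝ × Fin 2 → ℝ≥0∞} (hf : Measurable f) :
    ∫⁻ z, f z ∂μ = ∑ i, ∫⁻ x, f (x, i) ∂sect μ i := by
  have h1 : ∀ i, ∫⁻ x, f (x, i) ∂sect μ i = ∫⁻ z in range (fun x : ℝ => (x, i)), f z ∂μ := by
    intro i
    rw [← (measurableEmbedding_pair i).map_comap, lintegral_map hf (by fun_prop)]
    rfl
  have hU : (univ : Set (ℝ × Fin 2)) = range (fun x : ℝ => (x, (0 : Fin 2))) ∪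
      range fun x : ℝ => (x, (1 : Fin 2)) := by
    ext ⟨x, i⟩
    fin_cases i <;> simp
  rw [Fin.sum_univ_two, h1, h1, ← lintegral_union
    (measurableEmbedding_pair 1).measurableSet_range, ← hU, setLIntegral_univ]
  rw [disjoint_left]
  rintro _ ⟨x, rfl⟩ ⟨y, hy⟩
  simp at hy

lemma ext_sect {μ ν : Measure (ℝ × Fin 2)} (h : ∀ i, sect μ i = sect ν i) : μ = ν := by
  ext B hB
  rw [← lintegral_indicator_one hB, ← lintegral_indicator_one hB,
    lintegral_eq_sum_sect _ (measurable_one.indicator hB),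
    lintegral_eq_sum_sect _ (measurable_one.indicator hB)]
  simp only [h]

lemma sect_univ_add (μ : Measure (ℝ × Fin 2)) : sect μ 0 univ + sect μ 1 univ = μ univ := by
  have := lintegral_eq_sum_sect μ (measurable_one (α := ℝ≥0∞))
  simpa [Fin.sum_univ_two, eq_comm] using this

lemma sect_densityMeasure {p : Fin 2 → ℝ → ℝ} (hp : ∀ i, Measurable (p i)) (i : Fin 2) :
    sect (densityMeasure p) i = volume.withDensity fun x => ENNReal.ofReal (p i x) := by
  have hpm : Measurable fun z : ℝ × Fin 2 => p z.2 z.1 := by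
    have h : Measurable fun z : Fin 2 × ℝ => p z.1 z.2 := measurable_from_prod_countable_right hp
    exact h.comp measurable_swap
  ext A hA
  have hI : MeasurableSet ((fun x => (x, i)) '' A) :=
    (measurableEmbedding_pair i).measurableSet_image.2 hA
  have hprod : (fun x : ℝ => (x, i)) '' A = A ×ˢ {i} := by
    ext ⟨x, j⟩
    simp [eq_comm]
  rw [sect_apply, densityMeasure, withDensity_apply _ hI, withDensity_apply _ hA, hprod,
    ← Measure.prod_restrict, lintegral_prod _ hpm.ennreal_ofReal.aemeasurable]
  simp

variable (lam a γ : Fin 2 → ℝ)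

/-- The exponential law with rate `c`, with its density on `(0, ∞)`. -/
def holdMeasure (c : ℝ) : Measure ℝ :=
  (volume.restrict (Ioi 0)).withDensity fun s => ENNReal.ofReal (c * Real.exp (-(c * s)))

/-- The stationarity of `m` in integrated form: the trajectories which end in `A` in the state `i`
have entered that state through a switch, an exponential time ago. -/
def IsBalanced (m : Fin 2 → Measure ℝ) : Prop :=
  ∀ i A, MeasurableSet A → ENNReal.ofReal (lam i) * m i A =
    ENNReal.ofReal (lam (1 - i)) * ∫⁻ s, m (1 - i) (flow a γ i s ⁻¹' A) ∂holdMeasure (lam i)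

variable {lam a γ}

lemma measurableSet_flow_pair (i : Fin 2) {A : Set ℝ} (hA : MeasurableSet A) :
    MeasurableSet {p : ℝ × ℝ | flow a γ i p.1 p.2 ∈ A} := measurable_flow i hA

lemma measurable_measure_flow (ν : Measure ℝ) [SFinite ν] (i : Fin 2) {A : Set ℝ}
    (hA : MeasurableSet A) : Measurable fun s => ν (flow a γ i s ⁻¹' A) :=
  measurable_measure_prodMk_left (ν := ν) (measurableSet_flow_pair i hA)

lemma lintegral_holdMeasure (c : ℝ) {F : ℝ → ℝ≥0∞} (hF : Measurable F) :
    ∫⁻ s, F s ∂holdMeasure c = ∫⁻ s in Ioi 0, ENNReal.ofReal (c * Real.exp (-(c * s))) * F s := by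
  unfold holdMeasure
  rw [lintegral_withDensity_eq_lintegral_mul _ (by fun_prop) hF]
  rfl

lemma holdMeasure_Ioi {c t : ℝ} (hc : 0 < c) (ht : 0 ≤ t) :
    holdMeasure c (Ioi t) = ENNReal.ofReal (Real.exp (-(c * t))) := by
  unfold holdMeasure
  rw [withDensity_apply _ measurableSet_Ioi, Measure.restrict_restrict measurableSet_Ioi,
    inter_eq_left.2 (Ioi_subset_Ioi ht), lintegral_Ioi_exp hc]

lemma holdMeasure_ae (c : ℝ) : ∀ᵐ s ∂holdMeasure c, 0 < s :=
  (withDensity_absolutelyContinuous _ _).ae_le (ae_restrict_mem measurableSet_Ioi)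

lemma holdMeasure_univ {c : ℝ} (hc : 0 < c) : holdMeasure c univ = 1 := by
  have h := holdMeasure_Ioi hc le_rfl
  rw [mul_zero, neg_zero, Real.exp_zero, ENNReal.ofReal_one] at h
  rw [← h, eq_comm]
  refine measure_congr ?_
  filter_upwards [holdMeasure_ae c] with s hs
  exact propext ⟨fun _ => trivial, fun _ => hs⟩

lemma one_sub_one_sub (i : Fin 2) : 1 - (1 - i) = i := by revert i; decide

/-- The factor `lam i` on the left turns the survival factor `exp (-lam i * s)` into the probability
density of `holdMeasure`. -/
lemma sect_switchFlow (hlam : ∀ i, 0 < lam i) (μ : Measure (ℝ × Fin 2)) [SFinite μ]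
    [∀ i, SFinite (sect μ i)] (i : Fin 2) {A : Set ℝ} (hA : MeasurableSet A) :
    ENNReal.ofReal (lam i) * sect (switchFlow lam a γ μ) i A =
      ENNReal.ofReal (lam (1 - i)) *
        ∫⁻ s, sect μ (1 - i) (flow a γ i s ⁻¹' A) ∂holdMeasure (lam i) := by
  have hI : MeasurableSet ((fun x => (x, i)) '' A) :=
    (measurableEmbedding_pair i).measurableSet_image.2 hA
  set f : ℝ × Fin 2 → ℝ≥0∞ := ((fun x => (x, i)) '' A).indicator 1 with hfd
  have hf : Measurable f := measurable_one.indicator hI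
  have hΛS : ∀ s, Measurable (switch lam (noSwitch lam a γ s f)) := fun s =>
    measurable_switch lam (g := fun _ => noSwitch lam a γ s f)
      (measurable_uncurry_noSwitch lam a γ (g := fun _ => f) (hf.comp measurable_snd)
        measurable_const) measurable_id
  have key : ∀ s, ∫⁻ z, switch lam (noSwitch lam a γ s f) z ∂μ =
      ENNReal.ofReal (lam (1 - i)) * (ENNReal.ofReal (Real.exp (-(lam i * s))) *
        sect μ (1 - i) (flow a γ i s ⁻¹' A)) := by
    intro s
    have hfm : MeasurableSet (flow a γ i s ⁻¹' A) :=
      (measurable_flow i).comp (by fun_prop : Measurable fun y : ℝ => (s, y)) hA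
    have h1 : ∀ x, switch lam (noSwitch lam a γ s f) (x, 1 - i) =
        ENNReal.ofReal (lam (1 - i)) * (ENNReal.ofReal (Real.exp (-(lam i * s))) *
          (flow a γ i s ⁻¹' A).indicator 1 x) := by
      intro x
      have hfA : ∀ y, f (y, i) = A.indicator 1 y := by
        intro y
        by_cases hy : y ∈ A
        · rw [hfd, indicator_of_mem (mem_image_of_mem _ hy), indicator_of_mem hy]
          rfl
        · rw [hfd, indicator_of_notMem (by simpa using hy), indicator_of_notMem hy]
      simp only [switch, noSwitch, flip, drift, one_sub_one_sub, hfA]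
      rfl
    -- A switch out of `i` lands in `1 - i`, where `f` vanishes; only the section `1 - i` of `μ`
    -- contributes.
    have h2 : ∀ x, switch lam (noSwitch lam a γ s f) (x, i) = 0 := by
      intro x
      have hne : ∀ i : Fin 2, i ≠ 1 - i := by decide
      simp [switch, noSwitch, flip, drift, hfd, hne i]
    have h3 : ∀ g : Fin 2 → ℝ≥0∞, ∑ j, g j = g (1 - i) + g i := by
      intro g
      fin_cases i <;> simp [Fin.sum_univ_two, add_comm]
    rw [lintegral_eq_sum_sect μ (hΛS s), h3]
    simp only [h1, h2, lintegral_zero, add_zero]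
    rw [lintegral_const_mul _ ((measurable_one.indicator hfm).const_mul _),
      lintegral_const_mul _ (measurable_one.indicator hfm), lintegral_indicator_one hfm]
  rw [sect_apply, ← lintegral_indicator_one hI, lintegral_switchFlow lam a γ μ hf]
  simp only [key]
  have hm := measurable_measure_flow (a := a) (γ := γ) (sect μ (1 - i)) i hA
  have hm2 : Measurable fun s => ENNReal.ofReal (Real.exp (-(lam i * s))) *
    sect μ (1 - i) (flow a γ i s ⁻¹' A) := Measurable.mul (by fun_prop) hm
  rw [lintegral_const_mul _ hm2, lintegral_holdMeasure _ hm, mul_left_comm,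
    ← lintegral_const_mul _ hm2]
  congr 1
  refine lintegral_congr fun s => ?_
  rw [ENNReal.ofReal_mul (hlam i).le, mul_assoc]

/-- The bridge from the stochastic process to analysis: the rest of the argument uses only the
balance equation and no paths. -/
theorem isInvariantProbability_iff (hlam : ∀ i, 0 < lam i) (hγ : ∀ i, γ i ≠ 0)
    (μ : Measure (ℝ × Fin 2)) :
    IsInvariantProbability lam a γ μ ↔ IsProbabilityMeasure μ ∧ IsBalanced lam a γ (sect μ) := by
  have hlam' : ∀ i, ENNReal.ofReal (lam i) ≠ 0 := fun i => by simp [hlam i]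
  constructor
  · intro h
    have := h.prob
    refine ⟨this, fun i A hA => ?_⟩
    rw [← sect_switchFlow hlam μ i hA, h.switchFlow_eq hlam hγ]
  · rintro ⟨hμ, h⟩
    refine isInvariantProbability_of_switchFlow_eq hlam hγ (ext_sect fun i => ?_)
    ext A hA
    refine (ENNReal.mul_right_inj (hlam' i) ENNReal.ofReal_ne_top).1 ?_
    rw [sect_switchFlow hlam μ i hA, h i A hA]

variable {m : Fin 2 → Measure ℝ}

lemma IsBalanced.mul_eq (hlam : ∀ i, 0 < lam i) (h : IsBalanced lam a γ m) {i : Fin 2} {A : Set ℝ}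
    (hA : MeasurableSet A) (hinv : ∀ s, 0 < s → flow a γ i s ⁻¹' A = A) :
    ENNReal.ofReal (lam i) * m i A = ENNReal.ofReal (lam (1 - i)) * m (1 - i) A := by
  rw [h i A hA]
  congr 1
  rw [lintegral_congr_ae (g := fun _ => m (1 - i) A)]
  · simp [holdMeasure_univ (hlam i)]
  · filter_upwards [holdMeasure_ae (lam i)] with s hs
    rw [hinv s hs]

/-- `A` is forward invariant for flow `i`: whatever switches into state `i` inside `A` stays there,
so all of it is counted in `m i A`. -/
lemma IsBalanced.mul_le (hlam : ∀ i, 0 < lam i) (h : IsBalanced lam a γ m) {i : Fin 2} {A : Set ℝ}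
    (hA : MeasurableSet A) (hsub : ∀ s, 0 < s → A ⊆ flow a γ i s ⁻¹' A) :
    ENNReal.ofReal (lam (1 - i)) * m (1 - i) A ≤ ENNReal.ofReal (lam i) * m i A := by
  rw [h i A hA]
  gcongr
  calc m (1 - i) A = ∫⁻ _, m (1 - i) A ∂holdMeasure (lam i) := by simp [holdMeasure_univ (hlam i)]
    _ ≤ _ := by
      refine lintegral_mono_ae ?_
      filter_upwards [holdMeasure_ae (lam i)] with s hs
      exact measure_mono (hsub s hs)

lemma frequently_of_ae_holdMeasure {c : ℝ} (hc : 0 < c) {Q : ℝ → Prop}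
    (h : ∀ᵐ s ∂holdMeasure c, Q s) (N : ℕ) : ∃ s, (N : ℝ) < s ∧ Q s := by
  by_contra! hN
  have h0 : holdMeasure c (Ioi (N : ℝ)) = 0 :=
    measure_mono_null (fun s hs => hN s hs) (ae_iff.1 h)
  rw [holdMeasure_Ioi hc N.cast_nonneg] at h0
  simp at h0
  linarith [Real.exp_pos (-(c * N))]

/-- The waiting time after which a point stays in `E s` depends on the point; sorting the points by
an integer bound for it leaves countably many pieces, each inside a null `E s`. -/
lemma null_of_eventually {ν : Measure ℝ} {E : ℝ → Set ℝ} (hE : ∀ N : ℕ, ∃ s, (N : ℝ) < s ∧ ν (E s) = 0)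
    {S : Set ℝ} (hS : ∀ y ∈ S, ∀ᶠ s in atTop, y ∈ E s) : ν S = 0 := by
  have hsub : S ⊆ ⋃ N : ℕ, {y | ∀ s, (N : ℝ) < s → y ∈ E s} := by
    intro y hy
    obtain ⟨T, hT⟩ := eventually_atTop.1 (hS y hy)
    obtain ⟨N, hN⟩ := exists_nat_ge T
    exact mem_iUnion.2 ⟨N, fun s hs => hT s (hN.trans hs.le)⟩
  refine measure_mono_null hsub (measure_iUnion_null fun N => ?_)
  obtain ⟨s, hs, h0⟩ := hE N
  exact measure_mono_null (fun y hy => hy s hs) h0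

variable [∀ i, IsFiniteMeasure (m i)]

/-- If the backward flow enlarges `A` although it does not gain mass, then the set which is
eventually added has no mass. -/
lemma IsBalanced.null_of_subset (hlam : ∀ i, 0 < lam i) (h : IsBalanced lam a γ m) {i : Fin 2}
    {A S : Set ℝ} (hA : MeasurableSet A) (hsub : ∀ s, 0 < s → A ⊆ flow a γ i s ⁻¹' A)
    (hle : ENNReal.ofReal (lam i) * m i A ≤ ENNReal.ofReal (lam (1 - i)) * m (1 - i) A)
    (hS : ∀ y ∈ S, y ∉ A ∧ ∀ᶠ s in atTop, flow a γ i s y ∈ A) : m (1 - i) S = 0 := by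
  rw [h i A hA] at hle
  have hle' := (ENNReal.mul_le_mul_iff_right (by simp [hlam (1 - i)]) ENNReal.ofReal_ne_top).1 hle
  have hconst : ∫⁻ _, m (1 - i) A ∂holdMeasure (lam i) = m (1 - i) A := by
    simp [holdMeasure_univ (hlam i)]
  -- The preimages contain `A`, yet on average their mass is no larger; hence the masses agree for
  -- almost every `s`, and the added sets are null at arbitrarily large times.
  have hae := ae_eq_of_ae_le_of_lintegral_le (f := fun _ => m (1 - i) A)
    (g := fun s => m (1 - i) (flow a γ i s ⁻¹' A)) (μ := holdMeasure (lam i)) (by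
      filter_upwards [holdMeasure_ae (lam i)] with s hs
      exact measure_mono (hsub s hs)) (by rw [hconst]; finiteness)
    (measurable_measure_flow _ i hA).aemeasurable (by rw [hconst]; exact hle')
  refine null_of_eventually (E := fun s => flow a γ i s ⁻¹' A \ A)
    (frequently_of_ae_holdMeasure (hlam i) ?_) fun y hy =>
      (hS y hy).2.mono fun s hs => ⟨hs, (hS y hy).1⟩
  filter_upwards [hae, holdMeasure_ae (lam i)] with s hs hs0
  rw [measure_sdiff (hsub s hs0) hA.nullMeasurableSet (by finiteness), ← hs, tsub_self]

/-- Mass of state `1 - i` on `S` would switch and then be carried by flow `i` into `A`, where state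
`i` has none. -/
lemma IsBalanced.null_of_null (hlam : ∀ i, 0 < lam i) (h : IsBalanced lam a γ m) {i : Fin 2}
    {A S : Set ℝ} (hA : MeasurableSet A) (h0 : m i A = 0)
    (hS : ∀ y ∈ S, ∀ᶠ s in atTop, flow a γ i s y ∈ A) : m (1 - i) S = 0 := by
  have h1 := h i A hA
  rw [h0, mul_zero, eq_comm, mul_eq_zero, or_iff_right (by simp [hlam (1 - i)]),
    lintegral_eq_zero_iff (measurable_measure_flow _ i hA)] at h1
  exact null_of_eventually (E := fun s => flow a γ i s ⁻¹' A)
    (frequently_of_ae_holdMeasure (hlam i) h1) hS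

end KacOU
end

/-! ### Location of the mass; non-existence for two repelling flows -/

noncomputable section

open scoped ENNReal

namespace KacOU

variable {lam a γ : Fin 2 → ℝ} {m : Fin 2 → Measure ℝ}

/-- The symmetry `(x, i) ↦ (-x, 1 - i)`. Exchanging the states as well as the sign preserves the
order `ρ₀ < ρ₁`. -/
lemma IsBalanced.reflect (h : IsBalanced lam a γ m) :
    IsBalanced (fun i => lam (1 - i)) (fun i => -a (1 - i)) (fun i => γ (1 - i))
      fun i => (m (1 - i)).map fun x => -x := by
  intro i A hA
  have hn : MeasurableSet ((fun x : ℝ => -x) ⁻¹' A) := measurable_neg hA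
  have h1 := h (1 - i) _ hn
  have hf : ∀ s, MeasurableSet
      (flow (fun i => -a (1 - i)) (fun i => γ (1 - i)) i s ⁻¹' A) := fun s =>
    (measurable_flow i).comp (by fun_prop : Measurable fun y : ℝ => (s, y)) hA
  have hpre : ∀ s, (fun x : ℝ => -x) ⁻¹'
      (flow (fun i => -a (1 - i)) (fun i => γ (1 - i)) i s ⁻¹' A) =
      flow a γ (1 - i) s ⁻¹' ((fun x : ℝ => -x) ⁻¹' A) := by
    intro s
    ext y
    simp only [mem_preimage, flow, rho]
    ring_nf
  simp only [Measure.map_apply measurable_neg hA, Measure.map_apply measurable_neg (hf _), hpre, h1]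

lemma flow_sub_rho (i : Fin 2) (s y : ℝ) :
    flow a γ i s y - rho a γ i = (y - rho a γ i) * Real.exp (-(γ i * s)) := by
  unfold flow; ring

lemma rho_le_flow {i : Fin 2} {s y : ℝ} : rho a γ i ≤ flow a γ i s y ↔ rho a γ i ≤ y := by
  rw [← sub_nonneg, flow_sub_rho, mul_nonneg_iff_of_pos_right (Real.exp_pos _), sub_nonneg]

lemma flow_lt_rho {i : Fin 2} {s y : ℝ} : flow a γ i s y < rho a γ i ↔ y < rho a γ i := by
  rw [← not_le, rho_le_flow, not_le]

lemma one_le_exp_of_neg {i : Fin 2} (hγ : γ i < 0) {s : ℝ} (hs : 0 < s) :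
    1 ≤ Real.exp (-(γ i * s)) := Real.one_le_exp (by nlinarith)

lemma le_flow {i : Fin 2} (hγ : γ i < 0) {s y : ℝ} (hs : 0 < s) (hy : rho a γ i ≤ y) :
    y ≤ flow a γ i s y := by
  have h := one_le_exp_of_neg hγ hs
  unfold flow
  nlinarith

lemma flow_le {i : Fin 2} (hγ : γ i < 0) {s y : ℝ} (hs : 0 < s) (hy : y ≤ rho a γ i) :
    flow a γ i s y ≤ y := by
  have h := one_le_exp_of_neg hγ hs
  unfold flow
  nlinarith

lemma tendsto_exp_flow {i : Fin 2} (hγ : γ i < 0) :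
    Tendsto (fun s => Real.exp (-(γ i * s))) atTop atTop := by
  refine Real.tendsto_exp_atTop.comp ?_
  simp only [← neg_mul]
  exact tendsto_id.const_mul_atTop (neg_pos.2 hγ)

lemma tendsto_flow_atTop {i : Fin 2} (hγ : γ i < 0) {y : ℝ} (hy : rho a γ i < y) :
    Tendsto (fun s => flow a γ i s y) atTop atTop :=
  tendsto_atTop_add_const_left _ _ ((tendsto_exp_flow hγ).const_mul_atTop (sub_pos.2 hy))

lemma tendsto_flow_atBot {i : Fin 2} (hγ : γ i < 0) {y : ℝ} (hy : y < rho a γ i) :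
    Tendsto (fun s => flow a γ i s y) atTop atBot :=
  tendsto_atBot_add_const_left _ _ ((tendsto_exp_flow hγ).const_mul_atTop_of_neg (sub_neg.2 hy))

lemma tendsto_flow_rho {i : Fin 2} (hγ : 0 < γ i) (y : ℝ) :
    Tendsto (fun s => flow a γ i s y) atTop (𝓝 (rho a γ i)) := by
  have h : Tendsto (fun s => Real.exp (-(γ i * s))) atTop (𝓝 0) :=
    Real.tendsto_exp_neg_atTop_nhds_zero.comp (tendsto_id.const_mul_atTop hγ)
  simpa [flow] using (h.const_mul (y - rho a γ i)).const_add (rho a γ i)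

variable [∀ i, IsFiniteMeasure (m i)]

/-- For `c ≥ ρ₁` the half-line `[c, ∞)` is forward invariant under both flows, so it cannot gain
mass. But flow `0` eventually carries all of `(ρ₀, c)` into it; hence state `1`, which feeds state
`0`, has no mass there. -/
lemma IsBalanced.null_Ioi_of_neg (hlam : ∀ i, 0 < lam i) (h : IsBalanced lam a γ m)
    (hρ : rho a γ 0 < rho a γ 1) (h0 : γ 0 < 0) (h1 : γ 1 < 0) : m 1 (Ioi (rho a γ 0)) = 0 := by
  have key : ∀ c, rho a γ 1 ≤ c → m 1 (Ioo (rho a γ 0) c) = 0 := by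
    intro c hc
    have hle := h.mul_le (i := 1) hlam (measurableSet_Ici (a := c)) fun s hs y hy =>
      mem_preimage.2 (mem_Ici.2 (le_trans hy (le_flow h1 hs (hc.trans hy))))
    refine h.null_of_subset (i := 0) hlam (measurableSet_Ici (a := c)) (fun s hs y hy =>
      mem_preimage.2 (mem_Ici.2 (le_trans hy (le_flow h0 hs ?_)))) hle fun y hy =>
        ⟨fun hy' => not_lt.2 (mem_Ici.1 hy') hy.2,
          (tendsto_flow_atTop h0 hy.1).eventually (eventually_ge_atTop c)⟩
    exact (hρ.le.trans hc).trans hy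
  have hU : Ioi (rho a γ 0) ⊆ ⋃ n : ℕ, Ioo (rho a γ 0) (rho a γ 1 + n) := by
    intro y hy
    obtain ⟨n, hn⟩ := exists_nat_gt (y - rho a γ 1)
    exact mem_iUnion.2 ⟨n, hy, by linarith⟩
  exact measure_mono_null hU (measure_iUnion_null fun n => key _ (by simp))

/-- There is no stationary distribution if both flows are repelling. -/
theorem IsBalanced.eq_zero_of_neg (hlam : ∀ i, 0 < lam i) (h : IsBalanced lam a γ m)
    (hρ : rho a γ 0 < rho a γ 1) (h0 : γ 0 < 0) (h1 : γ 1 < 0) (i : Fin 2) : m i univ = 0 := by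
  have hr : ∀ i, rho (fun i => -a (1 - i)) (fun i => γ (1 - i)) i = -rho a γ (1 - i) := by
    intro i; unfold rho; ring
  have hm1 := h.null_Ioi_of_neg hlam hρ h0 h1
  have hm0 : m 0 (Iio (rho a γ 1)) = 0 := by
    have := h.reflect.null_Ioi_of_neg (fun i => hlam (1 - i)) (by rw [hr, hr]; simpa using hρ)
      (by simpa using h1) (by simpa using h0)
    rw [hr, Measure.map_apply measurable_neg measurableSet_Ioi] at this
    simpa using this
  have hpos : ∀ i, ENNReal.ofReal (lam i) ≠ 0 := fun i => by simp [hlam i]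
  -- Flow `1` preserves `[ρ₁, ∞)`, so the masses of the two states there are proportional, and that
  -- of state `1` is already known to vanish.
  have hI : m 0 (Ici (rho a γ 1)) = 0 := by
    have := h.mul_eq (i := 1) hlam (measurableSet_Ici (a := rho a γ 1)) fun s _ => by
      ext y; exact rho_le_flow
    rw [measure_mono_null (Ici_subset_Ioi.2 hρ) hm1, mul_zero, eq_comm, mul_eq_zero,
      or_iff_right (hpos _)] at this
    exact this
  have hU0 : m 0 univ = 0 := by
    rw [← Iio_union_Ici (a := rho a γ 1)]
    exact measure_union_null hm0 hI
  fin_cases i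
  · exact hU0
  · have := h.mul_eq (i := 1) hlam MeasurableSet.univ fun s _ => by simp
    rw [show m (1 - 1) univ = 0 from hU0, mul_zero, mul_eq_zero, or_iff_right (hpos _)] at this
    exact this

/-- If the flow of the state `0` is attracting and the other one is repelling, then a stationary
distribution is carried by the half-line below the attracting point. -/
theorem IsBalanced.null_Ici (hlam : ∀ i, 0 < lam i) (h : IsBalanced lam a γ m)
    (hρ : rho a γ 0 < rho a γ 1) (h0 : 0 < γ 0) (h1 : γ 1 < 0) (i : Fin 2) :
    m i (Ici (rho a γ 0)) = 0 := by
  have hpos : ∀ i, ENNReal.ofReal (lam i) ≠ 0 := fun i => by simp [hlam i]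
  -- Flow `0` preserves `(-∞, ρ₀)`, which forces equality of the switching rates there. Flow `1`
  -- never leaves this half-line and eventually brings `[ρ₀, ρ₁)` into it, which would add mass.
  have hm0 : m 0 (Ico (rho a γ 0) (rho a γ 1)) = 0 := by
    have hle := h.mul_eq (i := 0) hlam (measurableSet_Iio (a := rho a γ 0)) fun s _ => by
      ext y; exact flow_lt_rho
    refine h.null_of_subset (i := 1) hlam (measurableSet_Iio (a := rho a γ 0))
      (fun s hs y hy => mem_preimage.2 (mem_Iio.2 (lt_of_le_of_lt (flow_le h1 hs ?_) hy)))
      hle.ge fun y hy => ⟨not_lt.2 hy.1,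
        (tendsto_flow_atBot h1 hy.2).eventually (eventually_lt_atBot _)⟩
    exact (lt_trans hy hρ).le
  -- Flow `0` attracts every point of `[ρ₀, ∞)` to `ρ₀` from above, hence into the null interval
  -- `[ρ₀, ρ₁)`.
  have hm1 : m 1 (Ici (rho a γ 0)) = 0 :=
    h.null_of_null (i := 0) hlam measurableSet_Ico hm0 fun y hy => by
      filter_upwards [(tendsto_flow_rho h0 y).eventually (eventually_lt_nhds hρ)] with s hs
      exact ⟨rho_le_flow.2 hy, hs⟩
  fin_cases i
  · have := h.mul_eq (i := 0) hlam (measurableSet_Ici (a := rho a γ 0)) fun s _ => by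
      ext y; exact rho_le_flow
    rw [show m (1 - 0) (Ici (rho a γ 0)) = 0 from hm1, mul_zero, mul_eq_zero,
      or_iff_right (hpos _)] at this
    exact this
  · exact hm1

end KacOU
end

/-! ### Differential equations for the distribution functions -/

noncomputable section

open scoped ENNReal

namespace KacOU

variable {lam a γ : Fin 2 → ℝ} {m : Fin 2 → Measure ℝ} [∀ i, IsFiniteMeasure (m i)]

lemma flow_preimage_Iic (i : Fin 2) (s x : ℝ) :
    flow a γ i s ⁻¹' Iic x = Iic (flow a γ i (-s) x) := by
  ext y
  have he : Real.exp (-(γ i * -s)) = (Real.exp (-(γ i * s)))⁻¹ := by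
    rw [← Real.exp_neg]; ring_nf
  have hp := Real.exp_pos (-(γ i * s))
  simp only [mem_preimage, mem_Iic, flow, he]
  rw [← sub_le_iff_le_add', ← le_sub_iff_add_le', ← div_eq_mul_inv, le_div_iff₀ hp]

/-- In the coordinate `x = ρ_i - exp (γ_i τ)`, which covers `x < ρ_i`, the backward flow is a
translation of `τ`; the balance equation becomes a Laplace-type integral over `(τ, ∞)`. -/
lemma flow_neg_exp (i : Fin 2) (s τ : ℝ) :
    flow a γ i (-s) (rho a γ i - Real.exp (γ i * τ)) = rho a γ i - Real.exp (γ i * (s + τ)) := by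
  unfold flow
  rw [mul_add, Real.exp_add]
  ring_nf

lemma measurable_measure_Iic_flow (j i : Fin 2) (x : ℝ) :
    Measurable fun s => m j (Iic (flow a γ i (-s) x)) := by
  simpa only [flow_preimage_Iic] using
    measurable_measure_flow (a := a) (γ := γ) (m j) i (measurableSet_Iic (a := x))

lemma toReal_lintegral_holdMeasure {c : ℝ} (hc : 0 < c) (i j : Fin 2) (x : ℝ) :
    (∫⁻ s, m j (flow a γ i s ⁻¹' Iic x) ∂holdMeasure c).toReal =
      c * ∫ s in Ioi 0, Real.exp (-(c * s)) * (m j).real (Iic (flow a γ i (-s) x)) := by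
  simp only [flow_preimage_Iic]
  rw [lintegral_holdMeasure _ (measurable_measure_Iic_flow j i x), ← integral_toReal]
  · rw [← integral_const_mul]
    refine integral_congr_ae (ae_of_all _ fun s => ?_)
    beta_reduce
    rw [ENNReal.toReal_mul, ENNReal.toReal_ofReal (mul_pos hc (Real.exp_pos _)).le, mul_assoc]
    rfl
  · exact (Measurable.mul (by fun_prop) (measurable_measure_Iic_flow j i x)).aemeasurable
  · exact ae_of_all _ fun s => by finiteness

/-- The distribution functions of a balanced pair, along the flow. -/
lemma IsBalanced.real_Iic (hlam : ∀ i, 0 < lam i) (h : IsBalanced lam a γ m) (i : Fin 2) (x : ℝ) :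
    (m i).real (Iic x) = lam (1 - i) *
      ∫ s in Ioi 0, Real.exp (-(lam i * s)) * (m (1 - i)).real (Iic (flow a γ i (-s) x)) := by
  have h2 := congrArg ENNReal.toReal (h i (Iic x) measurableSet_Iic)
  rw [ENNReal.toReal_mul, ENNReal.toReal_mul, ENNReal.toReal_ofReal (hlam _).le,
    ENNReal.toReal_ofReal (hlam _).le, toReal_lintegral_holdMeasure (hlam i), mul_left_comm] at h2
  exact mul_left_cancel₀ (hlam i).ne' h2

lemma isBalanced_of_real_Iic (hlam : ∀ i, 0 < lam i) (h : ∀ i x, (m i).real (Iic x) =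
    lam (1 - i) * ∫ s in Ioi 0, Real.exp (-(lam i * s)) *
      (m (1 - i)).real (Iic (flow a γ i (-s) x))) : IsBalanced lam a γ m := by
  intro i A hA
  have hhold : IsProbabilityMeasure (holdMeasure (lam i)) := ⟨holdMeasure_univ (hlam i)⟩
  have hflow : Measurable fun p : ℝ × ℝ => flow a γ i p.1 p.2 := measurable_flow i
  have hmap : ∀ B, MeasurableSet B →
      ((holdMeasure (lam i)).prod (m (1 - i))).map (fun p => flow a γ i p.1 p.2) B =
        ∫⁻ s, m (1 - i) (flow a γ i s ⁻¹' B) ∂holdMeasure (lam i) := fun B hB => by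
    rw [Measure.map_apply hflow hB, Measure.prod_apply (hflow hB)]
    rfl
  have hfin : ∀ x, ∫⁻ s, m (1 - i) (flow a γ i s ⁻¹' Iic x) ∂holdMeasure (lam i) ≠ ∞ := fun x => by
    rw [← hmap _ measurableSet_Iic]
    finiteness
  have : IsFiniteMeasure (ENNReal.ofReal (lam i) • m i) :=
    Measure.smul_finite _ ENNReal.ofReal_ne_top
  have heq : ENNReal.ofReal (lam i) • m i = ENNReal.ofReal (lam (1 - i)) •
      ((holdMeasure (lam i)).prod (m (1 - i))).map (fun p => flow a γ i p.1 p.2) := by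
    refine Measure.ext_of_Iic _ _ fun x => ?_
    rw [Measure.smul_apply, Measure.smul_apply, hmap _ measurableSet_Iic, smul_eq_mul, smul_eq_mul,
      ← ENNReal.toReal_eq_toReal_iff' (by finiteness)
        (ENNReal.mul_ne_top ENNReal.ofReal_ne_top (hfin x)),
      ENNReal.toReal_mul, ENNReal.toReal_mul, ENNReal.toReal_ofReal (hlam _).le,
      ENNReal.toReal_ofReal (hlam _).le, toReal_lintegral_holdMeasure (hlam i), mul_left_comm]
    exact congrArg _ (h i x)
  have := congrArg (fun μ : Measure ℝ => μ A) heq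
  simpa only [Measure.smul_apply, hmap _ hA, smul_eq_mul] using this

lemma integrableOn_exp_mul_of_bounded {c C τ : ℝ} (hc : 0 < c) {K : ℝ → ℝ} (hK : Measurable K)
    (hb : ∀ s, |K s| ≤ C) : IntegrableOn (fun s => Real.exp (-(c * s)) * K s) (Ioi τ) := by
  have hi := integrableOn_exp_mul_Ioi (a := -c) (by linarith) τ
  simp only [neg_mul] at hi
  exact Integrable.mul_bdd (c := C) hi hK.aestronglyMeasurable (ae_of_all _ fun s => hb s)

/-- The function solves `u' = c u - K`. Both conclusions are needed for a bootstrap: bounded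
measurable `K` already gives continuity of `u`, and continuity of `K` at a point gives the
derivative there. -/
lemma hasDerivAt_exp_mul_integral_Ioi {c C : ℝ} (hc : 0 < c) {K : ℝ → ℝ} (hK : Measurable K)
    (hb : ∀ s, |K s| ≤ C) :
    Continuous (fun τ => Real.exp (c * τ) * ∫ s in Ioi τ, Real.exp (-(c * s)) * K s) ∧
    ∀ τ, ContinuousAt K τ →
      HasDerivAt (fun τ => Real.exp (c * τ) * ∫ s in Ioi τ, Real.exp (-(c * s)) * K s)
        (c * (Real.exp (c * τ) * ∫ s in Ioi τ, Real.exp (-(c * s)) * K s) - K τ) τ := by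
  set g : ℝ → ℝ := fun s => Real.exp (-(c * s)) * K s with hg
  have hgm : Measurable g := by fun_prop
  have hgi : ∀ τ, IntegrableOn g (Ioi τ) := fun τ => integrableOn_exp_mul_of_bounded hc hK hb
  have hgii : ∀ s t, IntervalIntegrable g volume s t := fun s t =>
    intervalIntegrable_iff.2 ((hgi (min s t)).mono_set Ioc_subset_Ioi_self)
  obtain ⟨D, hD⟩ : ∃ D, D = ∫ s in Ioi 0, g s := ⟨_, rfl⟩
  have hsplit : ∀ τ, ∫ s in Ioi τ, g s = D - ∫ s in (0 : ℝ)..τ, g s := by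
    intro τ
    rw [hD, ← intervalIntegral.integral_Ioi_sub_Ioi' (hgi 0) (hgi τ), sub_sub_cancel]
  simp only [hsplit]
  have hcont : Continuous fun τ => ∫ s in (0 : ℝ)..τ, g s :=
    intervalIntegral.continuous_primitive hgii 0
  refine ⟨by fun_prop, fun τ hKτ => ?_⟩
  have hd := intervalIntegral.integral_hasDerivAt_right (hgii 0 τ)
    hgm.stronglyMeasurable.stronglyMeasurableAtFilter
    ((by fun_prop : ContinuousAt (fun s => Real.exp (-(c * s))) τ).mul hKτ)
  have he : HasDerivAt (fun τ => Real.exp (c * τ)) (Real.exp (c * τ) * c) τ := by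
    simpa using ((hasDerivAt_id τ).const_mul c).exp
  refine (he.mul (hd.const_sub D)).congr_deriv ?_
  have : Real.exp (c * τ) * Real.exp (-(c * τ)) = 1 := by rw [← Real.exp_add]; simp
  linear_combination -K τ * this

lemma IsBalanced.real_Iic_exp (hlam : ∀ i, 0 < lam i) (h : IsBalanced lam a γ m) (i : Fin 2)
    (τ : ℝ) : (m i).real (Iic (rho a γ i - Real.exp (γ i * τ))) =
      lam (1 - i) * (Real.exp (lam i * τ) * ∫ s in Ioi τ, Real.exp (-(lam i * s)) *
        (m (1 - i)).real (Iic (rho a γ i - Real.exp (γ i * s)))) := by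
  rw [h.real_Iic hlam i, ← integral_const_mul (Real.exp (lam i * τ))]
  simp only [flow_neg_exp]
  congr 1
  have hsub : ∀ g : ℝ → ℝ, ∫ s in Ioi 0, g (s + τ) = ∫ s in Ioi τ, g s := by
    intro g
    rw [← integral_indicator measurableSet_Ioi, ← integral_indicator measurableSet_Ioi,
      ← integral_add_right_eq_self ((Ioi τ).indicator g) τ]
    refine integral_congr_ae (ae_of_all _ fun s => ?_)
    simp [indicator]
  rw [← hsub]
  refine integral_congr_ae (ae_of_all _ fun s => ?_)
  beta_reduce
  rw [← mul_assoc, ← Real.exp_add]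
  ring_nf

lemma measurable_real_Iic (ν : Measure ℝ) [IsFiniteMeasure ν] : Measurable fun x => ν.real (Iic x) :=
  Monotone.measurable fun _ _ hxy => measureReal_mono (Iic_subset_Iic.2 hxy)

lemma measurable_real_Iic_exp (i : Fin 2) (j : Fin 2) :
    Measurable fun s => (m j).real (Iic (rho a γ i - Real.exp (γ i * s))) :=
  (measurable_real_Iic (m j)).comp (by fun_prop : Measurable fun s => rho a γ i - Real.exp (γ i * s))

lemma abs_real_Iic_le (ν : Measure ℝ) [IsFiniteMeasure ν] (x : ℝ) :
    |ν.real (Iic x)| ≤ ν.real univ := by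
  rw [abs_of_nonneg measureReal_nonneg]
  exact measureReal_mono (subset_univ _)

lemma hasDerivAt_log_rho {i : Fin 2} {x : ℝ} (hx : x < rho a γ i) :
    HasDerivAt (fun y => Real.log (rho a γ i - y) / γ i) (-(1 / (γ i * (rho a γ i - x)))) x := by
  have h := (((hasDerivAt_id x).const_sub (rho a γ i)).log (sub_pos.2 hx).ne').div_const (γ i)
  refine h.congr_deriv ?_
  rw [id, div_div, mul_comm (γ i), neg_div]

lemma real_Iic_eq_comp_log {i : Fin 2} (hγ : γ i ≠ 0) (ν : Measure ℝ) {x : ℝ}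
    (hx : x < rho a γ i) : ν.real (Iic x) = ν.real (Iic (rho a γ i -
      Real.exp (γ i * (Real.log (rho a γ i - x) / γ i)))) := by
  rw [mul_div_cancel₀ _ hγ, Real.exp_log (sub_pos.2 hx), sub_sub_cancel]

/-- First half of the bootstrap: the other distribution function enters only under the integral,
where boundedness suffices. In particular there are no atoms below `ρ_i`. -/
lemma IsBalanced.continuousAt (hlam : ∀ i, 0 < lam i) (hγ : ∀ i, γ i ≠ 0) (h : IsBalanced lam a γ m)
    {i : Fin 2} {x : ℝ} (hx : x < rho a γ i) : ContinuousAt (fun y => (m i).real (Iic y)) x := by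
  have hH : Continuous fun τ => (m i).real (Iic (rho a γ i - Real.exp (γ i * τ))) := by
    simp only [h.real_Iic_exp hlam i]
    exact continuous_const.mul (hasDerivAt_exp_mul_integral_Ioi (hlam i)
      (measurable_real_Iic_exp i (1 - i)) fun s => abs_real_Iic_le _ _).1
  refine (ContinuousAt.comp (f := fun y => Real.log (rho a γ i - y) / γ i) hH.continuousAt
    (hasDerivAt_log_rho hx).continuousAt).congr ?_
  filter_upwards [eventually_lt_nhds hx] with y hy
  exact (real_Iic_eq_comp_log (hγ i) _ hy).symm

/-- The differential equations of the distribution functions of a balanced pair. -/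
lemma IsBalanced.hasDerivAt (hlam : ∀ i, 0 < lam i) (hγ : ∀ i, γ i ≠ 0) (h : IsBalanced lam a γ m)
    {i : Fin 2} {x : ℝ} (hx : x < rho a γ i) (hx' : x < rho a γ (1 - i)) :
    HasDerivAt (fun y => (m i).real (Iic y)) ((lam (1 - i) * (m (1 - i)).real (Iic x) -
      lam i * (m i).real (Iic x)) / (γ i * (rho a γ i - x))) x := by
  set τ := Real.log (rho a γ i - x) / γ i with hτ
  have hxτ : rho a γ i - Real.exp (γ i * τ) = x := by
    rw [hτ, mul_div_cancel₀ _ (hγ i), Real.exp_log (sub_pos.2 hx), sub_sub_cancel]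
  -- Second half of the bootstrap: continuity of the other distribution function holds below its own
  -- `ρ`, whence the hypothesis `hx'`.
  have hK : ContinuousAt (fun s => (m (1 - i)).real (Iic (rho a γ i - Real.exp (γ i * s)))) τ := by
    refine ContinuousAt.comp (g := fun y => (m (1 - i)).real (Iic y)) ?_ (by fun_prop)
    rw [hxτ]
    exact h.continuousAt hlam hγ hx'
  have hH : HasDerivAt (fun τ => (m i).real (Iic (rho a γ i - Real.exp (γ i * τ))))
      (lam i * (m i).real (Iic x) - lam (1 - i) * (m (1 - i)).real (Iic x)) τ := by
    have h1 := ((hasDerivAt_exp_mul_integral_Ioi (hlam i)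
      (measurable_real_Iic_exp (m := m) (a := a) (γ := γ) i (1 - i))
      fun s => abs_real_Iic_le _ _).2 τ hK).const_mul (lam (1 - i))
    simp only [← h.real_Iic_exp hlam i] at h1
    refine h1.congr_deriv ?_
    rw [mul_sub, mul_left_comm, ← h.real_Iic_exp hlam i, hxτ]
  have h2 := hH.comp x (hasDerivAt_log_rho hx)
  refine (h2.congr_of_eventuallyEq ?_).congr_deriv ?_
  · filter_upwards [eventually_lt_nhds hx] with y hy
    exact real_Iic_eq_comp_log (hγ i) _ hy
  · ring

end KacOU
end

/-! ### Beta integrals and the scalar flux equation -/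

noncomputable section

open scoped ENNReal

namespace KacOU

lemma lintegral_rpow_mul_exp {q r : ℝ} (hq : 0 < q) (hr : 0 < r) :
    ∫⁻ y in Ioi 0, ENNReal.ofReal (y ^ (q - 1) * Real.exp (-(r * y))) =
      ENNReal.ofReal (Real.Gamma q * r ^ (-q)) := by
  have h := Real.integral_rpow_mul_exp_neg_mul_Ioi hq hr
  have hG := Real.Gamma_pos_of_pos hq
  rw [← ofReal_integral_eq_lintegral_ofReal]
  · rw [h, one_div, Real.inv_rpow hr.le, ← Real.rpow_neg hr.le, mul_comm]
  · exact .of_integral_ne_zero (by rw [h]; positivity)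
  · filter_upwards [ae_restrict_mem measurableSet_Ioi] with y hy
    exact mul_nonneg (Real.rpow_nonneg (le_of_lt hy) _) (Real.exp_pos _).le

/-- Write `(t + d) ^ (-q)` as a Gamma integral over `y` and use Tonelli: the `t`-integral gives
`Γ(p) y ^ (-p)`, and the remaining one gives `Γ(q - p) d ^ (p - q)`. -/
lemma lintegral_rpow_mul_add_rpow {p q d : ℝ} (hp : 0 < p) (hpq : p < q) (hd : 0 < d) :
    ∫⁻ t in Ioi 0, ENNReal.ofReal (t ^ (p - 1) * (t + d) ^ (-q)) =
      ENNReal.ofReal (d ^ (p - q) * beta (q - p) p) := by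
  have hq : 0 < q := hp.trans hpq
  have hGq := Real.Gamma_pos_of_pos hq
  have hGp := Real.Gamma_pos_of_pos hp
  have hGpq := Real.Gamma_pos_of_pos (sub_pos.2 hpq)
  have hm : Measurable (Function.uncurry fun t y : ℝ =>
      ENNReal.ofReal (t ^ (p - 1) * (y ^ (q - 1) * Real.exp (-((t + d) * y))))) := by
    fun_prop
  have h1 : ∫⁻ t in Ioi 0, ENNReal.ofReal (t ^ (p - 1) * (t + d) ^ (-q)) =
      ENNReal.ofReal (Real.Gamma q)⁻¹ * ∫⁻ t in Ioi 0, ∫⁻ y in Ioi 0,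
        ENNReal.ofReal (t ^ (p - 1) * (y ^ (q - 1) * Real.exp (-((t + d) * y)))) := by
    rw [← lintegral_const_mul' _ _ ENNReal.ofReal_ne_top]
    refine setLIntegral_congr_fun measurableSet_Ioi fun t ht => ?_
    have ht0 : 0 < t := ht
    have hpow : 0 ≤ t ^ (p - 1) := (Real.rpow_pos_of_pos ht0 _).le
    simp only [ENNReal.ofReal_mul hpow]
    rw [lintegral_const_mul' _ _ ENNReal.ofReal_ne_top, lintegral_rpow_mul_exp hq (by positivity),
      mul_left_comm, ← ENNReal.ofReal_mul (inv_pos.2 hGq).le, inv_mul_cancel_left₀ hGq.ne']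
  have h2 : ∀ y ∈ Ioi (0 : ℝ), ∫⁻ t in Ioi 0,
      ENNReal.ofReal (t ^ (p - 1) * (y ^ (q - 1) * Real.exp (-((t + d) * y)))) =
      ENNReal.ofReal (Real.Gamma p) *
        ENNReal.ofReal (y ^ ((q - p) - 1) * Real.exp (-(d * y))) := by
    intro y hy
    have hy0 : 0 < y := hy
    have hc : 0 ≤ y ^ (q - 1) * Real.exp (-(d * y)) := by positivity
    have h3 : ∀ t, ENNReal.ofReal (t ^ (p - 1) * (y ^ (q - 1) * Real.exp (-((t + d) * y)))) =
        ENNReal.ofReal (y ^ (q - 1) * Real.exp (-(d * y))) *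
          ENNReal.ofReal (t ^ (p - 1) * Real.exp (-(y * t))) := by
      intro t
      rw [← ENNReal.ofReal_mul hc, add_mul, neg_add, Real.exp_add]
      ring_nf
    simp only [h3]
    rw [lintegral_const_mul' _ _ ENNReal.ofReal_ne_top, lintegral_rpow_mul_exp hp hy0,
      ← ENNReal.ofReal_mul hc, ← ENNReal.ofReal_mul hGp.le,
      show q - p - 1 = (q - 1) + -p by ring, Real.rpow_add hy0]
    ring_nf
  rw [h1, lintegral_lintegral_swap hm.aemeasurable, setLIntegral_congr_fun measurableSet_Ioi h2,
    lintegral_const_mul' _ _ ENNReal.ofReal_ne_top, lintegral_rpow_mul_exp (sub_pos.2 hpq) hd,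
    ← ENNReal.ofReal_mul hGp.le, ← ENNReal.ofReal_mul (inv_pos.2 hGq).le, beta,
    sub_add_cancel, neg_sub]
  congr 1
  field_simp

lemma integrable_and_integral_rpow_mul_add_rpow {p q d : ℝ} (hp : 0 < p) (hpq : p < q)
    (hd : 0 < d) : IntegrableOn (fun t => t ^ (p - 1) * (t + d) ^ (-q)) (Ioi 0) ∧
      ∫ t in Ioi 0, t ^ (p - 1) * (t + d) ^ (-q) = d ^ (p - q) * beta (q - p) p := by
  have h := lintegral_rpow_mul_add_rpow hp hpq hd
  have hnn : 0 ≤ᵐ[volume.restrict (Ioi 0)] fun t : ℝ => t ^ (p - 1) * (t + d) ^ (-q) := by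
    filter_upwards [ae_restrict_mem measurableSet_Ioi] with t ht
    have ht0 : 0 < t := ht
    simp only [Pi.zero_apply]
    positivity
  have hm : Measurable fun t : ℝ => t ^ (p - 1) * (t + d) ^ (-q) := by fun_prop
  refine ⟨⟨hm.aestronglyMeasurable, ?_⟩, ?_⟩
  · rw [hasFiniteIntegral_iff_ofReal hnn, h]
    exact ENNReal.ofReal_lt_top
  · rw [integral_eq_lintegral_of_nonneg_ae hnn hm.aestronglyMeasurable, h, ENNReal.toReal_ofReal]
    exact mul_nonneg (Real.rpow_nonneg hd.le _) (beta_pos (sub_pos.2 hpq) hp).le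

lemma measurableEmbedding_sub_left (r : ℝ) : MeasurableEmbedding fun t : ℝ => r - t :=
  (Homeomorph.subLeft r).measurableEmbedding

lemma integrableOn_Iio_iff (r : ℝ) (f : ℝ → ℝ) :
    IntegrableOn f (Iio r) ↔ IntegrableOn (fun t => f (r - t)) (Ioi 0) := by
  have h := (Measure.measurePreserving_sub_left volume r).integrableOn_comp_preimage
    (measurableEmbedding_sub_left r) (f := f) (s := Iio r)
  rw [← h]
  simp [Function.comp_def]

lemma integral_Iio_eq (r : ℝ) (f : ℝ → ℝ) :
    ∫ x in Iio r, f x = ∫ t in Ioi 0, f (r - t) := by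
  have h := (Measure.measurePreserving_sub_left volume r).setIntegral_preimage_emb
    (measurableEmbedding_sub_left r) f (Iio r)
  rw [← h]
  simp

/-- For `t > 1` one has `t + d ≤ (1 + d) t`; since `β < 0`, the integrand dominates a multiple of `t
^ (α + β - 1)`, whose integrability at infinity decides. -/
lemma add_neg_of_integrableOn {α β d : ℝ} (hβ : β < 0) (hd : 0 < d)
    (h : IntegrableOn (fun t : ℝ => t ^ (α - 1) * (t + d) ^ β) (Ioi 1)) : α + β < 0 := by
  have h1 : IntegrableOn (fun t : ℝ => t ^ (α + β - 1)) (Ioi 1) := by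
    refine Integrable.mono' (h.const_mul ((1 + d) ^ (-β))) (by fun_prop) ?_
    filter_upwards [ae_restrict_mem measurableSet_Ioi] with t ht
    have ht1 : 1 < t := ht
    have ht0 : 0 < t := one_pos.trans ht1
    rw [Real.norm_of_nonneg (by positivity), show α + β - 1 = (α - 1) + β by ring,
      Real.rpow_add ht0, mul_left_comm]
    gcongr
    have h2 : ((1 + d) * t) ^ β ≤ (t + d) ^ β :=
      Real.rpow_le_rpow_of_nonpos (by positivity) (by nlinarith) hβ.le
    rw [Real.mul_rpow (by positivity) ht0.le] at h2
    calc t ^ β = (1 + d) ^ (-β) * ((1 + d) ^ β * t ^ β) := by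
          rw [← mul_assoc, ← Real.rpow_add (by positivity)]; simp
      _ ≤ _ := by gcongr
  have := (integrableOn_Ioi_rpow_iff one_pos).1 h1
  linarith

section
variable {r₀ r₁ α β : ℝ}

/-- The common value of the two fluxes, up to a constant. -/
def flux (r₀ r₁ α β x : ℝ) : ℝ := (r₀ - x) ^ α * (r₁ - x) ^ β

lemma hasDerivAt_flux (hr : r₀ < r₁) {x : ℝ} (hx : x < r₀) : HasDerivAt (flux r₀ r₁ α β)
    (-(flux r₀ r₁ α β x * (α / (r₀ - x) + β / (r₁ - x)))) x := by
  have h0 : 0 < r₀ - x := sub_pos.2 hx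
  have h1 : 0 < r₁ - x := sub_pos.2 (hx.trans hr)
  have d0 := ((hasDerivAt_id x).const_sub r₀).rpow_const (p := α) (.inl h0.ne')
  have d1 := ((hasDerivAt_id x).const_sub r₁).rpow_const (p := β) (.inl h1.ne')
  refine (d0.mul d1).congr_deriv ?_
  simp only [id, flux]
  rw [Real.rpow_sub_one h0.ne', Real.rpow_sub_one h1.ne']
  field_simp
  ring

lemma flux_pos (hr : r₀ < r₁) {x : ℝ} (hx : x < r₀) : 0 < flux r₀ r₁ α β x :=
  mul_pos (Real.rpow_pos_of_pos (sub_pos.2 hx) _) (Real.rpow_pos_of_pos (sub_pos.2 (hx.trans hr)) _)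

/-- The flux equation has a one-dimensional space of solutions. -/
lemma exists_eq_mul_flux (hr : r₀ < r₁) {G : ℝ → ℝ} (hG : ∀ x < r₀,
    HasDerivAt G (-(G x * (α / (r₀ - x) + β / (r₁ - x)))) x) :
    ∃ C, ∀ x < r₀, G x = C * flux r₀ r₁ α β x := by
  have hd : ∀ x < r₀, HasDerivAt (fun x => G x / flux r₀ r₁ α β x) 0 x := by
    intro x hx
    refine ((hG x hx).div (hasDerivAt_flux hr hx) (flux_pos hr hx).ne').congr_deriv ?_
    rw [div_eq_zero_iff]
    left
    ring
  refine ⟨G (r₀ - 1) / flux r₀ r₁ α β (r₀ - 1), fun x hx => ?_⟩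
  rw [← div_eq_iff (flux_pos hr hx).ne']
  exact isOpen_Iio.is_const_of_deriv_eq_zero isPreconnected_Iio
    (fun y hy => (hd y hy).differentiableAt.differentiableWithinAt) (fun y hy => (hd y hy).deriv)
    hx (by simp)

/-- As `α > 0` and `r₀ < r₁`, the flux lies below `(r₁ - x) ^ (α + β)`. -/
lemma tendsto_flux_atBot (hr : r₀ < r₁) (hα : 0 < α) (hαβ : α + β < 0) :
    Tendsto (flux r₀ r₁ α β) atBot (𝓝 0) := by
  have h1 : Tendsto (fun x => (r₁ - x) ^ (α + β)) atBot (𝓝 0) := by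
    have h := (tendsto_rpow_neg_atTop (neg_pos.2 hαβ)).comp
      (tendsto_atTop_add_const_left _ r₁ tendsto_neg_atBot_atTop)
    simpa [Function.comp_def, sub_eq_add_neg] using h
  refine tendsto_of_tendsto_of_tendsto_of_le_of_le' tendsto_const_nhds h1 ?_ ?_
  · filter_upwards [eventually_lt_atBot r₀] with x hx
    exact (flux_pos hr hx).le
  · filter_upwards [eventually_lt_atBot r₀] with x hx
    have h0 : 0 < r₀ - x := sub_pos.2 hx
    have h1 : 0 < r₁ - x := sub_pos.2 (hx.trans hr)
    rw [Real.rpow_add h1, flux]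
    gcongr

end

end KacOU
end

/-! ### The profile, its normalisation, and stationary densities -/

noncomputable section

open scoped ENNReal

namespace KacOU

variable (lam a γ : Fin 2 → ℝ)

/-- The density `piLower` without its normalising constant, on the half-line below `ρ₀`. -/
def profile : Fin 2 → ℝ → ℝ :=
  ![fun x => flux (rho a γ 0) (rho a γ 1) (alpha lam γ 0) (alpha lam γ 1) x /
      (γ 0 * (rho a γ 0 - x)),
    fun x => -(flux (rho a γ 0) (rho a γ 1) (alpha lam γ 0) (alpha lam γ 1) x /
      (γ 1 * (rho a γ 1 - x)))]

variable {lam a γ}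

lemma profile_zero (x : ℝ) : profile lam a γ 0 x =
    flux (rho a γ 0) (rho a γ 1) (alpha lam γ 0) (alpha lam γ 1) x / (γ 0 * (rho a γ 0 - x)) := rfl

lemma profile_one (x : ℝ) : profile lam a γ 1 x =
    -(flux (rho a γ 0) (rho a γ 1) (alpha lam γ 0) (alpha lam γ 1) x /
      (γ 1 * (rho a γ 1 - x))) := rfl

lemma profile_zero_eq {x : ℝ} (hx : x < rho a γ 0) :
    profile lam a γ 0 x = (γ 0)⁻¹ * ((rho a γ 0 - x) ^ (alpha lam γ 0 - 1) *
      (rho a γ 1 - x) ^ alpha lam γ 1) := by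
  rw [profile_zero, flux, Real.rpow_sub_one (sub_pos.2 hx).ne']
  simp only [div_eq_mul_inv, mul_inv]
  ring

lemma profile_one_eq (hρ : rho a γ 0 < rho a γ 1) {x : ℝ} (hx : x < rho a γ 0) :
    profile lam a γ 1 x = -(γ 1)⁻¹ * ((rho a γ 0 - x) ^ alpha lam γ 0 *
      (rho a γ 1 - x) ^ (alpha lam γ 1 - 1)) := by
  rw [profile_one, flux, Real.rpow_sub_one (sub_pos.2 (hx.trans hρ)).ne']
  simp only [div_eq_mul_inv, mul_inv]
  ring

lemma piLower_eq (hρ : rho a γ 0 < rho a γ 1) (i : Fin 2) {x : ℝ} (hx : x < rho a γ 0) :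
    piLower lam a γ i x = c₀ lam a γ * profile lam a γ i x := by
  fin_cases i
  · simp only [Fin.zero_eta]
    rw [profile_zero_eq hx]
    simp only [piLower, Matrix.cons_val_zero, indicator_of_mem (mem_Iio.2 hx)]
    ring_nf
  · simp only [Fin.mk_one]
    rw [profile_one_eq hρ hx]
    simp only [piLower, Matrix.cons_val_one, Matrix.cons_val_zero, indicator_of_mem (mem_Iio.2 hx)]
    ring_nf

lemma piLower_eq_zero (i : Fin 2) {x : ℝ} (hx : rho a γ 0 ≤ x) : piLower lam a γ i x = 0 := by
  fin_cases i <;> simp [piLower, hx]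

lemma alpha_pos (hlam : ∀ i, 0 < lam i) {i : Fin 2} (h : 0 < γ i) : 0 < alpha lam γ i :=
  div_pos (hlam i) h

lemma alpha_neg (hlam : ∀ i, 0 < lam i) {i : Fin 2} (h : γ i < 0) : alpha lam γ i < 0 :=
  div_neg_of_pos_of_neg (hlam i) h

lemma profile_pos (hρ : rho a γ 0 < rho a γ 1) (h0 : 0 < γ 0) (h1 : γ 1 < 0) (i : Fin 2) {x : ℝ}
    (hx : x < rho a γ 0) : 0 < profile lam a γ i x := by
  have hf := flux_pos (α := alpha lam γ 0) (β := alpha lam γ 1) hρ hx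
  fin_cases i
  · exact div_pos hf (mul_pos h0 (sub_pos.2 hx))
  · exact neg_pos.2 (div_neg_of_pos_of_neg hf
      (mul_neg_of_neg_of_pos h1 (sub_pos.2 (hx.trans hρ))))

/-- With `t = ρ₀ - x` both components become beta integrals, with `(p, q) = (α₀, -α₁)` and `(1 + α₀,
1 - α₁)`. In both, `q - p = -α₀ - α₁`. -/
lemma integral_profile (hlam : ∀ i, 0 < lam i) (hρ : rho a γ 0 < rho a γ 1) (h0 : 0 < γ 0)
    (h1 : γ 1 < 0) (hα : alpha lam γ 0 + alpha lam γ 1 < 0) :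
    (∀ i, IntegrableOn (profile lam a γ i) (Iio (rho a γ 0))) ∧
      (∫ x in Iio (rho a γ 0), (profile lam a γ 0 x + profile lam a γ 1 x)) = (c₀ lam a γ)⁻¹ ∧
      0 < c₀ lam a γ := by
  have hα0 := alpha_pos hlam h0
  have hd := sub_pos.2 hρ
  obtain ⟨i0, e0⟩ := integrable_and_integral_rpow_mul_add_rpow (p := alpha lam γ 0)
    (q := -alpha lam γ 1) hα0 (by linarith) hd
  obtain ⟨i1, e1⟩ := integrable_and_integral_rpow_mul_add_rpow (p := 1 + alpha lam γ 0)
    (q := 1 - alpha lam γ 1) (by linarith) (by linarith) hd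
  have f0 : EqOn (fun t => profile lam a γ 0 (rho a γ 0 - t)) (fun t => (γ 0)⁻¹ *
      (t ^ (alpha lam γ 0 - 1) * (t + (rho a γ 1 - rho a γ 0)) ^ (-(-alpha lam γ 1)))) (Ioi 0) := by
    intro t ht
    beta_reduce
    rw [profile_zero_eq (by linarith [mem_Ioi.1 ht])]
    ring_nf
  have f1 : EqOn (fun t => profile lam a γ 1 (rho a γ 0 - t)) (fun t => -(γ 1)⁻¹ *
      (t ^ (1 + alpha lam γ 0 - 1) * (t + (rho a γ 1 - rho a γ 0)) ^ (-(1 - alpha lam γ 1))))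
      (Ioi 0) := by
    intro t ht
    beta_reduce
    rw [profile_one_eq hρ (by linarith [mem_Ioi.1 ht])]
    ring_nf
  have j0 : IntegrableOn (profile lam a γ 0) (Iio (rho a γ 0)) :=
    (integrableOn_Iio_iff _ _).2
      ((integrableOn_congr_fun f0 measurableSet_Ioi).2 (i0.const_mul _))
  have j1 : IntegrableOn (profile lam a γ 1) (Iio (rho a γ 0)) :=
    (integrableOn_Iio_iff _ _).2
      ((integrableOn_congr_fun f1 measurableSet_Ioi).2 (i1.const_mul _))
  refine ⟨Fin.forall_fin_two.2 ⟨j0, j1⟩, ?_, ?_⟩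
  · rw [integral_add j0 j1, integral_Iio_eq, integral_Iio_eq,
      setIntegral_congr_fun measurableSet_Ioi f0, setIntegral_congr_fun measurableSet_Ioi f1,
      integral_const_mul, integral_const_mul, e0, e1, c₀, inv_inv]
    ring_nf
  · have b0 := beta_pos (α := -alpha lam γ 0 - alpha lam γ 1) (by linarith) hα0
    have b1 := beta_pos (α := -alpha lam γ 0 - alpha lam γ 1) (β := 1 + alpha lam γ 0)
      (by linarith) (by linarith)
    have g1 : (γ 1)⁻¹ < 0 := inv_lt_zero.2 h1
    refine inv_pos.2 (mul_pos (Real.rpow_pos_of_pos hd _) ?_)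
    have := mul_pos (inv_pos.2 h0) b0
    nlinarith

lemma alpha_add_neg_of_integrableOn (hlam : ∀ i, 0 < lam i) (hρ : rho a γ 0 < rho a γ 1)
    (h0 : 0 < γ 0) (h1 : γ 1 < 0)
    (h : IntegrableOn (fun t => profile lam a γ 0 (rho a γ 0 - t)) (Ioi 1)) :
    alpha lam γ 0 + alpha lam γ 1 < 0 := by
  refine add_neg_of_integrableOn (alpha_neg hlam h1) (sub_pos.2 hρ) ?_
  refine (integrableOn_congr_fun (fun t ht => ?_) measurableSet_Ioi).2 (h.const_mul (γ 0))
  have ht1 : 1 < t := ht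
  rw [profile_zero_eq (by linarith), mul_inv_cancel_left₀ h0.ne']
  ring_nf

lemma gamma_mul_sub_a (hγ : ∀ i, γ i ≠ 0) (i : Fin 2) (x : ℝ) :
    γ i * x - a i = -(γ i * (rho a γ i - x)) := by
  have := hγ i
  unfold rho
  field_simp
  ring

lemma alpha_mul (hγ : ∀ i, γ i ≠ 0) (i : Fin 2) : γ i * alpha lam γ i = lam i :=
  mul_div_cancel₀ _ (hγ i)

/-- The flux is stationary: its derivative is the difference of the switching rates. -/
lemma hasDerivAt_flux_profile (hγ : ∀ i, γ i ≠ 0) (hρ : rho a γ 0 < rho a γ 1) {x : ℝ}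
    (hx : x < rho a γ 0) :
    HasDerivAt (flux (rho a γ 0) (rho a γ 1) (alpha lam γ 0) (alpha lam γ 1))
      (lam 1 * profile lam a γ 1 x - lam 0 * profile lam a γ 0 x) x := by
  refine (hasDerivAt_flux hρ hx).congr_deriv ?_
  have h0 := (sub_pos.2 hx).ne'
  have h1 := (sub_pos.2 (hx.trans hρ)).ne'
  have g0 := hγ 0
  have g1 := hγ 1
  rw [profile_zero, profile_one, ← alpha_mul (lam := lam) hγ 0, ← alpha_mul (lam := lam) hγ 1]
  field_simp
  ring

/-- Zero total flux expresses `p 1` through `p 0`, which closes the equation of the flux `γ₀ (ρ₀ -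
x) p 0` into the scalar flux equation. It serves both stationary densities and derivatives of
distribution functions. -/
lemma exists_eq_mul_profile (hγ : ∀ i, γ i ≠ 0)
    (hρ : rho a γ 0 < rho a γ 1) {p : Fin 2 → ℝ → ℝ}
    (hp : ∀ x < rho a γ 0, γ 0 * (rho a γ 0 - x) * p 0 x = -(γ 1 * (rho a γ 1 - x) * p 1 x))
    (hd : ∀ x < rho a γ 0, HasDerivAt (fun x => γ 0 * (rho a γ 0 - x) * p 0 x)
      (lam 1 * p 1 x - lam 0 * p 0 x) x) :
    ∃ C, ∀ i, ∀ x < rho a γ 0, p i x = C * profile lam a γ i x := by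
  obtain ⟨C, hC⟩ := exists_eq_mul_flux (α := alpha lam γ 0) (β := alpha lam γ 1) hρ
    (G := fun x => γ 0 * (rho a γ 0 - x) * p 0 x) fun x hx => by
      refine (hd x hx).congr_deriv ?_
      have h0 := (sub_pos.2 hx).ne'
      have h1 := (sub_pos.2 (hx.trans hρ)).ne'
      have g0 := hγ 0
      have g1 := hγ 1
      have hp1 : p 1 x = -(γ 0 * (rho a γ 0 - x) * p 0 x) / (γ 1 * (rho a γ 1 - x)) := by
        rw [hp x hx]
        field_simp
      rw [hp1, ← alpha_mul (lam := lam) hγ 0, ← alpha_mul (lam := lam) hγ 1]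
      field_simp
      ring
  refine ⟨C, Fin.forall_fin_two.2 ⟨fun x hx => ?_, fun x hx => ?_⟩⟩
  · rw [profile_zero, ← mul_div_assoc, ← hC x hx,
      mul_div_cancel_left₀ _ (mul_ne_zero (hγ 0) (sub_pos.2 hx).ne')]
  · rw [profile_one, mul_neg, ← mul_div_assoc, ← hC x hx, hp x hx, neg_div, neg_neg,
      mul_div_cancel_left₀ _ (mul_ne_zero (hγ 1) (sub_pos.2 (hx.trans hρ)).ne')]

/-- Adding the two equations shows that the total flux is constant on the half-line; the boundary
condition at `ρ₀` makes this constant zero. -/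
lemma IsStationaryDensityOn.exists_eq_mul_profile (hγ : ∀ i, γ i ≠ 0)
    (hρ : rho a γ 0 < rho a γ 1) {p : Fin 2 → ℝ → ℝ}
    (h : IsStationaryDensityOn lam a γ (Iio (rho a γ 0)) p) :
    ∃ C, ∀ i, ∀ x < rho a γ 0, p i x = C * profile lam a γ i x := by
  have hd : ∀ i, ∀ x < rho a γ 0, HasDerivAt (fun x => γ i * (rho a γ i - x) * p i x)
      (lam (1 - i) * p (1 - i) x - lam i * p i x) x := by
    intro i x hx
    have h1 := (((hasDerivAt_id x).const_sub (rho a γ i)).const_mul (γ i)).mul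
      (h.differentiable i x hx).hasDerivAt
    refine h1.congr_deriv ?_
    have he := h.equation i x hx
    rw [gamma_mul_sub_a hγ] at he
    simp only [id]
    linarith
  have hJ : ∀ x < rho a γ 0, HasDerivAt (fun x => γ 0 * (rho a γ 0 - x) * p 0 x +
      γ 1 * (rho a γ 1 - x) * p 1 x) 0 x := by
    intro x hx
    refine ((hd 0 x hx).add (hd 1 x hx)).congr_deriv ?_
    simp only [sub_zero, sub_self]
    ring
  have hb : ∀ i, Tendsto (fun x => γ i * (rho a γ i - x) * p i x) (𝓝[<] (rho a γ 0)) (𝓝 0) := by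
    intro i
    refine (h.boundary i (rho a γ 0) (by simp)).congr fun x => ?_
    have := gamma_mul_sub_a (a := a) hγ i x
    rw [show a i - γ i * x = γ i * (rho a γ i - x) by linarith]
  have hlim := (hb 0).add (hb 1)
  rw [add_zero] at hlim
  refine KacOU.exists_eq_mul_profile hγ hρ (fun x hx => ?_) fun x hx => ?_
  · rw [← add_eq_zero_iff_eq_neg]
    refine tendsto_nhds_unique (tendsto_const_nhds.congr' ?_) hlim
    filter_upwards [self_mem_nhdsWithin] with y hy
    exact isOpen_Iio.is_const_of_deriv_eq_zero isPreconnected_Iio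
      (f := fun x => γ 0 * (rho a γ 0 - x) * p 0 x + γ 1 * (rho a γ 1 - x) * p 1 x)
      (fun y hy => (hJ y hy).differentiableAt.differentiableWithinAt) (fun y hy => (hJ y hy).deriv)
      hx hy
  · simpa using hd 0 x hx

lemma eq_c₀_of_integral (hlam : ∀ i, 0 < lam i) (hρ : rho a γ 0 < rho a γ 1) (h0 : 0 < γ 0)
    (h1 : γ 1 < 0) (hα : alpha lam γ 0 + alpha lam γ 1 < 0) {C : ℝ}
    (hC : C * ∫ x in Iio (rho a γ 0), (profile lam a γ 0 x + profile lam a γ 1 x) = 1) :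
    C = c₀ lam a γ := by
  obtain ⟨-, he, hc⟩ := integral_profile hlam hρ h0 h1 hα
  rw [he] at hC
  field_simp at hC
  exact hC

theorem isStationaryDensityOn_lower (hlam : ∀ i, 0 < lam i) (hγ : ∀ i, γ i ≠ 0)
    (hρ : rho a γ 0 < rho a γ 1) (h0 : 0 < γ 0) (h1 : γ 1 < 0) {p : Fin 2 → ℝ → ℝ}
    (h : IsStationaryDensityOn lam a γ (Iio (rho a γ 0)) p) :
    alpha lam γ 0 + alpha lam γ 1 < 0 ∧
      ∀ i, EqOn (p i) (piLower lam a γ i) (Iio (rho a γ 0)) := by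
  obtain ⟨C, hC⟩ := h.exists_eq_mul_profile hγ hρ
  have hpe : EqOn (fun x => p 0 x + p 1 x)
      (fun x => C * (profile lam a γ 0 x + profile lam a γ 1 x)) (Iio (rho a γ 0)) := by
    intro x hx
    beta_reduce
    rw [hC 0 x hx, hC 1 x hx]
    ring
  have hone := h.integral_eq_one
  rw [setIntegral_congr_fun measurableSet_Iio hpe, integral_const_mul] at hone
  have hC0 : C ≠ 0 := by
    rintro rfl
    simp at hone
  have hint : IntegrableOn (fun x => profile lam a γ 0 x + profile lam a γ 1 x)
      (Iio (rho a γ 0)) := by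
    refine (integrableOn_congr_fun (fun x hx => ?_) measurableSet_Iio).2
      (h.integrable.const_mul C⁻¹)
    have := hpe hx
    beta_reduce at this
    rw [this]
    field_simp
  have hα : alpha lam γ 0 + alpha lam γ 1 < 0 := by
    refine alpha_add_neg_of_integrableOn hlam hρ h0 h1 ?_
    have h2 := ((integrableOn_Iio_iff _ _).1 hint).mono_set (Ioi_subset_Ioi zero_le_one)
    refine Integrable.mono' h2 ?_ ?_
    · have hm : Measurable fun t => profile lam a γ 0 (rho a γ 0 - t) := by
        simp only [profile_zero, flux]
        fun_prop
      exact hm.aestronglyMeasurable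
    · filter_upwards [ae_restrict_mem measurableSet_Ioi] with t ht
      have ht1 : 1 < t := ht
      have hx : rho a γ 0 - t < rho a γ 0 := by linarith
      rw [Real.norm_of_nonneg (profile_pos hρ h0 h1 0 hx).le]
      linarith [profile_pos (lam := lam) hρ h0 h1 1 hx]
  refine ⟨hα, fun i x hx => ?_⟩
  rw [hC i x hx, piLower_eq hρ i hx, eq_c₀_of_integral hlam hρ h0 h1 hα hone]

theorem isStationaryDensityOn_of_eqOn_piLower (hlam : ∀ i, 0 < lam i) (hγ : ∀ i, γ i ≠ 0)
    (hρ : rho a γ 0 < rho a γ 1) (h0 : 0 < γ 0) (h1 : γ 1 < 0)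
    (hα : alpha lam γ 0 + alpha lam γ 1 < 0) {p : Fin 2 → ℝ → ℝ}
    (h : ∀ i, EqOn (p i) (piLower lam a γ i) (Iio (rho a γ 0))) :
    IsStationaryDensityOn lam a γ (Iio (rho a γ 0)) p := by
  obtain ⟨hi, he, hc⟩ := integral_profile hlam hρ h0 h1 hα
  have hp : ∀ i, ∀ x < rho a γ 0, p i x = c₀ lam a γ * profile lam a γ i x := fun i x hx =>
    (h i hx).trans (piLower_eq hρ i hx)
  set g := flux (rho a γ 0) (rho a γ 1) (alpha lam γ 0) (alpha lam γ 1) with hg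
  have hflux : ∀ x < rho a γ 0, HasDerivAt (fun x => c₀ lam a γ * g x)
      (lam 1 * p 1 x - lam 0 * p 0 x) x := by
    intro x hx
    refine ((hasDerivAt_flux_profile hγ hρ hx).const_mul (c₀ lam a γ)).congr_deriv ?_
    rw [hp 0 x hx, hp 1 x hx]
    ring
  have hfp : ∀ x < rho a γ 0, γ 0 * (rho a γ 0 - x) * p 0 x = c₀ lam a γ * g x ∧
      γ 1 * (rho a γ 1 - x) * p 1 x = -(c₀ lam a γ * g x) := by
    intro x hx
    have d0 := (sub_pos.2 hx).ne'
    have d1 := (sub_pos.2 (hx.trans hρ)).ne'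
    have g0 := hγ 0
    have g1 := hγ 1
    constructor
    · rw [hp 0 x hx, profile_zero, ← hg]
      field_simp
    · rw [hp 1 x hx, profile_one, ← hg]
      field_simp
  have hlt0 : ∀ x < rho a γ 0, x < rho a γ 0 := fun x hx => hx
  have hlt1 : ∀ x < rho a γ 0, x < rho a γ 1 := fun x hx => hx.trans hρ
  have hpd : ∀ i, ∀ x < rho a γ 0, HasDerivAt (p i) ((lam (1 - i) * p (1 - i) x -
      lam i * p i x + γ i * p i x) / (γ i * (rho a γ i - x))) x := by
    -- The fluxes of the two states are opposite; `ε = 1` for state `0` and `ε = -1` for state `1`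
    -- lets both densities be differentiated as the same quotient.
    have key : ∀ i, ∀ ε : ℝ, ∀ x < rho a γ 0, (∀ y < rho a γ 0, y < rho a γ i) →
        (∀ y < rho a γ 0, γ i * (rho a γ i - y) * p i y = ε * (c₀ lam a γ * g y)) →
        (ε * (lam 1 * p 1 x - lam 0 * p 0 x) = lam (1 - i) * p (1 - i) x - lam i * p i x) →
        HasDerivAt (p i) ((lam (1 - i) * p (1 - i) x -
          lam i * p i x + γ i * p i x) / (γ i * (rho a γ i - x))) x := by
      intro i ε x hx hlt hy hε
      have d := (sub_pos.2 (hlt x hx)).ne'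
      have gi := hγ i
      have hden : γ i * (rho a γ i - x) ≠ 0 := mul_ne_zero gi d
      have h1 := ((hflux x hx).const_mul ε).div
        (((hasDerivAt_id x).const_sub (rho a γ i)).const_mul (γ i)) hden
      refine (h1.congr_of_eventuallyEq ?_).congr_deriv ?_
      · filter_upwards [eventually_lt_nhds hx] with y hyx
        have d' := (sub_pos.2 (hlt y hyx)).ne'
        simp only [Pi.div_apply, id]
        rw [eq_div_iff (mul_ne_zero gi d'), ← hy y hyx, mul_comm]
      · simp only [id]
        rw [hε, ← hy x hx]
        field_simp
        ring
    refine Fin.forall_fin_two.2 ⟨fun x hx => ?_, fun x hx => ?_⟩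
    · exact key 0 1 x hx hlt0 (fun y hy => by rw [one_mul, (hfp y hy).1]) (by simp)
    · exact key 1 (-1) x hx hlt1 (fun y hy => by rw [(hfp y hy).2]; ring) (by simp)
  have hlt : ∀ i, ∀ x < rho a γ 0, x < rho a γ i := Fin.forall_fin_two.2 ⟨hlt0, hlt1⟩
  have hsum : EqOn (fun x => p 0 x + p 1 x)
      (fun x => c₀ lam a γ * (profile lam a γ 0 x + profile lam a γ 1 x)) (Iio (rho a γ 0)) := by
    intro x hx
    beta_reduce
    rw [hp 0 x hx, hp 1 x hx]
    ring
  refine ⟨fun i x hx => (hpd i x hx).differentiableAt, fun i x hx => ?_, fun i b hb => ?_,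
    fun i x hx => ?_, ?_, ?_⟩
  · rw [(hpd i x hx).deriv, gamma_mul_sub_a hγ]
    have d := (sub_pos.2 (hlt i x hx)).ne'
    have gi := hγ i
    field_simp
    ring
  · rw [frontier_Iio, mem_singleton_iff] at hb
    subst hb
    -- The boundary condition concerns the flux and not the density: `p 0` may blow up at `ρ₀`, but
    -- the flux has the factor `(ρ₀ - x) ^ α₀` with `α₀ > 0`.
    have hg0 : Tendsto g (𝓝[<] (rho a γ 0)) (𝓝 0) := by
      have hcont : ContinuousAt g (rho a γ 0) := by
        refine ContinuousAt.mul ?_ ?_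
        · exact ContinuousAt.rpow_const (by fun_prop) (.inr (alpha_pos hlam h0).le)
        · exact ContinuousAt.rpow_const (by fun_prop) (.inl (sub_pos.2 hρ).ne')
      have h2 := hcont.tendsto
      have h3 : g (rho a γ 0) = 0 := by
        simp [hg, flux, Real.zero_rpow (alpha_pos hlam h0).ne']
      rw [h3] at h2
      exact h2.mono_left nhdsWithin_le_nhds
    have hga : ∀ i x, a i - γ i * x = γ i * (rho a γ i - x) := fun i x => by
      linarith [gamma_mul_sub_a (a := a) hγ i x]
    have hg1 := hg0.const_mul (c₀ lam a γ)
    rw [mul_zero] at hg1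
    have hg2 := hg1.neg
    rw [neg_zero] at hg2
    revert i
    refine Fin.forall_fin_two.2 ⟨hg1.congr' ?_, hg2.congr' ?_⟩
    · filter_upwards [self_mem_nhdsWithin] with x hx
      rw [hga, (hfp x hx).1]
    · filter_upwards [self_mem_nhdsWithin] with x hx
      rw [hga, (hfp x hx).2]
  · rw [hp i x hx]
    exact (mul_pos hc (profile_pos hρ h0 h1 i hx)).le
  · exact (integrableOn_congr_fun hsum measurableSet_Iio).2 (((hi 0).add (hi 1)).const_mul _)
  · rw [setIntegral_congr_fun measurableSet_Iio hsum, integral_const_mul, he,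
      mul_inv_cancel₀ hc.ne']

end KacOU
end

/-! ### Balanced measures have the explicit density -/

noncomputable section

open scoped ENNReal

namespace KacOU

/-- The distribution functions are controlled only below `r = ρ₀`; nullity of `[r, ∞)` supplies the
rest, including the absence of an atom at `r`. -/
lemma measure_eq_of_Iic_lt {μ ν : Measure ℝ} [IsFiniteMeasure μ] {r : ℝ}
    (h : ∀ x < r, μ (Iic x) = ν (Iic x)) (hμ : μ (Ici r) = 0) (hν : ν (Ici r) = 0) : μ = ν := by
  have hIio : μ (Iio r) = ν (Iio r) := by
    have hU : Iio r = ⋃ n : ℕ, Iic (r - 1 / ((n : ℝ) + 1)) := by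
      ext x
      simp only [mem_Iio, mem_iUnion, mem_Iic]
      refine ⟨fun hx => ?_, fun ⟨n, hn⟩ => ?_⟩
      · obtain ⟨n, hn⟩ := exists_nat_one_div_lt (sub_pos.2 hx)
        exact ⟨n, by linarith⟩
      · have : 0 < 1 / ((n : ℝ) + 1) := by positivity
        linarith
    have hmono : Monotone fun n : ℕ => Iic (r - 1 / ((n : ℝ) + 1)) := fun k n hkn =>
      Iic_subset_Iic.2 (sub_le_sub_left (Nat.one_div_le_one_div hkn) r)
    rw [hU, hmono.measure_iUnion, hmono.measure_iUnion]
    congr 1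
    funext n
    refine h _ ?_
    have : 0 < 1 / ((n : ℝ) + 1) := by positivity
    linarith
  refine Measure.ext_of_Iic _ _ fun x => ?_
  rcases lt_or_ge x r with hx | hx
  · exact h x hx
  · have hs : ∀ ξ : Measure ℝ, ξ (Ici r) = 0 → ξ (Iic x) = ξ (Iio r) := fun ξ hξ => by
      refine le_antisymm ?_ (measure_mono fun y hy => (le_of_lt hy).trans hx)
      calc ξ (Iic x) ≤ ξ (Iio r ∪ Ici r) := measure_mono (by simp)
        _ ≤ ξ (Iio r) + ξ (Ici r) := measure_union_le _ _
        _ = ξ (Iio r) := by rw [hξ, add_zero]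
    rw [hs μ hμ, hs ν hν, hIio]

lemma tendsto_real_Iic_atBot (ν : Measure ℝ) [IsFiniteMeasure ν] :
    Tendsto (fun x => ν.real (Iic x)) atBot (𝓝 0) := by
  have h := tendsto_measure_iInter_atBot (μ := ν) (s := fun x : ℝ => Iic x)
    (fun x => measurableSet_Iic.nullMeasurableSet) (fun _ _ hxy => Iic_subset_Iic.2 hxy)
    ⟨0, measure_ne_top _ _⟩
  rw [iInter_Iic_eq_empty_iff.2 (by simp), measure_empty] at h
  exact (ENNReal.tendsto_toReal ENNReal.zero_ne_top).comp h

/-- A distribution function with a nonnegative derivative below `r`. -/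
lemma integral_Iic_of_hasDerivAt_real_Iic {ν : Measure ℝ} [IsFiniteMeasure ν] {r x : ℝ} {f : ℝ → ℝ}
    (hf : ∀ y < r, HasDerivAt (fun y => ν.real (Iic y)) (f y) y) (hf0 : ∀ y < r, 0 ≤ f y)
    (hx : x < r) : IntegrableOn f (Iic x) ∧ ∫ y in Iic x, f y = ν.real (Iic x) := by
  have hlim := tendsto_real_Iic_atBot ν
  have hi : IntegrableOn (fun t => f (x - t)) (Ioi 0) := by
    refine integrableOn_Ioi_deriv_of_nonneg' (g := fun t => -ν.real (Iic (x - t))) (l := -0)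
      (fun t ht => ?_) (fun t ht => hf0 _ (by linarith [mem_Ioi.1 ht])) ?_
    · have h1 := (hf (x - t) (by linarith [mem_Ici.1 ht])).comp t ((hasDerivAt_id t).const_sub x)
      refine h1.neg.congr_deriv ?_
      ring
    · exact (hlim.comp (tendsto_atBot_add_const_left _ x tendsto_neg_atTop_atBot)).neg
  have hi' : IntegrableOn f (Iic x) := by
    rw [integrableOn_Iic_iff_integrableOn_Iio, integrableOn_Iio_iff]
    exact hi
  refine ⟨hi', ?_⟩
  rw [integral_Iic_of_hasDerivAt_of_tendsto' (fun y hy => hf y (lt_of_le_of_lt hy hx)) hi' hlim,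
    sub_zero]

variable {lam a γ : Fin 2 → ℝ} {m : Fin 2 → Measure ℝ} [∀ i, IsFiniteMeasure (m i)]

/-- No boundary condition is needed here: the flux of state `i` is `λ_{1-i} F_{1-i} - λ_i F_i`, so
the two fluxes cancel identically, and differentiating once more yields the flux equation. -/
lemma IsBalanced.exists_hasDerivAt (hlam : ∀ i, 0 < lam i) (hγ : ∀ i, γ i ≠ 0)
    (h : IsBalanced lam a γ m) (hρ : rho a γ 0 < rho a γ 1) :
    ∃ C, ∀ i, ∀ x < rho a γ 0,
      HasDerivAt (fun y => (m i).real (Iic y)) (C * profile lam a γ i x) x := by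
  set p : Fin 2 → ℝ → ℝ := fun i x => (lam (1 - i) * (m (1 - i)).real (Iic x) -
    lam i * (m i).real (Iic x)) / (γ i * (rho a γ i - x)) with hp
  have hlt : ∀ i, ∀ x < rho a γ 0, x < rho a γ i :=
    Fin.forall_fin_two.2 ⟨fun x hx => hx, fun x hx => hx.trans hρ⟩
  have hd : ∀ i, ∀ x < rho a γ 0, HasDerivAt (fun y => (m i).real (Iic y)) (p i x) x :=
    fun i x hx => h.hasDerivAt hlam hγ (hlt i x hx) (hlt (1 - i) x hx)
  have hu : ∀ i, ∀ x < rho a γ 0, γ i * (rho a γ i - x) * p i x =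
      lam (1 - i) * (m (1 - i)).real (Iic x) - lam i * (m i).real (Iic x) := fun i x hx =>
    mul_div_cancel₀ _ (mul_ne_zero (hγ i) (sub_pos.2 (hlt i x hx)).ne')
  obtain ⟨C, hC⟩ := exists_eq_mul_profile (p := p) hγ hρ (fun x hx => by
      rw [hu 0 x hx, hu 1 x hx, sub_zero, sub_self, neg_sub]) fun x hx => by
    refine (((hd 1 x hx).const_mul (lam 1)).sub ((hd 0 x hx).const_mul (lam 0))).congr_of_eventuallyEq ?_
    filter_upwards [eventually_lt_nhds hx] with y hy
    exact hu 0 y hy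
  exact ⟨C, fun i x hx => hC i x hx ▸ hd i x hx⟩

lemma measurable_piLower (i : Fin 2) : Measurable (piLower lam a γ i) := by
  fin_cases i
  · exact Measurable.indicator (by fun_prop) measurableSet_Iio
  · exact Measurable.indicator (by fun_prop) measurableSet_Iio

/-- The single constant `C` is determined in stages: monotonicity of a distribution function gives
`C ≥ 0`, total mass one excludes `C = 0`, finiteness of the mass near `-∞` forces `α₀ + α₁ < 0`, and
then the normalisation gives `C = c₀`. -/
theorem IsBalanced.eq_withDensity (hlam : ∀ i, 0 < lam i) (hγ : ∀ i, γ i ≠ 0)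
    (h : IsBalanced lam a γ m) (hm : m 0 univ + m 1 univ = 1)
    (hρ : rho a γ 0 < rho a γ 1) (h0 : 0 < γ 0) (h1 : γ 1 < 0) :
    alpha lam γ 0 + alpha lam γ 1 < 0 ∧
      ∀ i, m i = volume.withDensity fun x => ENNReal.ofReal (piLower lam a γ i x) := by
  obtain ⟨C, hC⟩ := h.exists_hasDerivAt hlam hγ hρ
  have hnull := h.null_Ici hlam hρ h0 h1
  have hprof := fun i x (hx : x < rho a γ 0) => profile_pos (lam := lam) hρ h0 h1 i hx
  have hC0 : 0 ≤ C := by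
    have hx : rho a γ 0 - 1 < rho a γ 0 := by linarith
    have hmono : Monotone fun y => (m 0).real (Iic y) := fun _ _ hxy =>
      measureReal_mono (Iic_subset_Iic.2 hxy)
    have h2 := hmono.deriv_nonneg (x := rho a γ 0 - 1)
    rw [(hC 0 _ hx).deriv] at h2
    exact nonneg_of_mul_nonneg_left h2 (hprof 0 _ hx)
  have hI : ∀ i, ∀ x < rho a γ 0, IntegrableOn (fun y => C * profile lam a γ i y) (Iic x) ∧
      ∫ y in Iic x, C * profile lam a γ i y = (m i).real (Iic x) := fun i x hx =>
    integral_Iic_of_hasDerivAt_real_Iic (hC i) (fun y hy => mul_nonneg hC0 (hprof i y hy).le) hx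
  set D : Fin 2 → ℝ → ℝ := fun i =>
    (Iio (rho a γ 0)).indicator fun x => C * profile lam a γ i x with hD
  have hDm : ∀ i, m i = volume.withDensity fun x => ENNReal.ofReal (D i x) := by
    intro i
    refine measure_eq_of_Iic_lt (r := rho a γ 0) (fun x hx => ?_) (hnull i) ?_
    · obtain ⟨h2, h3⟩ := hI i x hx
      have hnn : 0 ≤ᵐ[volume.restrict (Iic x)] fun y => C * profile lam a γ i y := by
        filter_upwards [ae_restrict_mem measurableSet_Iic] with y hy
        exact mul_nonneg hC0 (hprof i y (lt_of_le_of_lt hy hx)).le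
      rw [withDensity_apply _ measurableSet_Iic, ← ofReal_measureReal, ← h3,
        ofReal_integral_eq_lintegral_ofReal h2 hnn]
      refine setLIntegral_congr_fun measurableSet_Iic fun y hy => ?_
      simp [hD, lt_of_le_of_lt (mem_Iic.1 hy) hx]
    · rw [withDensity_apply _ measurableSet_Ici,
        setLIntegral_congr_fun (g := fun _ => 0) measurableSet_Ici, lintegral_zero]
      intro y hy
      simp [hD, mem_Ici.1 hy]
  have hCpos : 0 < C := by
    refine lt_of_le_of_ne hC0 fun hC' => ?_
    rw [hDm 0, hDm 1] at hm
    simp [hD, ← hC'] at hm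
  have hα : alpha lam γ 0 + alpha lam γ 1 < 0 := by
    refine alpha_add_neg_of_integrableOn hlam hρ h0 h1 ?_
    have h2 := ((hI 0 (rho a γ 0 - 1) (by linarith)).1.const_mul C⁻¹)
    simp only [inv_mul_cancel_left₀ hCpos.ne'] at h2
    have h3 : IntegrableOn (profile lam a γ 0) (Iio (rho a γ 0 - 1)) :=
      IntegrableOn.mono_set h2 Iio_subset_Iic_self
    have hind := (integrableOn_Iio_iff (rho a γ 0) ((Iio (rho a γ 0 - 1)).indicator
      (profile lam a γ 0))).1 ((integrable_indicator_iff measurableSet_Iio).2 h3).integrableOn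
    refine (integrableOn_congr_fun (fun t ht => ?_) measurableSet_Ioi).1
      (hind.mono_set (Ioi_subset_Ioi zero_le_one))
    simp [mem_Ioi.1 ht]
  refine ⟨hα, fun i => ?_⟩
  obtain ⟨hi, -, -⟩ := integral_profile hlam hρ h0 h1 hα
  have hmass : ∀ i, m i univ =
      ENNReal.ofReal (C * ∫ x in Iio (rho a γ 0), profile lam a γ i x) := by
    intro i
    rw [hDm i, withDensity_apply _ MeasurableSet.univ, setLIntegral_univ, ← integral_const_mul,
      ofReal_integral_eq_lintegral_ofReal ((hi i).const_mul C),
      ← lintegral_indicator measurableSet_Iio]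
    · refine lintegral_congr fun x => ?_
      by_cases hx : x < rho a γ 0 <;> simp [hD, hx]
    · filter_upwards [ae_restrict_mem measurableSet_Iio] with y hy
      exact mul_nonneg hC0 (hprof i y hy).le
  have hnonneg : ∀ i, 0 ≤ C * ∫ x in Iio (rho a γ 0), profile lam a γ i x := fun i =>
    mul_nonneg hC0 (setIntegral_nonneg measurableSet_Iio fun x hx => (hprof i x hx).le)
  have hCc : C = c₀ lam a γ := by
    refine eq_c₀_of_integral hlam hρ h0 h1 hα ?_
    rw [hmass, hmass, ← ENNReal.ofReal_add (hnonneg 0) (hnonneg 1),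
      ENNReal.ofReal_eq_one, ← mul_add] at hm
    rwa [integral_add (hi 0) (hi 1)]
  rw [hDm i]
  congr 1
  funext x
  rcases lt_or_ge x (rho a γ 0) with hx | hx
  · simp [hD, hx, piLower_eq hρ i hx, hCc]
  · simp [hD, hx, piLower_eq_zero i hx]

end KacOU
end

/-! ### The explicit density is balanced -/

noncomputable section

open scoped ENNReal

namespace KacOU

variable {lam a γ : Fin 2 → ℝ}

lemma piLower_eq_indicator (hρ : rho a γ 0 < rho a γ 1) (i : Fin 2) : piLower lam a γ i =
    (Iio (rho a γ 0)).indicator fun x => c₀ lam a γ * profile lam a γ i x := by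
  funext x
  rcases lt_or_ge x (rho a γ 0) with hx | hx
  · simp [hx, piLower_eq hρ i hx]
  · simp [hx, piLower_eq_zero i hx]

section
variable (hlam : ∀ i, 0 < lam i) (hρ : rho a γ 0 < rho a γ 1) (h0 : 0 < γ 0) (h1 : γ 1 < 0)
  (hα : alpha lam γ 0 + alpha lam γ 1 < 0)
include hlam hρ h0 h1 hα

lemma integrable_piLower (i : Fin 2) : Integrable (piLower lam a γ i) := by
  rw [piLower_eq_indicator hρ, integrable_indicator_iff measurableSet_Iio]
  exact ((integral_profile hlam hρ h0 h1 hα).1 i).const_mul _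

lemma piLower_nonneg (i : Fin 2) (x : ℝ) : 0 ≤ piLower lam a γ i x := by
  rw [piLower_eq_indicator hρ]
  exact indicator_nonneg (fun x hx => mul_nonneg (integral_profile hlam hρ h0 h1 hα).2.2.le
    (profile_pos hρ h0 h1 i hx).le) x

lemma integral_piLower_add :
    (∫ x, piLower lam a γ 0 x) + ∫ x, piLower lam a γ 1 x = 1 := by
  obtain ⟨hi, he, hc⟩ := integral_profile hlam hρ h0 h1 hα
  simp only [piLower_eq_indicator hρ, integral_indicator measurableSet_Iio, integral_const_mul]
  rw [← mul_add, ← integral_add (hi 0) (hi 1), he, mul_inv_cancel₀ hc.ne']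

/-- The distribution functions of `piLower` solve the balance equations. -/
lemma gamma_mul_piLower (i : Fin 2) (y : ℝ) :
    γ i * (y - rho a γ i) * piLower lam a γ i y = lam i * (∫ z in Iic y, piLower lam a γ i z) -
      lam (1 - i) * ∫ z in Iic y, piLower lam a γ (1 - i) z := by
  have hγ : ∀ i, γ i ≠ 0 := Fin.forall_fin_two.2 ⟨h0.ne', h1.ne⟩
  have hint := integrable_piLower hlam hρ h0 h1 hα
  -- The derivative of the flux is the difference of switching rates and the flux vanishes at `-∞`;
  -- integrating up to `y` identifies the two sides. The endpoint `ρ₀` is included for use above it.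
  have hle : ∀ y ≤ rho a γ 0, lam 1 * (∫ z in Iic y, piLower lam a γ 1 z) -
      lam 0 * (∫ z in Iic y, piLower lam a γ 0 z) =
      c₀ lam a γ * flux (rho a γ 0) (rho a γ 1) (alpha lam γ 0) (alpha lam γ 1) y := by
    intro y hy
    have hcont : ContinuousAt (flux (rho a γ 0) (rho a γ 1) (alpha lam γ 0) (alpha lam γ 1)) y :=
      (ContinuousAt.rpow_const (by fun_prop) (.inr (alpha_pos hlam h0).le)).mul
        (ContinuousAt.rpow_const (by fun_prop) (.inl (sub_pos.2 (hy.trans_lt hρ)).ne'))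
    have h := integral_Iic_of_hasDerivAt_of_tendsto (a := y)
      (f := fun x => c₀ lam a γ * flux (rho a γ 0) (rho a γ 1) (alpha lam γ 0) (alpha lam γ 1) x)
      (f' := fun x => lam 1 * piLower lam a γ 1 x - lam 0 * piLower lam a γ 0 x) (m := 0)
      (hcont.const_mul _).continuousWithinAt (fun x hx => ?_)
      (((hint 1).const_mul _).sub ((hint 0).const_mul _)).integrableOn ?_
    · rw [sub_zero, integral_sub ((hint 1).const_mul _).integrableOn
        ((hint 0).const_mul _).integrableOn, integral_const_mul, integral_const_mul] at h
      exact h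
    · have hx' : x < rho a γ 0 := lt_of_lt_of_le hx hy
      refine ((hasDerivAt_flux_profile hγ hρ hx').const_mul _).congr_deriv ?_
      rw [piLower_eq hρ _ hx', piLower_eq hρ _ hx']
      ring
    · simpa using (tendsto_flux_atBot hρ (alpha_pos hlam h0) hα).const_mul (c₀ lam a γ)
  rcases lt_or_ge y (rho a γ 0) with hy | hy
  · have hs0 := (sub_pos.2 hy).ne'
    have hs1 := (sub_pos.2 (hy.trans hρ)).ne'
    have g0 := hγ 0
    have g1 := hγ 1
    have hF := hle y hy.le
    revert i
    refine Fin.forall_fin_two.2 ⟨?_, ?_⟩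
    · rw [piLower_eq hρ 0 hy, profile_zero]
      simp only [sub_zero]
      rw [← neg_sub (lam 1 * _), hF]
      field_simp
      ring
    · rw [piLower_eq hρ 1 hy, profile_one]
      simp only [sub_self]
      rw [hF]
      field_simp
      ring
  -- Above `ρ₀` the distribution functions are constant, and the flux at `ρ₀` is `0` because `α₀ >
  -- 0`; both sides vanish.
  · have hF := hle _ le_rfl
    rw [flux, sub_self, Real.zero_rpow (alpha_pos hlam h0).ne', zero_mul, mul_zero] at hF
    have hIic : ∀ j, ∫ z in Iic y, piLower lam a γ j z =
        ∫ z in Iic (rho a γ 0), piLower lam a γ j z := fun j => by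
      refine setIntegral_eq_of_subset_of_forall_sdiff_eq_zero measurableSet_Iic
        (Iic_subset_Iic.2 hy) fun z hz => piLower_eq_zero j ?_
      exact (not_le.1 hz.2).le
    rw [piLower_eq_zero i hy, mul_zero, hIic, hIic]
    revert i
    refine Fin.forall_fin_two.2 ⟨?_, ?_⟩
    · simp only [sub_zero]
      linarith
    · simp only [sub_self]
      linarith

/-- Continuity of the density away from `ρ_i` is read off the balance equation, as a quotient of
continuous functions. This covers `π₁` at the end `ρ₀` of its support without a case distinction. -/
lemma hasDerivAt_integral_Iic_piLower {i : Fin 2} {y : ℝ} (hy : y ≠ rho a γ i) :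
    HasDerivAt (fun y => ∫ z in Iic y, piLower lam a γ i z) (piLower lam a γ i y) y := by
  have hγ : ∀ i, γ i ≠ 0 := Fin.forall_fin_two.2 ⟨h0.ne', h1.ne⟩
  have hint := integrable_piLower hlam hρ h0 h1 hα
  have hF : ∀ j y, ∫ z in Iic y, piLower lam a γ j z = (∫ z in Iic 0, piLower lam a γ j z) +
      ∫ z in (0 : ℝ)..y, piLower lam a γ j z := fun j y => by
    rw [← intervalIntegral.integral_Iic_sub_Iic (hint j).integrableOn (hint j).integrableOn]
    ring
  have hcont : ∀ j, Continuous fun y => ∫ z in Iic y, piLower lam a γ j z := fun j => by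
    rw [funext (hF j)]
    exact continuous_const.add
      (intervalIntegral.continuous_primitive (fun _ _ => (hint j).intervalIntegrable) 0)
  have hc : ContinuousAt (piLower lam a γ i) y := by
    have hden : γ i * (y - rho a γ i) ≠ 0 := mul_ne_zero (hγ i) (sub_ne_zero.2 hy)
    have hc1 : ContinuousAt (fun y => (lam i * (∫ z in Iic y, piLower lam a γ i z) -
        lam (1 - i) * ∫ z in Iic y, piLower lam a γ (1 - i) z) / (γ i * (y - rho a γ i))) y :=
      (((hcont i).const_mul _).sub ((hcont (1 - i)).const_mul _)).continuousAt.div (by fun_prop) hden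
    refine hc1.congr ?_
    filter_upwards [eventually_ne_nhds hy] with x hx
    rw [← gamma_mul_piLower hlam hρ h0 h1 hα,
      mul_div_cancel_left₀ _ (mul_ne_zero (hγ i) (sub_ne_zero.2 hx))]
  rw [funext (hF i)]
  exact (intervalIntegral.integral_hasDerivAt_right (hint i).intervalIntegrable
    (measurable_piLower i).stronglyMeasurable.stronglyMeasurableAtFilter hc).const_add _

lemma hasDerivAt_integral_Iic_piLower_flow (i : Fin 2) (s x : ℝ) :
    HasDerivAt (fun s => ∫ z in Iic (flow a γ i (-s) x), piLower lam a γ i z)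
      (lam i * (∫ z in Iic (flow a γ i (-s) x), piLower lam a γ i z) -
        lam (1 - i) * ∫ z in Iic (flow a γ i (-s) x), piLower lam a γ (1 - i) z) s := by
  rw [← gamma_mul_piLower hlam hρ h0 h1 hα]
  -- At the fixed point `ρ_i` the density may be singular, but the flow does not move and the
  -- function of `s` is constant.
  rcases eq_or_ne x (rho a γ i) with hx | hx
  · have hconst : ∀ s, flow a γ i s x = rho a γ i := fun s => by simp [flow, hx]
    simpa only [hconst, sub_self, mul_zero, zero_mul] using hasDerivAt_const s _
  · have hd : HasDerivAt (fun s => flow a γ i (-s) x)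
        (γ i * (flow a γ i (-s) x - rho a γ i)) s := by
      have he := (((hasDerivAt_id s).const_mul (γ i)).exp.const_mul (x - rho a γ i)).const_add
        (rho a γ i)
      simp only [flow, mul_neg, neg_neg, add_sub_cancel_left]
      refine he.congr_deriv ?_
      simp only [id]
      ring
    have hne : flow a γ i (-s) x ≠ rho a γ i := by
      rw [flow, Ne, add_eq_left]
      exact mul_ne_zero (sub_ne_zero.2 hx) (Real.exp_pos _).ne'
    refine ((hasDerivAt_integral_Iic_piLower hlam hρ h0 h1 hα hne).comp s hd).congr_deriv ?_
    ring

lemma integral_piLower_eq_lintegral (i : Fin 2) {A : Set ℝ} :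
    ENNReal.ofReal (∫ x in A, piLower lam a γ i x) =
      ∫⁻ x in A, ENNReal.ofReal (piLower lam a γ i x) :=
  ofReal_integral_eq_lintegral_ofReal (integrable_piLower hlam hρ h0 h1 hα i).integrableOn
    (ae_of_all _ (piLower_nonneg hlam hρ h0 h1 hα i))

/-- With `F_i` the distribution functions and `x_s` the backward flow of state `i`, the derivative
of `exp (-λ_i s) F_i(x_s)` is `-λ_{1-i} exp (-λ_i s) F_{1-i}(x_s)`. Integrating over `s > 0` gives
the balance equation on half-lines, which determine finite measures. -/
lemma isBalanced_piLower : IsBalanced lam a γ fun i =>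
    volume.withDensity fun x => ENNReal.ofReal (piLower lam a γ i x) := by
  have hint := integrable_piLower hlam hρ h0 h1 hα
  have hfin : ∀ i, IsFiniteMeasure
      (volume.withDensity fun x => ENNReal.ofReal (piLower lam a γ i x)) := fun i =>
    isFiniteMeasure_withDensity_ofReal (hint i).2
  have hreal : ∀ i x, (volume.withDensity fun x => ENNReal.ofReal (piLower lam a γ i x)).real
      (Iic x) = ∫ z in Iic x, piLower lam a γ i z := fun i x => by
    rw [measureReal_def, withDensity_apply _ measurableSet_Iic,
      ← integral_piLower_eq_lintegral hlam hρ h0 h1 hα, ENNReal.toReal_ofReal]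
    exact integral_nonneg (piLower_nonneg hlam hρ h0 h1 hα i)
  have hmeas : ∀ i j x, Measurable fun s => ∫ z in Iic (flow a γ i (-s) x), piLower lam a γ j z := by
    intro i j x
    simp only [← hreal]
    exact (measurable_real_Iic _).comp (by unfold flow; fun_prop)
  have hbound : ∀ i j x s, |∫ z in Iic (flow a γ i (-s) x), piLower lam a γ j z| ≤
      (volume.withDensity fun x => ENNReal.ofReal (piLower lam a γ j x)).real univ := by
    intro i j x s
    rw [← hreal]
    exact abs_real_Iic_le _ _
  refine isBalanced_of_real_Iic hlam fun i x => ?_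
  simp only [hreal]
  have hexp : ∀ s, HasDerivAt (fun s => Real.exp (-(lam i * s)))
      (-lam i * Real.exp (-(lam i * s))) s := fun s => by
    refine ((hasDerivAt_id s).const_mul (lam i)).fun_neg.exp.congr_deriv ?_
    simp only [id]
    ring
  have hd : ∀ s, HasDerivAt (fun s => Real.exp (-(lam i * s)) *
      ∫ z in Iic (flow a γ i (-s) x), piLower lam a γ i z) (-lam (1 - i) *
        (Real.exp (-(lam i * s)) * ∫ z in Iic (flow a γ i (-s) x), piLower lam a γ (1 - i) z)) s :=
    fun s => by
      refine ((hexp s).mul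
        (hasDerivAt_integral_Iic_piLower_flow hlam hρ h0 h1 hα i s x)).congr_deriv ?_
      ring
  have hlim : Tendsto (fun s => Real.exp (-(lam i * s)) *
      ∫ z in Iic (flow a γ i (-s) x), piLower lam a γ i z) atTop (𝓝 0) := by
    refine Tendsto.zero_mul_isBoundedUnder_le ?_ (isBoundedUnder_of ⟨_, hbound i i x⟩)
    exact Real.tendsto_exp_neg_atTop_nhds_zero.comp (tendsto_id.const_mul_atTop (hlam i))
  have h := integral_Ioi_of_hasDerivAt_of_tendsto' (a := 0) (fun s _ => hd s)
    ((integrableOn_exp_mul_of_bounded (hlam i) (hmeas i (1 - i) x)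
      (hbound i (1 - i) x)).const_mul _) hlim
  rw [integral_const_mul] at h
  have hx0 : flow a γ i 0 x = x := by simp [flow]
  simp only [neg_zero, mul_zero, Real.exp_zero, one_mul, hx0] at h
  linarith

end

/-- In the case `γ 1 < 0 < γ 0` the invariant probability measures are given by `piLower`. -/
theorem isInvariantProbability_iff_eq_piLower (hlam : ∀ i, 0 < lam i)
    (hρ : rho a γ 0 < rho a γ 1) (h0 : 0 < γ 0) (h1 : γ 1 < 0) (μ : Measure (ℝ × Fin 2)) :
    IsInvariantProbability lam a γ μ ↔
      alpha lam γ 0 + alpha lam γ 1 < 0 ∧ μ = densityMeasure (piLower lam a γ) := by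
  have hγ : ∀ i, γ i ≠ 0 := Fin.forall_fin_two.2 ⟨h0.ne', h1.ne⟩
  have hsect := sect_densityMeasure (p := piLower lam a γ) measurable_piLower
  rw [isInvariantProbability_iff hlam hγ]
  constructor
  · rintro ⟨hμ, hb⟩
    obtain ⟨hα, hm⟩ := hb.eq_withDensity hlam hγ (by rw [sect_univ_add, measure_univ]) hρ h0 h1
    exact ⟨hα, ext_sect fun i => by rw [hm, hsect]⟩
  · rintro ⟨hα, rfl⟩
    refine ⟨⟨?_⟩, ?_⟩
    · rw [← sect_univ_add, hsect, hsect, withDensity_apply _ MeasurableSet.univ,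
        withDensity_apply _ MeasurableSet.univ, ← integral_piLower_eq_lintegral hlam hρ h0 h1 hα,
        ← integral_piLower_eq_lintegral hlam hρ h0 h1 hα, setIntegral_univ, setIntegral_univ,
        ← ENNReal.ofReal_add (integral_nonneg (piLower_nonneg hlam hρ h0 h1 hα 0))
          (integral_nonneg (piLower_nonneg hlam hρ h0 h1 hα 1)),
        integral_piLower_add hlam hρ h0 h1 hα, ENNReal.ofReal_one]
    · rw [funext hsect]
      exact isBalanced_piLower hlam hρ h0 h1 hα

end KacOU
end

/-! ### Transfer by reflection to the case of attracting state 1 -/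

noncomputable section

open scoped ENNReal

namespace KacOU

/-- The parameters after the reflection `(x, i) ↦ (-x, 1 - i)`. -/
def swap (v : Fin 2 → ℝ) (i : Fin 2) : ℝ := v (1 - i)

/-- The space coordinate changes its sign under the reflection. -/
def negSwap (v : Fin 2 → ℝ) (i : Fin 2) : ℝ := -v (1 - i)

variable {lam a γ : Fin 2 → ℝ}

@[simp] lemma swap_zero (v : Fin 2 → ℝ) : swap v 0 = v 1 := rfl

@[simp] lemma swap_one (v : Fin 2 → ℝ) : swap v 1 = v 0 := rfl

lemma swap_swap (v : Fin 2 → ℝ) : swap (swap v) = v :=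
  funext fun i => congrArg v (one_sub_one_sub i)

lemma negSwap_negSwap (v : Fin 2 → ℝ) : negSwap (negSwap v) = v := by
  funext i
  simp [negSwap]

lemma rho_swap (i : Fin 2) : rho (negSwap a) (swap γ) i = -rho a γ (1 - i) := by
  simp only [rho, negSwap, swap, neg_div]

lemma alpha_swap (i : Fin 2) : alpha (swap lam) (swap γ) i = alpha lam γ (1 - i) := rfl

lemma c₀_swap : c₀ (swap lam) (negSwap a) (swap γ) = c₁ lam a γ := by
  simp only [c₀, c₁, rho_swap, alpha_swap, sub_zero, sub_self, swap_zero, swap_one]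
  ring_nf

lemma piLower_swap (i : Fin 2) (x : ℝ) :
    piLower (swap lam) (negSwap a) (swap γ) (1 - i) (-x) = piUpper lam a γ i x := by
  have hind : (-x < -rho a γ 1) = (rho a γ 1 < x) := propext neg_lt_neg_iff
  revert i
  refine Fin.forall_fin_two.2 ⟨?_, ?_⟩
  · simp only [piLower, piUpper, sub_zero, Matrix.cons_val_one, Matrix.cons_val_zero, c₀_swap,
      rho_swap, alpha_swap, sub_self, swap_one, indicator, mem_Iio, mem_Ioi, hind]
    split_ifs <;> ring_nf
  · simp only [piLower, piUpper, sub_zero, Matrix.cons_val_one, Matrix.cons_val_zero, c₀_swap,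
      rho_swap, alpha_swap, sub_self, swap_zero, indicator, mem_Iio, mem_Ioi, hind]
    split_ifs <;> ring_nf

lemma measurable_piUpper (i : Fin 2) : Measurable (piUpper lam a γ i) := by
  rw [← funext (piLower_swap i)]
  exact (measurable_piLower (1 - i)).comp measurable_neg

/-- The image of a measure under the reflection `(x, i) ↦ (-x, 1 - i)`. -/
def reflection (μ : Measure (ℝ × Fin 2)) : Measure (ℝ × Fin 2) :=
  μ.map fun z => (-z.1, 1 - z.2)

lemma measurable_reflection : Measurable fun z : ℝ × Fin 2 => (-z.1, 1 - z.2) :=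
  measurable_fst.neg.prodMk (measurable_from_top.comp measurable_snd)

lemma sect_reflection (μ : Measure (ℝ × Fin 2)) (i : Fin 2) :
    sect (reflection μ) i = (sect μ (1 - i)).map fun x => -x := by
  ext A hA
  rw [sect_apply, reflection, Measure.map_apply measurable_reflection
    ((measurableEmbedding_pair i).measurableSet_image.2 hA), Measure.map_apply measurable_neg hA,
    sect_apply]
  congr 1
  ext ⟨x, j⟩
  simp only [mem_preimage, mem_image, Prod.mk.injEq]
  constructor
  · rintro ⟨y, hy, rfl, rfl⟩
    exact ⟨x, hy, rfl, one_sub_one_sub j⟩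
  · rintro ⟨y, hy, rfl, rfl⟩
    exact ⟨-y, hy, rfl, (one_sub_one_sub i).symm⟩

lemma reflection_reflection (μ : Measure (ℝ × Fin 2)) : reflection (reflection μ) = μ := by
  rw [reflection, reflection, Measure.map_map measurable_reflection measurable_reflection]
  convert Measure.map_id
  funext z
  simp

lemma IsInvariantProbability.reflection (hlam : ∀ i, 0 < lam i) (hγ : ∀ i, γ i ≠ 0)
    {μ : Measure (ℝ × Fin 2)} (h : IsInvariantProbability lam a γ μ) :
    IsInvariantProbability (swap lam) (negSwap a) (swap γ) (KacOU.reflection μ) := by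
  obtain ⟨hμ, hb⟩ := (isInvariantProbability_iff hlam hγ μ).1 h
  refine (isInvariantProbability_iff (fun i => hlam (1 - i)) (fun i => hγ (1 - i)) _).2
    ⟨Measure.isProbabilityMeasure_map measurable_reflection.aemeasurable, ?_⟩
  rw [funext (sect_reflection μ)]
  exact hb.reflect

/-- The reflection is an involution on measures and on parameters, so the one-sided transfer applied
twice gives the converse. -/
lemma isInvariantProbability_reflection_iff (hlam : ∀ i, 0 < lam i) (hγ : ∀ i, γ i ≠ 0)
    (μ : Measure (ℝ × Fin 2)) : IsInvariantProbability lam a γ μ ↔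
      IsInvariantProbability (swap lam) (negSwap a) (swap γ) (reflection μ) := by
  refine ⟨IsInvariantProbability.reflection hlam hγ, fun h => ?_⟩
  have h2 := h.reflection (lam := swap lam) (γ := swap γ) (fun i => hlam (1 - i)) fun i => hγ (1 - i)
  rwa [swap_swap, swap_swap, negSwap_negSwap, reflection_reflection] at h2

lemma map_neg_withDensity (f : ℝ → ℝ≥0∞) : (volume.withDensity f).map (fun x : ℝ => -x) =
    volume.withDensity fun x => f (-x) := by
  ext A hA
  rw [Measure.map_apply measurable_neg hA, withDensity_apply _ hA,
    withDensity_apply _ (measurable_neg hA),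
    ← (Measure.measurePreserving_neg (volume : Measure ℝ)).setLIntegral_comp_preimage_emb
      (Homeomorph.neg ℝ).measurableEmbedding]
  congr 2
  ext x
  simp

lemma reflection_densityMeasure :
    reflection (densityMeasure (piLower (swap lam) (negSwap a) (swap γ))) =
      densityMeasure (piUpper lam a γ) := by
  refine ext_sect fun i => ?_
  rw [sect_reflection, sect_densityMeasure measurable_piLower,
    sect_densityMeasure measurable_piUpper, map_neg_withDensity]
  simp only [piLower_swap]

/-- In the case `γ 0 < 0 < γ 1` the invariant probability measures are given by `piUpper`. -/
theorem isInvariantProbability_iff_eq_piUpper (hlam : ∀ i, 0 < lam i)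
    (hρ : rho a γ 0 < rho a γ 1) (h0 : γ 0 < 0) (h1 : 0 < γ 1) (μ : Measure (ℝ × Fin 2)) :
    IsInvariantProbability lam a γ μ ↔
      alpha lam γ 0 + alpha lam γ 1 < 0 ∧ μ = densityMeasure (piUpper lam a γ) := by
  have hγ : ∀ i, γ i ≠ 0 := Fin.forall_fin_two.2 ⟨h0.ne, h1.ne'⟩
  rw [isInvariantProbability_reflection_iff hlam hγ,
    isInvariantProbability_iff_eq_piLower (lam := swap lam) (γ := swap γ) (fun i => hlam (1 - i))
      (by simpa only [rho_swap, sub_zero, sub_self] using neg_lt_neg hρ) h1 h0,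
    ← reflection_densityMeasure, alpha_swap, alpha_swap, add_comm]
  refine and_congr Iff.rfl ⟨fun h => ?_, fun h => ?_⟩
  · rw [← h, reflection_reflection]
  · rw [h, reflection_reflection]

lemma IsStationaryDensityOn.reflection {K : Set ℝ} {p : Fin 2 → ℝ → ℝ}
    (h : IsStationaryDensityOn lam a γ K p) :
    IsStationaryDensityOn (swap lam) (negSwap a) (swap γ) ((fun x => -x) ⁻¹' K)
      fun i x => p (1 - i) (-x) := by
  have hemb : MeasurableEmbedding fun x : ℝ => -x := (Homeomorph.neg ℝ).measurableEmbedding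
  have hmp := Measure.measurePreserving_neg (volume : Measure ℝ)
  have hsum : (fun x => p (1 - 0) (-x) + p (1 - 1) (-x)) = fun x => p 0 (-x) + p 1 (-x) :=
    funext fun x => add_comm _ _
  refine ⟨fun i x hx => ?_, fun i x hx => ?_, fun i b hb => ?_, fun i x hx => h.nonneg _ _ hx,
    ?_, ?_⟩
  · exact (h.differentiable (1 - i) (-x) hx).comp x differentiable_neg.differentiableAt
  · have he := h.equation (1 - i) (-x) hx
    rw [deriv_comp_neg]
    simp only [swap, negSwap]
    linear_combination he
  · have hb' : -b ∈ frontier K := by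
      rw [show (fun x : ℝ => -x) ⁻¹' K = Homeomorph.neg ℝ ⁻¹' K from rfl,
        ← Homeomorph.preimage_frontier] at hb
      exact hb
    have ht : Tendsto (fun x : ℝ => -x) (𝓝[(fun x => -x) ⁻¹' K] b) (𝓝[K] (-b)) :=
      continuous_neg.continuousWithinAt.tendsto_nhdsWithin fun x hx => hx
    have h2 := ((h.boundary (1 - i) (-b) hb').comp ht).neg
    rw [neg_zero] at h2
    refine h2.congr fun x => ?_
    simp only [Function.comp, swap, negSwap]
    ring
  · rw [hsum]
    exact (hmp.integrableOn_comp_preimage hemb).2 h.integrable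
  · rw [hsum]
    exact (hmp.setIntegral_preimage_emb hemb (fun x => p 0 x + p 1 x) K).trans h.integral_eq_one

lemma isStationaryDensityOn_Ioi_iff {p : Fin 2 → ℝ → ℝ} :
    IsStationaryDensityOn lam a γ (Ioi (rho a γ 1)) p ↔
      IsStationaryDensityOn (swap lam) (negSwap a) (swap γ) (Iio (rho (negSwap a) (swap γ) 0))
        fun i x => p (1 - i) (-x) := by
  have hK : (fun x => -x) ⁻¹' Ioi (rho a γ 1) = Iio (rho (negSwap a) (swap γ) 0) := by
    ext x
    rw [rho_swap, mem_preimage, mem_Ioi, mem_Iio, lt_neg]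
    rfl
  have hK' : (fun x => -x) ⁻¹' Iio (rho (negSwap a) (swap γ) 0) = Ioi (rho a γ 1) := by
    rw [← hK]
    ext x
    simp
  refine ⟨fun h => hK ▸ h.reflection, fun h => ?_⟩
  have h2 := h.reflection
  rw [hK', swap_swap, swap_swap, negSwap_negSwap] at h2
  simpa only [one_sub_one_sub, neg_neg] using h2

lemma isStationaryDensityOn_lower_iff (hlam : ∀ i, 0 < lam i) (hρ : rho a γ 0 < rho a γ 1)
    (h0 : 0 < γ 0) (h1 : γ 1 < 0) {p : Fin 2 → ℝ → ℝ} :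
    IsStationaryDensityOn lam a γ (Iio (rho a γ 0)) p ↔
      alpha lam γ 0 + alpha lam γ 1 < 0 ∧
        ∀ i, EqOn (p i) (piLower lam a γ i) (Iio (rho a γ 0)) := by
  have hγ : ∀ i, γ i ≠ 0 := Fin.forall_fin_two.2 ⟨h0.ne', h1.ne⟩
  exact ⟨isStationaryDensityOn_lower hlam hγ hρ h0 h1, fun h =>
    isStationaryDensityOn_of_eqOn_piLower hlam hγ hρ h0 h1 h.1 h.2⟩

lemma isStationaryDensityOn_upper_iff (hlam : ∀ i, 0 < lam i) (hρ : rho a γ 0 < rho a γ 1)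
    (h0 : γ 0 < 0) (h1 : 0 < γ 1) {p : Fin 2 → ℝ → ℝ} :
    IsStationaryDensityOn lam a γ (Ioi (rho a γ 1)) p ↔
      alpha lam γ 0 + alpha lam γ 1 < 0 ∧
        ∀ i, EqOn (p i) (piUpper lam a γ i) (Ioi (rho a γ 1)) := by
  rw [isStationaryDensityOn_Ioi_iff,
    isStationaryDensityOn_lower_iff (lam := swap lam) (γ := swap γ) (fun i => hlam (1 - i))
      (by simpa only [rho_swap, sub_zero, sub_self] using neg_lt_neg hρ) h1 h0,
    alpha_swap, alpha_swap, add_comm, rho_swap]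
  refine and_congr Iff.rfl ⟨fun h i x hx => ?_, fun h i x hx => ?_⟩
  · have h2 := h (1 - i) (x := -x) (mem_Iio.2 (neg_lt_neg (mem_Ioi.1 hx)))
    simpa only [piLower_swap, one_sub_one_sub, neg_neg] using h2
  · have hx' : rho a γ 1 < -x := lt_neg.1 hx
    have h2 := h (1 - i) hx'
    rw [← piLower_swap, one_sub_one_sub, neg_neg] at h2
    exact h2

lemma c₁_pos (hlam : ∀ i, 0 < lam i) (hρ : rho a γ 0 < rho a γ 1) (h0 : γ 0 < 0) (h1 : 0 < γ 1)
    (hα : alpha lam γ 0 + alpha lam γ 1 < 0) : 0 < c₁ lam a γ := by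
  rw [← c₀_swap]
  refine (integral_profile (lam := swap lam) (γ := swap γ) (fun i => hlam (1 - i))
    (by simpa only [rho_swap, sub_zero, sub_self] using neg_lt_neg hρ) h1 h0 ?_).2.2
  rwa [alpha_swap, alpha_swap, add_comm]

lemma exists_iff_of_forall_iff {α : Type*} {P : α → Prop} {Q : Prop} {R : α → Prop}
    (h : ∀ x, P x ↔ Q ∧ R x) (hR : ∃ x, R x) : (∃ x, P x) ↔ Q :=
  ⟨fun ⟨x, hx⟩ => ((h x).1 hx).1, fun hQ => hR.imp fun x hx => (h x).2 ⟨hQ, hx⟩⟩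

end KacOU
end

theorem mainTheorem4 (lam a γ : Fin 2 → ℝ) (hlam : ∀ i, 0 < lam i)
    (hρ : KacOU.rho a γ 0 < KacOU.rho a γ 1) :
    (γ 1 < 0 → 0 < γ 0 →
      (KacOU.alpha lam γ 0 + KacOU.alpha lam γ 1 < 0 →
        (0 < KacOU.c₀ lam a γ * (γ 0)⁻¹ ∧ 0 < -KacOU.c₀ lam a γ * (γ 1)⁻¹) ∧
        (∀ μ : Measure (ℝ × Fin 2), KacOU.IsInvariantProbability lam a γ μ ↔
          μ = KacOU.densityMeasure (KacOU.piLower lam a γ)) ∧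
        (∀ p : Fin 2 → ℝ → ℝ,
          KacOU.IsStationaryDensityOn lam a γ (Set.Iio (KacOU.rho a γ 0)) p ↔
          ∀ i, Set.EqOn (p i) (KacOU.piLower lam a γ i) (Set.Iio (KacOU.rho a γ 0)))) ∧
      ((∃ μ : Measure (ℝ × Fin 2), KacOU.IsInvariantProbability lam a γ μ) ↔
        KacOU.alpha lam γ 0 + KacOU.alpha lam γ 1 < 0) ∧
      ((∃ p : Fin 2 → ℝ → ℝ,
          KacOU.IsStationaryDensityOn lam a γ (Set.Iio (KacOU.rho a γ 0)) p) ↔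
        KacOU.alpha lam γ 0 + KacOU.alpha lam γ 1 < 0)) ∧
    (γ 0 < 0 → 0 < γ 1 →
      (KacOU.alpha lam γ 0 + KacOU.alpha lam γ 1 < 0 →
        (0 < -KacOU.c₁ lam a γ * (γ 0)⁻¹ ∧ 0 < KacOU.c₁ lam a γ * (γ 1)⁻¹) ∧
        (∀ μ : Measure (ℝ × Fin 2), KacOU.IsInvariantProbability lam a γ μ ↔
          μ = KacOU.densityMeasure (KacOU.piUpper lam a γ)) ∧
        (∀ p : Fin 2 → ℝ → ℝ,
          KacOU.IsStationaryDensityOn lam a γ (Set.Ioi (KacOU.rho a γ 1)) p ↔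
          ∀ i, Set.EqOn (p i) (KacOU.piUpper lam a γ i) (Set.Ioi (KacOU.rho a γ 1)))) ∧
      ((∃ μ : Measure (ℝ × Fin 2), KacOU.IsInvariantProbability lam a γ μ) ↔
        KacOU.alpha lam γ 0 + KacOU.alpha lam γ 1 < 0) ∧
      ((∃ p : Fin 2 → ℝ → ℝ,
          KacOU.IsStationaryDensityOn lam a γ (Set.Ioi (KacOU.rho a γ 1)) p) ↔
        KacOU.alpha lam γ 0 + KacOU.alpha lam γ 1 < 0)) ∧
    (γ 0 < 0 → γ 1 < 0 →
      ¬ ∃ μ : Measure (ℝ × Fin 2), KacOU.IsInvariantProbability lam a γ μ) := by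
  refine ⟨fun h1 h0 => ?_, fun h0 h1 => ?_, fun h0 h1 => ?_⟩
  · have hinv := KacOU.isInvariantProbability_iff_eq_piLower hlam hρ h0 h1
    have hst := fun p => KacOU.isStationaryDensityOn_lower_iff (p := p) hlam hρ h0 h1
    refine ⟨fun hα => ⟨?_, fun μ => ?_, fun p => ?_⟩,
      KacOU.exists_iff_of_forall_iff hinv ⟨_, rfl⟩,
      KacOU.exists_iff_of_forall_iff hst ⟨_, fun i => Set.eqOn_refl _ _⟩⟩
    · have hc := (KacOU.integral_profile hlam hρ h0 h1 hα).2.2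
      exact ⟨mul_pos hc (inv_pos.2 h0), mul_pos_of_neg_of_neg (neg_lt_zero.2 hc) (inv_lt_zero.2 h1)⟩
    · rw [hinv, and_iff_right hα]
    · rw [hst, and_iff_right hα]
  · have hinv := KacOU.isInvariantProbability_iff_eq_piUpper hlam hρ h0 h1
    have hst := fun p => KacOU.isStationaryDensityOn_upper_iff (p := p) hlam hρ h0 h1
    refine ⟨fun hα => ⟨?_, fun μ => ?_, fun p => ?_⟩,
      KacOU.exists_iff_of_forall_iff hinv ⟨_, rfl⟩,
      KacOU.exists_iff_of_forall_iff hst ⟨_, fun i => Set.eqOn_refl _ _⟩⟩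
    · have hc := KacOU.c₁_pos hlam hρ h0 h1 hα
      exact ⟨mul_pos_of_neg_of_neg (neg_lt_zero.2 hc) (inv_lt_zero.2 h0), mul_pos hc (inv_pos.2 h1)⟩
    · rw [hinv, and_iff_right hα]
    · rw [hst, and_iff_right hα]
  · rintro ⟨μ, hμ⟩
    obtain ⟨hprob, hb⟩ := (KacOU.isInvariantProbability_iff hlam
      (Fin.forall_fin_two.2 ⟨h0.ne, h1.ne⟩) μ).1 hμ
    have hzero := hb.eq_zero_of_neg hlam hρ h0 h1
    have huniv := KacOU.sect_univ_add μ
    rw [hzero, hzero, MeasureTheory.measure_univ, add_zero] at huniv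
    exact zero_ne_one huniv
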